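/- **Setting.** Let $n\ge 1$. Points of $\mathbb R^{n+1}$ are written $z=(x,t)$. Put $d_p(z_1,z_2)=\max\{|x_1-x_2|,\sqrt{|t_1-t_2|}\}$. *Constants.* Fix $\mathfrak p^-\le\mathfrak p^+$ with $\mathfrak p^->\max\{1,\frac{2n}{n+2}\}$, $L>0$, $m_\varepsilon>0$, and fix constants $q>1$ and $\beta_0$ with $0<\beta_0<1-\frac1q$, $\beta_0\le\frac12$, $\mathfrak p^--\beta_0>\frac{2n}{n+2}$. *Exponent.* Let $p:\mathbb R^{n+1}\to[\mathfrak p^-,\mathfrak p^+]$ be measurable with $|p(z_1)-p(z_2)|\le \frac{L}{-\log|z_1-z_2|}$ whenever $d_p(z_1,z_2)\le\frac12$. Let $\omega:[0,\infty)\to[0,\infty)$ be a continuous non-decreasing modulus, with $\omega(r)\to0$ as $r\to0$, $|p(z_1)-p(z_2)|\le\omega(d_p(z_1,z_2))$ for all $z_1,z_2$, and $\omega(r)\log\frac1r\le L$ for $0<r\le\frac12$. *Domain and operator.* Let $\Omega\subset\mathbb R^n$ be a bounded domain with $|\Omega^c\cap B_r(y)|\ge m_\varepsilon|B_r(y)|$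 for all $y\in\partial\Omega$, $r>0$. Let $T>0$ and $\Omega_T=\Omega\times(-T,T)$. Let $\mathcal A(x,t,\zeta)$ be a Carathéodory function with $\langle\mathcal A(z,\zeta),\zeta\rangle\ge\Lambda_0|\zeta|^{p(z)}-h_1$ and $|\mathcal A(z,\zeta)|\le\Lambda_1(1+|\zeta|)^{p(z)-1}$ for a.e. $z\in\Omega_T$ and all $\zeta$, where $\Lambda_0,\Lambda_1>0$ and $h_1\in\mathbb R$. *Solution.* Let $\beta\in(0,\beta_0)$ with $p(\cdot)(1-\beta)>1$, and let $u\in L^2(-T,T;L^2(\Omega))\cap L^{p(\cdot)(1-\beta)}(-T,T;W^{1,p(\cdot)(1-\beta)}_0(\Omega))$ be a very weak solution of $u_t-\operatorname{div}\mathcal A(x,t,\nabla u)=0$ in $\Omega_T$, $u=0$ on $\partial\Omega\times(-T,T)$. That is, $\mathcal A(\cdot,\nabla u)\in L^1(\Omega_T)$ and, with Steklov averages $[v]_h(x,t)=\frac1h\int_t^{t+h}v(x,\tau)\,d\tau$, one has $\int_\Omega \partial_t[u]_h\,\phi+\langle[\mathcal A(\cdot,\nabla u)]_h,\nabla\phi\rangle\,dx=0$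 for all $h\in(0,2T)$, all $\phi\in C_c^\infty(\Omega)$ and a.e. $t\in(-T,T-h)$. Extend $u,\nabla u$ by $0$ outside $\Omega_T$, and put $\mathbf M_0=\iint_{\Omega_T}(|u|+|\nabla u|+1)^{p(z)(1-\beta)}dz$. *Scale.* Let $z_0\in\partial\Omega\times(-T,T)$ and let $\rho_0\in(0,1)$. Put $\mathfrak Q=B_{128\rho_0}(x_0)\times(t_0-(128\rho_0)^2,t_0+(128\rho_0)^2)$, $p^-=\inf_{\mathfrak Q}p$, $p^+=\sup_{\mathfrak Q}p$. Assume $\rho_0\le\frac1{1024\mathbf M_0}$, $\;p^+-p^-\le\omega(512\rho_0)\le\frac12\min\{\frac1{n+2},\frac14\}$ and $\omega(\rho_0)\le\frac{L}{\log(1/\rho_0)}\le\frac1n$. *Scaling exponent.* Let $d$ satisfy $\frac{2n}{(n+2)p^-}<d<\min\{\frac2{p^+},1\}$, and assume $q<\frac{p^-}{p^+-1}$ and $2\beta_0\le\frac{d(n+2)}2-\frac n{p^-}$. For $\mu,r>0$ set $$Q_r^\mu(z)=B_{\mu^{-\frac1{p(z)}+\frac d2}r}(x)\times\bigl(t-\mu^{-1+d}r^2,\;t+\mu^{-1+d}r^2\bigr),$$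 $$d_z^\mu(z_1,z_2)=\max\Bigl\{\mu^{\frac1{p(z)}-\frac d2}|x_1-x_2|,\ \sqrt{\mu^{1-d}|t_1-t_2|}\Bigr\}.$$ *Bad set.* Let $\alpha_0\ge1$ and $0<128\rho\le\rho_0$ satisfy $$\alpha_0^{1-\beta}\le\frac{1}{|Q_\rho^{\alpha_0}(z_0)|}\iint_{Q_\rho^{\alpha_0}(z_0)}(|\nabla u|+1)^{p(z)(1-\beta)}dz,\qquad \frac{1}{|Q_{16\rho}^{\alpha_0}(z_0)|}\iint_{Q_{16\rho}^{\alpha_0}(z_0)}(|\nabla u|+1)^{p(z)(1-\beta)}dz\le\alpha_0^{1-\beta},$$ and let $\rho\le\rho_a<\rho_b\le16\rho$. Let $\mathcal M$ be the strong maximal function (supremum of averages over all cylinders $B_a(y)\times(s-b,s+b)$, $a,b>0$, containing the point). For $\lambda\ge\alpha_0$ put $$g=\mathcal M\Bigl(\Bigl[|\nabla u|+1+\tfrac{|u|}{\alpha_0^{-1/p(z_0)+d/2}\rho}\Bigr]^{\frac{p(\cdot)}q}\chi_{Q_{\rho_b}^{\alpha_0}(z_0)}\Bigr)^{q(1-\beta)},\qquad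 E_\lambda=\{z\in\mathbb R^{n+1}:g(z)\le\lambda^{1-\beta}\},$$ and $\rho_z=\inf_{w\in E_\lambda}d_z^\lambda(z,w)$. **Statement.** There is a constant $\mathfrak X\ge9$, depending only on $n,\mathfrak p^\pm,L,m_\varepsilon$ and the fixed constants $q,\beta_0$ (and not on $p,\Omega,T,\mathcal A,\Lambda_0,\Lambda_1,h_1,\beta,u,z_0,\rho_0,d,\alpha_0,\rho,\rho_a,\rho_b,\lambda$), such that in every such setting $E_\lambda\ne\emptyset$, $\rho_z>0$ for all $z\in Q_{\rho_b}^{\alpha_0}(z_0)\setminus E_\lambda$, and for every $\mathfrak t\in(0,1)$ the open covering $\mathcal F=\{Q^\lambda_{\mathfrak t\rho_z}(z)\}_{z\in Q_{\rho_b}^{\alpha_0}(z_0)\setminus E_\lambda}$ has a countable pairwise disjoint subfamily $\{Q^\lambda_{\mathfrak t\rho_{z_i}}(z_i)\}_i$ with $$\bigcup_{z}Q^\lambda_{\mathfrak t\rho_z}(z)\subset\bigcup_iQ^\lambda_{\mathfrak X\mathfrak t\rho_{z_i}}(z_i)\qquad\text{and}\qquad \bigcup_{z}Q^\lambda_{\rho_z}(z)\subset\bigcup_iQ^\lambda_{\mathfrak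 X\rho_{z_i}}(z_i),$$ where $z$ ranges over $Q_{\rho_b}^{\alpha_0}(z_0)\setminus E_\lambda$. -/

import Mathlib

open MeasureTheory Set Filter Topology
open scoped ENNReal ContDiff

noncomputable section

namespace VarExpParabolic

/-- Space-time `ℝⁿ × ℝ`; the space variable carries the Euclidean norm. -/
abbrev SpaceTime (n : ℕ) : Type := EuclideanSpace ℝ (Fin n) × ℝ

variable {n : ℕ}

/-! ### Metrics, scalings and cylinders -/

/-- The parabolic metric `d_p(z₁,z₂) = max {|x₁-x₂|, √|t₁-t₂|}`. -/
def parDist (z₁ z₂ : SpaceTime n) : ℝ :=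
  max ‖z₁.1 - z₂.1‖ (Real.sqrt |z₁.2 - z₂.2|)

/-- The Euclidean distance of `ℝⁿ⁺¹`. -/
def eucDist (z₁ z₂ : SpaceTime n) : ℝ :=
  Real.sqrt (‖z₁.1 - z₂.1‖ ^ 2 + (z₁.2 - z₂.2) ^ 2)

/-- The spatial scaling factor `μ ^ (-1/p(z) + d/2)`. -/
def scaleX (p : SpaceTime n → ℝ) (d μ : ℝ) (z : SpaceTime n) : ℝ :=
  μ ^ (-(1 / p z) + d / 2)

/-- The time scaling factor `μ ^ (-1 + d)`. -/
def scaleT (d μ : ℝ) : ℝ := μ ^ (-1 + d)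

/-- The localized parabolic metric
`d_z^μ(z₁,z₂) = max {μ^(1/p(z) - d/2) |x₁-x₂|, √(μ^(1-d) |t₁-t₂|)}`. -/
def locDist (p : SpaceTime n → ℝ) (d μ : ℝ) (z z₁ z₂ : SpaceTime n) : ℝ :=
  max (μ ^ (1 / p z - d / 2) * ‖z₁.1 - z₂.1‖) (Real.sqrt (μ ^ (1 - d) * |z₁.2 - z₂.2|))

/-- `d_z^μ(z, A)`, the infimum of `d_z^μ(z, w)` over `w ∈ A`. -/
def locDistSet (p : SpaceTime n → ℝ) (d μ : ℝ) (z : SpaceTime n) (A : Set (SpaceTime n)) : ℝ :=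
  sInf ((fun w => locDist p d μ z z w) '' A)

/-- The cylinder `B_a(x) × (t - b, t + b)`. -/
def cyl (a b : ℝ) (z : SpaceTime n) : Set (SpaceTime n) :=
  Metric.ball z.1 a ×ˢ Ioo (z.2 - b) (z.2 + b)

/-- The intrinsic cylinder `Q_r^μ(z)`. -/
def intrinsicCyl (p : SpaceTime n → ℝ) (d μ r : ℝ) (z : SpaceTime n) : Set (SpaceTime n) :=
  cyl (scaleX p d μ z * r) (scaleT d μ * r ^ 2) z

/-- The space-time domain `Ω × (-T,T)`. -/
def parDomain (Ω : Set (EuclideanSpace ℝ (Fin n))) (T : ℝ) : Set (SpaceTime n) :=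
  Ω ×ˢ Ioo (-T) T

/-! ### The variable exponent and the domain -/

/-- The class `log^±` with bounds `pm`, `pp` and log-Hölder constant `L`. -/
structure IsLogHolderExponent (pm pp L : ℝ) (p : SpaceTime n → ℝ) : Prop where
  measurable : Measurable p
  lower : ∀ z, pm ≤ p z
  upper : ∀ z, p z ≤ pp
  logHolder : ∀ z₁ z₂, parDist z₁ z₂ ≤ 1 / 2 →
    |p z₁ - p z₂| ≤ L / (-Real.log (eucDist z₁ z₂))

/-- `om : [0,∞) → [0,∞)` is a modulus of continuity of `p` with log-Hölder constant `L`. -/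
structure IsLogModulus (L : ℝ) (p : SpaceTime n → ℝ) (om : ℝ → ℝ) : Prop where
  nonneg : ∀ r, 0 ≤ r → 0 ≤ om r
  mono : MonotoneOn om (Ici 0)
  cont : ContinuousOn om (Ici 0)
  tendsto_zero : Tendsto om (𝓝[>] 0) (𝓝 0)
  bound : ∀ z₁ z₂, |p z₁ - p z₂| ≤ om (parDist z₁ z₂)
  logBound : ∀ r, 0 < r → r ≤ 1 / 2 → om r * Real.log (1 / r) ≤ L

/-- A bounded domain whose complement satisfies the uniform measure density condition with
constant `m`. -/
structure IsMeasureDensityDomain (m : ℝ) (Ω : Set (EuclideanSpace ℝ (Fin n))) : Prop where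
  isOpen : IsOpen Ω
  isConnected : IsConnected Ω
  isBounded : Bornology.IsBounded Ω
  density : ∀ y ∈ frontier Ω, ∀ r : ℝ, 0 < r →
    ENNReal.ofReal m * volume (Metric.ball y r) ≤ volume (Ωᶜ ∩ Metric.ball y r)

/-! ### The operator, function spaces and very weak solutions -/

/-- Carathéodory condition, coercivity and growth of `𝒜(x,t,ζ)` on `Ω × (-T,T)`. -/
structure IsAdmissibleOperator (Ω : Set (EuclideanSpace ℝ (Fin n))) (T : ℝ)
    (p : SpaceTime n → ℝ) (Λ₀ Λ₁ h₁ : ℝ)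
    (𝒜 : SpaceTime n → EuclideanSpace ℝ (Fin n) → EuclideanSpace ℝ (Fin n)) : Prop where
  measurable : ∀ ζ, AEMeasurable (fun z => 𝒜 z ζ) (volume.restrict (parDomain Ω T))
  continuous : ∀ᵐ z ∂(volume.restrict (parDomain Ω T)), Continuous (𝒜 z)
  coercive : ∀ᵐ z ∂(volume.restrict (parDomain Ω T)), ∀ ζ,
    Λ₀ * ‖ζ‖ ^ (p z) - h₁ ≤ inner ℝ (𝒜 z ζ) ζ
  growth : ∀ᵐ z ∂(volume.restrict (parDomain Ω T)), ∀ ζ,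
    ‖𝒜 z ζ‖ ≤ Λ₁ * (1 + ‖ζ‖) ^ (p z - 1)

/-- `v ∈ W₀^{1,s(·)}(Ω)` with weak gradient `Dv`: the pair `(v, Dv)` is the limit, in the
modular of the bounded exponent `s(·)`, of `(φ, ∇φ)` with `φ ∈ C_c^∞(Ω)`. -/
def MemSobolevZero (Ω : Set (EuclideanSpace ℝ (Fin n))) (s : EuclideanSpace ℝ (Fin n) → ℝ)
    (v : EuclideanSpace ℝ (Fin n) → ℝ)
    (Dv : EuclideanSpace ℝ (Fin n) → EuclideanSpace ℝ (Fin n)) : Prop :=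
  ∃ φ : ℕ → EuclideanSpace ℝ (Fin n) → ℝ,
    (∀ k, ContDiff ℝ ∞ (φ k) ∧ HasCompactSupport (φ k) ∧ tsupport (φ k) ⊆ Ω) ∧
    Tendsto (fun k => ∫⁻ x in Ω,
      (ENNReal.ofReal (|v x - φ k x| ^ (s x))
        + ENNReal.ofReal (‖Dv x - gradient (φ k) x‖ ^ (s x)))) atTop (𝓝 0)

/-- `u ∈ L²(-T,T;L²(Ω)) ∩ L^{s(·)}(-T,T;W₀^{1,s(·)}(Ω))` with spatial gradient `Du`; both are
extended by `0` outside `Ω × (-T,T)`. -/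
structure MemParabolicSpace (Ω : Set (EuclideanSpace ℝ (Fin n))) (T : ℝ)
    (s : SpaceTime n → ℝ) (u : SpaceTime n → ℝ)
    (Du : SpaceTime n → EuclideanSpace ℝ (Fin n)) : Prop where
  aemeasurable : AEMeasurable u
  aemeasurable_grad : AEMeasurable Du
  zero_outside : ∀ z, z ∉ parDomain Ω T → u z = 0 ∧ Du z = 0
  square_integrable : IntegrableOn (fun z => |u z| ^ 2) (parDomain Ω T)
  integrable : IntegrableOn (fun z => |u z| ^ (s z)) (parDomain Ω T)
  integrable_grad : IntegrableOn (fun z => ‖Du z‖ ^ (s z)) (parDomain Ω T)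
  slice : ∀ᵐ t ∂(volume.restrict (Ioo (-T) T)),
    MemSobolevZero Ω (fun x => s (x, t)) (fun x => u (x, t)) (fun x => Du (x, t))

/-- The Steklov average `[v]_h`. -/
def steklov {F : Type*} [NormedAddCommGroup F] [NormedSpace ℝ F] (T h : ℝ)
    (v : SpaceTime n → F) (z : SpaceTime n) : F :=
  open Classical in
  if z.2 ∈ Ioo (-T) (T - h) then h⁻¹ • ∫ τ in z.2..(z.2 + h), v (z.1, τ) else 0

/-- `u`, with spatial gradient `Du`, is a very weak solution of `u_t - div 𝒜(x,t,∇u) = 0` in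
`Ω × (-T,T)`, `u = 0` on `∂Ω × (-T,T)`, in the Steklov averaged formulation. -/
structure IsVeryWeakSolution (Ω : Set (EuclideanSpace ℝ (Fin n))) (T β : ℝ)
    (p : SpaceTime n → ℝ)
    (𝒜 : SpaceTime n → EuclideanSpace ℝ (Fin n) → EuclideanSpace ℝ (Fin n))
    (u : SpaceTime n → ℝ) (Du : SpaceTime n → EuclideanSpace ℝ (Fin n)) : Prop where
  exponent : ∀ z, 1 < p z * (1 - β)
  mem : MemParabolicSpace Ω T (fun z => p z * (1 - β)) u Du
  flux_integrable : IntegrableOn (fun z => 𝒜 z (Du z)) (parDomain Ω T)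
  equation : ∀ h ∈ Ioo 0 (2 * T), ∀ φ : EuclideanSpace ℝ (Fin n) → ℝ,
    ContDiff ℝ ∞ φ → HasCompactSupport φ → tsupport φ ⊆ Ω →
    ∀ᵐ t ∂(volume.restrict (Ioo (-T) (T - h))),
      ∫ x in Ω, (deriv (fun τ => steklov T h u (x, τ)) t * φ x
        + inner ℝ (steklov T h (fun z => 𝒜 z (Du z)) (x, t)) (gradient φ x)) = 0

/-! ### Maximal function, energy and good set -/

/-- The strong maximal function: supremum of averages over all cylinders `B_a × (τ-b, τ+b)`
that contain the point. -/
def strongMaximal (f : SpaceTime n → ℝ≥0∞) (z : SpaceTime n) : ℝ≥0∞ :=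
  ⨆ (c : SpaceTime n) (a : ℝ) (b : ℝ) (_ : 0 < a) (_ : 0 < b) (_ : z ∈ cyl a b c),
    (volume (cyl a b c))⁻¹ * ∫⁻ w in cyl a b c, f w

/-- `M₀ = ∬_{Ω_T} (|u| + |∇u| + 1)^{p(z)(1-β)} dz`. -/
def energy (Ω : Set (EuclideanSpace ℝ (Fin n))) (T β : ℝ) (p : SpaceTime n → ℝ)
    (u : SpaceTime n → ℝ) (Du : SpaceTime n → EuclideanSpace ℝ (Fin n)) : ℝ :=
  ∫ z in parDomain Ω T, (|u z| + ‖Du z‖ + 1) ^ (p z * (1 - β))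

/-- The function
`g = 𝓜( [|∇u| + 1 + |u| / (scaleX α₀ z₀ ρ)]^{p/q} χ_{Q_{ρ_b}^{α₀}(z₀)} )^{q(1-β)}`. -/
def gFun (p : SpaceTime n → ℝ) (d q β α₀ ρ ρb : ℝ) (z₀ : SpaceTime n)
    (u : SpaceTime n → ℝ) (Du : SpaceTime n → EuclideanSpace ℝ (Fin n))
    (z : SpaceTime n) : ℝ≥0∞ :=
  strongMaximal ((intrinsicCyl p d α₀ ρb z₀).indicator fun w =>
    ENNReal.ofReal ((‖Du w‖ + 1 + |u w| / (scaleX p d α₀ z₀ * ρ)) ^ (p w / q))) z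
      ^ (q * (1 - β))

/-- The good set `E_λ = {g ≤ λ^{1-β}}`. -/
def goodSet (p : SpaceTime n → ℝ) (d q β α₀ ρ ρb : ℝ) (z₀ : SpaceTime n)
    (u : SpaceTime n → ℝ) (Du : SpaceTime n → EuclideanSpace ℝ (Fin n)) (lam : ℝ) :
    Set (SpaceTime n) :=
  {z | gFun p d q β α₀ ρ ρb z₀ u Du z ≤ ENNReal.ofReal (lam ^ (1 - β))}

/-- The bad set `Q_{ρ_b}^{α₀}(z₀) \ E_λ`. -/
def badSet (p : SpaceTime n → ℝ) (d q β α₀ ρ ρb : ℝ) (z₀ : SpaceTime n)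
    (u : SpaceTime n → ℝ) (Du : SpaceTime n → EuclideanSpace ℝ (Fin n)) (lam : ℝ) :
    Set (SpaceTime n) :=
  intrinsicCyl p d α₀ ρb z₀ \ goodSet p d q β α₀ ρ ρb z₀ u Du lam

/-- The radius `ρ_z = d_z^λ(z, E_λ)`. -/
def coverRadius (p : SpaceTime n → ℝ) (d q β α₀ ρ ρb : ℝ) (z₀ : SpaceTime n)
    (u : SpaceTime n → ℝ) (Du : SpaceTime n → EuclideanSpace ℝ (Fin n)) (lam : ℝ)
    (z : SpaceTime n) : ℝ :=
  locDistSet p d lam z (goodSet p d q β α₀ ρ ρb z₀ u Du lam)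

/-! ### The standing restrictions on the parameters -/

/-- The cylinder `𝔔 = B_{128ρ₀}(x₀) × (t₀ - (128ρ₀)², t₀ + (128ρ₀)²)`. -/
def largeCyl (ρ₀ : ℝ) (z₀ : SpaceTime n) : Set (SpaceTime n) :=
  cyl (128 * ρ₀) ((128 * ρ₀) ^ 2) z₀

/-- `p⁻`, the infimum of `p` over `𝔔`. -/
def pInf (p : SpaceTime n → ℝ) (ρ₀ : ℝ) (z₀ : SpaceTime n) : ℝ := sInf (p '' largeCyl ρ₀ z₀)

/-- `p⁺`, the supremum of `p` over `𝔔`. -/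
def pSup (p : SpaceTime n → ℝ) (ρ₀ : ℝ) (z₀ : SpaceTime n) : ℝ := sSup (p '' largeCyl ρ₀ z₀)

/-- The restrictions on the radius `ρ₀`; `M₀` is the energy of the solution. -/
structure RadiusRestrictions (p : SpaceTime n → ℝ) (om : ℝ → ℝ) (L M₀ ρ₀ : ℝ)
    (z₀ : SpaceTime n) : Prop where
  pos : 0 < ρ₀
  lt_one : ρ₀ < 1
  energy_bound : ρ₀ ≤ 1 / (1024 * M₀)
  osc_le : pSup p ρ₀ z₀ - pInf p ρ₀ z₀ ≤ om (512 * ρ₀)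
  modulus_le : om (512 * ρ₀) ≤ 1 / 2 * min (1 / ((n : ℝ) + 2)) (1 / 4)
  log_le : om ρ₀ ≤ L / Real.log (1 / ρ₀)
  log_small : L / Real.log (1 / ρ₀) ≤ 1 / (n : ℝ)

/-- The restrictions on the scaling exponent `d` and on `q`, `β₀` that involve `p⁻` and `p⁺`. -/
structure ExponentRestrictions (p : SpaceTime n → ℝ) (q β₀ d ρ₀ : ℝ) (z₀ : SpaceTime n) :
    Prop where
  d_lower : 2 * (n : ℝ) / (((n : ℝ) + 2) * pInf p ρ₀ z₀) < d
  d_upper : d < min (2 / pSup p ρ₀ z₀) 1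
  q_upper : q < pInf p ρ₀ z₀ / (pSup p ρ₀ z₀ - 1)
  beta_d : 2 * β₀ ≤ d * ((n : ℝ) + 2) / 2 - (n : ℝ) / pInf p ρ₀ z₀

/-- The two-sided condition relating `α₀` to the averages of `(|∇u|+1)^{p(z)(1-β)}`. -/
structure StoppingCondition (p : SpaceTime n → ℝ) (d β α₀ ρ : ℝ) (z₀ : SpaceTime n)
    (Du : SpaceTime n → EuclideanSpace ℝ (Fin n)) : Prop where
  lower : α₀ ^ (1 - β) ≤
    ⨍ z in intrinsicCyl p d α₀ ρ z₀, (‖Du z‖ + 1) ^ (p z * (1 - β))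
  upper : ⨍ z in intrinsicCyl p d α₀ (16 * ρ) z₀, (‖Du z‖ + 1) ^ (p z * (1 - β))
    ≤ α₀ ^ (1 - β)

end VarExpParabolic

end

/-! The only obstruction to a Vitali argument is that the spatial scaling `λ^(-1/p(z)+d/2)` depends
on the centre. The time scaling does not. For two intersecting cylinders the ratio of spatial
scalings is a power of λ whose exponent is at most `|p(a) - p(b)|`, hence at most `ω(3r)` with `r`
the radius of the dominating cylinder. Log-Hölder continuity makes `ω(r) log (1/r)` bounded. The
ratio is therefore controlled by the data as soon as λ is at most polynomially large in `1/r`, and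
that is the heart of the proof (`FixedConstants.exists_lam_rpow_mul_le`): `λ^(β₀/2) r^N ≤ C`
whenever `Q_r^λ(z)` misses the good set.

For such a cylinder the strong maximal function exceeds `λ^(1/q)` on all of `Q_r^λ(z)`. Let `h =
|∇u| + 1 + |u|/len`, where `len` is the spatial length in the definition of `g`. The weak type `(ηq,
ηq)` bound, with `1/q < η < 1 - β₀`, gives `λ^η |Q_r^λ(z)| ≤ C ∫ h^(pη)` over the large cylinder.
The volume is a power of λ times `r^(n+2)`, and the restriction linking `d` and `β₀` leaves a
positive power of λ on the left. The right side is bounded in two ways.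

The crude way uses the total energy, at most `1/ρ`, and yields `λ^(β₀/2) r^(n+2) ≤ C ρ^(-K)`. To
trade ρ for `r`, one shows `r ≤ Cρ` when ρ is small: the Poincaré inequality at the boundary (u
vanishes on the complement of Ω, which has positive density) together with the upper stopping
condition bounds `∫ h^(pη)` by `α₀^η |Q_16ρ|` up to a factor `α₀^(O(ω))`. That factor is harmless
because the lower stopping condition makes `α₀` polynomial in `1/ρ`. When ρ is bounded below, the
crude bound already suffices.

The same estimate shows that the good set is nonempty and that the radii are bounded, and Vitali's
lemma concludes. The strong maximal function is controlled by composing a space and a time maximal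
function, each over a countable family of balls. -/

noncomputable section

namespace VarExpParabolic

/-! ### Dyadic-ball maximal functions -/

section Maximal

set_option linter.unusedSectionVars false

/-- Jensen's inequality for powers of a lower Lebesgue integral. -/
theorem lintegral_rpow_le_measure_rpow_mul {α : Type*} [MeasurableSpace α] (μ : Measure α)
    {f : α → ℝ≥0∞} (hf : AEMeasurable f μ) {k : ℝ} (hk : 1 ≤ k) :
    (∫⁻ x, f x ∂μ) ^ k ≤ μ univ ^ (k - 1) * ∫⁻ x, f x ^ k ∂μ := by
  have hk0 : 0 < k := by linarith
  have h := eLpNorm'_le_eLpNorm'_mul_rpow_measure_univ (μ := μ) (f := f) one_pos hk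
    hf.aestronglyMeasurable
  simp only [eLpNorm', enorm_eq_self, ENNReal.rpow_one, div_one] at h
  calc (∫⁻ x, f x ∂μ) ^ k
      ≤ ((∫⁻ x, f x ^ k ∂μ) ^ (1 / k) * μ univ ^ (1 - 1 / k)) ^ k :=
        ENNReal.rpow_le_rpow h hk0.le
    _ = μ univ ^ (k - 1) * ∫⁻ x, f x ^ k ∂μ := by
        rw [ENNReal.mul_rpow_of_nonneg _ _ hk0.le, ← ENNReal.rpow_mul, ← ENNReal.rpow_mul,
          one_div_mul_cancel hk0.ne', ENNReal.rpow_one, mul_comm]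
        congr 2
        field_simp

variable {E : Type*} [NormedAddCommGroup E] [NormedSpace ℝ E] [FiniteDimensional ℝ E]
  [MeasurableSpace E] [BorelSpace E] (μ : Measure E) [μ.IsAddHaarMeasure]

/-- The ball with centre in a fixed dense sequence and dyadic radius. -/
def dyBall (E : Type*) [NormedAddCommGroup E] [NormedSpace ℝ E] [FiniteDimensional ℝ E]
    (i : ℕ × ℤ) : Set E :=
  Metric.ball (@TopologicalSpace.denseSeq E _ _ _ i.1) ((2 : ℝ) ^ i.2)

/-- The uncentred maximal function over the countable family of dyadic balls. -/
def dyMax (f : E → ℝ≥0∞) (x : E) : ℝ≥0∞ :=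
  ⨆ i : ℕ × ℤ, (dyBall E i).indicator
    (fun _ => (μ (dyBall E i))⁻¹ * ∫⁻ y in dyBall E i, f y ∂μ) x

theorem measurableSet_dyBall (i : ℕ × ℤ) : MeasurableSet (dyBall E i) :=
  Metric.isOpen_ball.measurableSet

theorem measure_dyBall_ne_zero (i : ℕ × ℤ) : μ (dyBall E i) ≠ 0 :=
  (Metric.measure_ball_pos μ _ (by positivity)).ne'

theorem measure_dyBall_ne_top (i : ℕ × ℤ) : μ (dyBall E i) ≠ ⊤ :=
  measure_ball_lt_top.ne

theorem setLIntegral_le_dyMax (f : E → ℝ≥0∞) {i : ℕ × ℤ} {x : E} (hx : x ∈ dyBall E i) :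
    ∫⁻ y in dyBall E i, f y ∂μ ≤ μ (dyBall E i) * dyMax μ f x := by
  have h : (μ (dyBall E i))⁻¹ * ∫⁻ y in dyBall E i, f y ∂μ ≤ dyMax μ f x := by
    have := le_iSup (fun i : ℕ × ℤ => (dyBall E i).indicator
      (fun _ => (μ (dyBall E i))⁻¹ * ∫⁻ y in dyBall E i, f y ∂μ) x) i
    rwa [indicator_of_mem hx] at this
  calc ∫⁻ y in dyBall E i, f y ∂μ
      = μ (dyBall E i) * ((μ (dyBall E i))⁻¹ * ∫⁻ y in dyBall E i, f y ∂μ) := by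
        rw [← mul_assoc, ENNReal.mul_inv_cancel (measure_dyBall_ne_zero μ i)
          (measure_dyBall_ne_top μ i), one_mul]
    _ ≤ _ := by gcongr

/-- Moving the centre to a dense point at distance less than `a` costs one factor 2, and rounding
`2a` up to a power of two costs another; this is the 4. -/
theorem exists_dyBall_superset (c : E) {a : ℝ} (ha : 0 < a) :
    ∃ i : ℕ × ℤ, Metric.ball c a ⊆ dyBall E i ∧
      μ (dyBall E i) ≤ 4 ^ Module.finrank ℝ E * μ (Metric.ball c a) := by
  obtain ⟨j, hj⟩ := (TopologicalSpace.denseRange_denseSeq E).exists_dist_lt c ha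
  obtain ⟨k, hk⟩ := exists_mem_Ioc_zpow (x := 2 * a) (y := (2 : ℝ)) (by positivity) one_lt_two
  have h1 : (2 : ℝ) ^ (k + 1) ≤ 4 * a := by
    rw [zpow_add_one₀ two_ne_zero]; linarith [hk.1]
  refine ⟨(j, k + 1), ?_, ?_⟩
  · exact Metric.ball_subset_ball' (by linarith [hk.2])
  · calc μ (dyBall E (j, k + 1)) ≤ μ (Metric.ball (TopologicalSpace.denseSeq E j) (4 * a)) :=
          measure_mono (Metric.ball_subset_ball h1)
      _ = 4 ^ Module.finrank ℝ E * μ (Metric.ball c a) := by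
        rw [Measure.addHaar_ball_mul_of_pos μ _ (by norm_num), Measure.addHaar_ball_center μ c]
        congr 1
        rw [ENNReal.ofReal_pow (by norm_num)]; norm_num

/-- Joint measurability is what allows the maximal function to be iterated and Tonelli's theorem to
be used; it is immediate because the supremum is countable. -/
theorem measurable_dyMax_prod {α : Type*} [MeasurableSpace α] {f : E × α → ℝ≥0∞}
    (hf : Measurable f) : Measurable fun z : E × α => dyMax μ (fun y => f (y, z.2)) z.1 := by
  refine Measurable.iSup fun i => ?_
  have h : Measurable fun z : E × α =>
      (μ (dyBall E i))⁻¹ * ∫⁻ y in dyBall E i, f (y, z.2) ∂μ :=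
    ((Measurable.lintegral_prod_left' hf).comp measurable_snd).const_mul _
  have := h.indicator ((measurableSet_dyBall i).preimage (measurable_fst (β := α)))
  exact this

/-- Weak type `(1,1)` of the dyadic-ball maximal function. -/
theorem mul_measure_dyMax_le [Nontrivial E] (f : E → ℝ≥0∞) (s : ℝ≥0∞) :
    s * μ {x | s < dyMax μ f x} ≤ 5 ^ Module.finrank ℝ E * ∫⁻ x, f x ∂μ := by
  rcases eq_or_ne s 0 with rfl | hs
  · simp
  by_cases hI : ∫⁻ x, f x ∂μ = ⊤
  · rw [hI, ENNReal.mul_top (by positivity)]; exact le_top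
  set S : Set (ℕ × ℤ) := {i | s * μ (dyBall E i) < ∫⁻ y in dyBall E i, f y ∂μ} with hS
  have hsub : {x | s < dyMax μ f x} ⊆ ⋃ i ∈ S, dyBall E i := by
    intro x hx
    obtain ⟨i, hi⟩ := lt_iSup_iff.1 (show s < dyMax μ f x from hx)
    by_cases hxi : x ∈ dyBall E i
    · refine mem_iUnion₂.2 ⟨i, ?_, hxi⟩
      rw [indicator_of_mem hxi, mul_comm, ← div_eq_mul_inv,
        ENNReal.lt_div_iff_mul_lt (Or.inl (measure_dyBall_ne_zero μ i))
          (Or.inl (measure_dyBall_ne_top μ i))] at hi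
      exact hi
    · rw [indicator_of_notMem hxi] at hi; exact absurd hi not_lt_zero
  have hpos : 0 < Module.finrank ℝ E := Module.finrank_pos
  have hc0 : s * μ (Metric.ball (0 : E) 1) ≠ 0 :=
    mul_ne_zero hs (Metric.measure_ball_pos μ _ one_pos).ne'
  -- Vitali's lemma needs bounded radii. A selected ball of radius `R ≥ 1` satisfies `R ≤ R ^ dim`,
  -- which is bounded by the finite mass of `f`; this uses positive dimension.
  have hR : ∀ i ∈ S, (2 : ℝ) ^ i.2 ≤
      max 1 ((∫⁻ x, f x ∂μ) / (s * μ (Metric.ball (0 : E) 1))).toReal := by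
    intro i hi
    by_cases h1 : (2 : ℝ) ^ i.2 ≤ 1
    · exact h1.trans (le_max_left _ _)
    push Not at h1
    refine le_max_of_le_right ?_
    have h2 : ENNReal.ofReal ((2 : ℝ) ^ i.2) * (s * μ (Metric.ball (0 : E) 1)) ≤
        ∫⁻ x, f x ∂μ := by
      refine le_trans ?_ (hi.le.trans (setLIntegral_le_lintegral _ _))
      calc _ = s * (ENNReal.ofReal ((2 : ℝ) ^ i.2) * μ (Metric.ball (0 : E) 1)) := by
            rw [← mul_assoc, ← mul_assoc, mul_comm s]
        _ ≤ s * (ENNReal.ofReal (((2 : ℝ) ^ i.2) ^ Module.finrank ℝ E) *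
              μ (Metric.ball (0 : E) 1)) := by
            gcongr; exact le_self_pow₀ h1.le hpos.ne'
        _ = s * μ (dyBall E i) := by
            rw [dyBall, ← Measure.addHaar_ball μ _ (by positivity)]
    have hne : s * μ (Metric.ball (0 : E) 1) ≠ ⊤ := by
      intro htop
      rw [htop, ENNReal.mul_top (by simpa using by positivity)] at h2
      exact hI (top_le_iff.1 h2)
    rw [← ENNReal.le_div_iff_mul_le (Or.inl hc0) (Or.inl hne)] at h2
    exact (ENNReal.ofReal_le_iff_le_toReal (ENNReal.div_ne_top hI hc0)).1 h2
  obtain ⟨U, hUS, hdisj, hcov⟩ := Vitali.exists_disjoint_subfamily_covering_enlargement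
    (fun i : ℕ × ℤ => dyBall E i) S (fun i => (2 : ℝ) ^ i.2) 2 one_lt_two
    (fun i _ => by positivity) _ hR (fun i _ => Metric.nonempty_ball.2 (by positivity))
  -- With radii comparable up to the factor 2, a point of the smaller family lies within `2·2 + 1 =
  -- 5` radii of the selected centre.
  have hsub2 : {x | s < dyMax μ f x} ⊆
      ⋃ i ∈ U, Metric.ball (TopologicalSpace.denseSeq E i.1) (5 * (2 : ℝ) ^ i.2) := by
    intro x hx
    obtain ⟨i, hiS, hxi⟩ := mem_iUnion₂.1 (hsub hx)
    obtain ⟨j, hjU, ⟨y, hyi, hyj⟩, hij⟩ := hcov i hiS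
    refine mem_iUnion₂.2 ⟨j, hjU, ?_⟩
    simp only [dyBall, Metric.mem_ball] at hxi hyi hyj ⊢
    have h1 := dist_triangle x (TopologicalSpace.denseSeq E i.1) (TopologicalSpace.denseSeq E j.1)
    have h2 := dist_triangle_left (TopologicalSpace.denseSeq E i.1)
      (TopologicalSpace.denseSeq E j.1) y
    linarith
  have hUc : U.Countable := to_countable U
  calc s * μ {x | s < dyMax μ f x}
      ≤ s * ∑' i : U, μ (Metric.ball (TopologicalSpace.denseSeq E i.1.1)
          (5 * (2 : ℝ) ^ i.1.2)) := by
        gcongr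
        exact (measure_mono hsub2).trans (measure_biUnion_le μ hUc _)
    _ = 5 ^ Module.finrank ℝ E * ∑' i : U, s * μ (dyBall E i.1) := by
        rw [← ENNReal.tsum_mul_left, ← ENNReal.tsum_mul_left]
        congr 1; ext i
        rw [Measure.addHaar_ball_mul_of_pos μ _ (by norm_num), dyBall,
          Measure.addHaar_ball_center μ, ENNReal.ofReal_pow (by norm_num),
          show ENNReal.ofReal 5 = 5 by norm_num, Measure.addHaar_ball_center μ
            (TopologicalSpace.denseSeq E i.1.1)]
        ring
    _ ≤ 5 ^ Module.finrank ℝ E * ∑' i : U, ∫⁻ y in dyBall E i.1, f y ∂μ := by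
        gcongr with i; exact (hUS i.2).le
    _ = 5 ^ Module.finrank ℝ E * ∫⁻ y in ⋃ i ∈ U, dyBall E i, f y ∂μ := by
        rw [lintegral_biUnion hUc (fun i _ => measurableSet_dyBall i) hdisj]
    _ ≤ _ := mul_le_mul_right (setLIntegral_le_lintegral _ _) _

/-- Weak type `(k,k)` of the dyadic-ball maximal function. -/
theorem rpow_mul_measure_dyMax_le [Nontrivial E] {f : E → ℝ≥0∞} (hf : Measurable f)
    {k : ℝ} (hk : 1 ≤ k) (s : ℝ≥0∞) :
    s ^ k * μ {x | s < dyMax μ f x} ≤ 5 ^ Module.finrank ℝ E * ∫⁻ x, f x ^ k ∂μ := by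
  have hk0 : 0 < k := by linarith
  -- Jensen's inequality on each ball shows that the `k`-th power of the maximal function of `f` is
  -- at most the maximal function of `f ^ k`, which reduces the claim to weak type `(1,1)`.
  refine le_trans ?_ (mul_measure_dyMax_le μ (fun x => f x ^ k) (s ^ k))
  refine mul_le_mul_right (measure_mono fun x hx => ?_) _
  obtain ⟨i, hi⟩ := lt_iSup_iff.1 (show s < dyMax μ f x from hx)
  refine mem_ofPred_eq ▸ lt_of_lt_of_le ?_ (le_iSup (fun i : ℕ × ℤ => (dyBall E i).indicator
    (fun _ => (μ (dyBall E i))⁻¹ * ∫⁻ y in dyBall E i, f y ^ k ∂μ) x) i)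
  by_cases hxi : x ∈ dyBall E i
  · rw [indicator_of_mem hxi] at hi ⊢
    refine (ENNReal.rpow_lt_rpow hi hk0).trans_le ?_
    have hJ := lintegral_rpow_le_measure_rpow_mul (μ.restrict (dyBall E i)) hf.aemeasurable hk
    rw [Measure.restrict_apply_univ] at hJ
    rw [ENNReal.mul_rpow_of_nonneg _ _ hk0.le]
    refine (mul_le_mul_right hJ _).trans_eq ?_
    rw [← mul_assoc]
    congr 1
    have h0 := measure_dyBall_ne_zero μ i
    have ht := measure_dyBall_ne_top μ i
    rw [ENNReal.inv_rpow, ← ENNReal.rpow_neg, ← ENNReal.rpow_add _ _ h0 ht,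
      show -k + (k - 1) = -1 by ring, ENNReal.rpow_neg_one]
  · rw [indicator_of_notMem hxi] at hi; exact absurd hi not_lt_zero

end Maximal

/-! ### The strong maximal function -/

section StrongMaximal

/-- The last index `j` with `2 ^ j * s < a` alone contributes at least `a`. This is a discrete
layer-cake formula above height `s`. -/
theorem le_tsum_dyadic {a s : ℝ≥0∞} (hs : s ≠ 0) (hst : s ≠ ⊤) (ha : s < a) :
    a ≤ ∑' j : ℕ, (if 2 ^ j * s < a then 2 ^ (j + 1) * s else 0) := by
  rcases eq_or_ne a ⊤ with rfl | hat
  · refine (ENNReal.tsum_const_eq_top_of_ne_zero (α := ℕ) hs).ge.trans ?_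
    refine ENNReal.tsum_le_tsum fun j => ?_
    rw [if_pos (ENNReal.mul_lt_top (by finiteness) hst.lt_top)]
    exact le_mul_of_one_le_left zero_le (one_le_pow₀ one_le_two)
  · have hex : ∃ m : ℕ, a ≤ 2 ^ m * s := by
      obtain ⟨N, hN⟩ := ENNReal.exists_nat_gt (ENNReal.div_ne_top hat hs)
      refine ⟨N, ?_⟩
      rw [← ENNReal.div_le_iff_le_mul (Or.inl hs) (Or.inl hst)]
      refine hN.le.trans ?_
      exact_mod_cast N.lt_two_pow_self.le
    obtain ⟨j, hj⟩ : ∃ j, Nat.find hex = j + 1 := by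
      refine Nat.exists_eq_succ_of_ne_zero fun h0 => ?_
      have := Nat.find_spec hex
      rw [h0, pow_zero, one_mul] at this
      exact absurd ha this.not_gt
    have h1 : a ≤ 2 ^ (j + 1) * s := hj ▸ Nat.find_spec hex
    have h2 : 2 ^ j * s < a := not_le.1 (Nat.find_min hex (by omega))
    refine le_trans ?_ (ENNReal.le_tsum j)
    rw [if_pos h2]; exact h1

variable {n : ℕ}

/-- The space maximal function on time slices. -/
def sliceMax (f : SpaceTime n → ℝ≥0∞) (z : SpaceTime n) : ℝ≥0∞ :=
  dyMax volume (fun y => f (y, z.2)) z.1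

/-- The composition of the time and the space maximal functions. -/
def iterMax (f : SpaceTime n → ℝ≥0∞) (z : SpaceTime n) : ℝ≥0∞ :=
  dyMax volume (fun τ => sliceMax f (z.1, τ)) z.2

theorem measurable_sliceMax {f : SpaceTime n → ℝ≥0∞} (hf : Measurable f) :
    Measurable (sliceMax f) :=
  measurable_dyMax_prod volume hf

theorem measurable_iterMax {f : SpaceTime n → ℝ≥0∞} (hf : Measurable f) :
    Measurable (iterMax f) := by
  have h1 : Measurable fun w : ℝ × EuclideanSpace ℝ (Fin n) => sliceMax f (w.2, w.1) :=
    (measurable_sliceMax hf).comp measurable_swap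
  have h2 := measurable_dyMax_prod (volume : Measure ℝ) h1
  have h3 := h2.comp (measurable_swap (α := EuclideanSpace ℝ (Fin n)) (β := ℝ))
  exact h3

/-- A cylinder is a product of balls, so both factors can be enlarged to dyadic balls. By Tonelli
the space integral on each time slice is controlled by the slice maximal function at the one point
`z.1`, and the remaining time integral by the maximal function in time. -/
theorem strongMaximal_le_iterMax {f : SpaceTime n → ℝ≥0∞} (hf : Measurable f)
    (z : SpaceTime n) : strongMaximal f z ≤ 4 ^ (n + 1) * iterMax f z := by
  refine iSup_le fun c => iSup_le fun a => iSup_le fun b => iSup_le fun ha => iSup_le fun hb =>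
    iSup_le fun hz => ?_
  obtain ⟨i, hi, hi'⟩ := exists_dyBall_superset volume c.1 ha
  obtain ⟨j, hj, hj'⟩ := exists_dyBall_superset volume c.2 hb
  have hcyl : cyl a b c = Metric.ball c.1 a ×ˢ Metric.ball c.2 b := by
    rw [cyl, Real.ball_eq_Ioo]
  rw [hcyl] at hz ⊢
  rw [finrank_euclideanSpace_fin] at hi'
  rw [Module.finrank_self] at hj'
  have h1 : ∫⁻ w in Metric.ball c.1 a ×ˢ Metric.ball c.2 b, f w ≤
      volume (dyBall (EuclideanSpace ℝ (Fin n)) i) *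
        (volume (dyBall ℝ j) * iterMax f z) := by
    calc ∫⁻ w in Metric.ball c.1 a ×ˢ Metric.ball c.2 b, f w
        ≤ ∫⁻ w in dyBall (EuclideanSpace ℝ (Fin n)) i ×ˢ dyBall ℝ j, f w :=
          lintegral_mono_set (prod_mono hi hj)
      _ = ∫⁻ τ in dyBall ℝ j, ∫⁻ y in dyBall (EuclideanSpace ℝ (Fin n)) i, f (y, τ) := by
          rw [Measure.volume_eq_prod, ← Measure.prod_restrict,
            lintegral_prod_symm _ hf.aemeasurable]
      _ ≤ ∫⁻ τ in dyBall ℝ j, volume (dyBall (EuclideanSpace ℝ (Fin n)) i) *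
            sliceMax f (z.1, τ) :=
          lintegral_mono fun τ => setLIntegral_le_dyMax volume (fun y => f (y, τ)) (hi hz.1)
      _ = volume (dyBall (EuclideanSpace ℝ (Fin n)) i) *
            ∫⁻ τ in dyBall ℝ j, sliceMax f (z.1, τ) :=
          lintegral_const_mul _ ((measurable_sliceMax hf).comp measurable_prodMk_left)
      _ ≤ _ := mul_le_mul_right (setLIntegral_le_dyMax volume _ (hj hz.2)) _
  have hv : volume (Metric.ball c.1 a ×ˢ Metric.ball c.2 b) =
      volume (Metric.ball c.1 a) * volume (Metric.ball c.2 b) := by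
    rw [Measure.volume_eq_prod, Measure.prod_prod]
  have hv0 : volume (Metric.ball c.1 a ×ˢ Metric.ball c.2 b) ≠ 0 := by
    rw [hv]
    exact mul_ne_zero (Metric.measure_ball_pos _ _ ha).ne' (Metric.measure_ball_pos _ _ hb).ne'
  have hvt : volume (Metric.ball c.1 a ×ˢ Metric.ball c.2 b) ≠ ⊤ := by
    rw [hv]; exact ENNReal.mul_ne_top measure_ball_lt_top.ne measure_ball_lt_top.ne
  rw [mul_comm, ← div_eq_mul_inv, ENNReal.div_le_iff hv0 hvt]
  refine h1.trans ?_
  rw [hv]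
  calc volume (dyBall (EuclideanSpace ℝ (Fin n)) i) * (volume (dyBall ℝ j) * iterMax f z)
      ≤ (4 ^ n * volume (Metric.ball c.1 a)) *
          ((4 ^ 1 * volume (Metric.ball c.2 b)) * iterMax f z) := by gcongr
    _ = _ := by ring

theorem rpow_mul_measure_sliceMax_le [NeZero n] {f : SpaceTime n → ℝ≥0∞} (hf : Measurable f)
    {k : ℝ} (hk : 1 ≤ k) (s : ℝ≥0∞) :
    s ^ k * volume {z | s < sliceMax f z} ≤ 5 ^ n * ∫⁻ z, f z ^ k := by
  have hm : MeasurableSet {z | s < sliceMax f z} :=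
    measurableSet_lt measurable_const (measurable_sliceMax hf)
  rw [Measure.volume_eq_prod, Measure.prod_apply_symm hm,
    lintegral_prod_symm _ (hf.pow_const k).aemeasurable,
    ← lintegral_const_mul _ (measurable_measure_prodMk_right hm),
    ← lintegral_const_mul _ ((hf.pow_const k).lintegral_prod_left')]
  refine lintegral_mono fun τ => ?_
  have := rpow_mul_measure_dyMax_le (volume : Measure (EuclideanSpace ℝ (Fin n)))
    (f := fun y => f (y, τ)) (hf.comp measurable_prodMk_right) hk s
  rwa [finrank_euclideanSpace_fin] at this

/-- The constant in `setLIntegral_sliceMax_le`. -/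
def tailConst (n : ℕ) (k : ℝ) : ℝ≥0∞ :=
  5 ^ n * (2 * (1 - 2 ^ (1 - k))⁻¹)

theorem tailConst_ne_top (n : ℕ) {k : ℝ} (hk : 1 < k) : tailConst n k ≠ ⊤ := by
  refine ENNReal.mul_ne_top (by finiteness) (ENNReal.mul_ne_top (by finiteness) ?_)
  rw [ENNReal.inv_ne_top]
  refine (tsub_pos_iff_lt.2 ?_).ne'
  exact ENNReal.rpow_lt_one_of_one_lt_of_neg ENNReal.one_lt_two (by linarith)

/-- Summing the weak type `(k,k)` bound over the levels `2 ^ j * s` produces a geometric series of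
ratio `2 ^ (1 - k)`. It converges exactly when `k > 1`, which is why the strong maximal function is
not handled at `k = 1`. -/
theorem setLIntegral_sliceMax_le [NeZero n] {f : SpaceTime n → ℝ≥0∞} (hf : Measurable f)
    {k : ℝ} (hk : 1 ≤ k) {s : ℝ≥0∞} (hs : s ≠ 0) (hst : s ≠ ⊤) :
    s ^ k * ∫⁻ z in {z | s < sliceMax f z}, sliceMax f z ≤
      tailConst n k * s * ∫⁻ z, f z ^ k := by
  have hk0 : 0 < k := by linarith
  have hF := measurable_sliceMax hf
  have hm : ∀ c : ℝ≥0∞, MeasurableSet {z | c < sliceMax f z} := fun c =>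
    measurableSet_lt measurable_const hF
  have h1 : ∫⁻ z in {z | s < sliceMax f z}, sliceMax f z ≤
      ∑' j : ℕ, 2 ^ (j + 1) * s * volume {z | 2 ^ j * s < sliceMax f z} := by
    calc ∫⁻ z in {z | s < sliceMax f z}, sliceMax f z
        ≤ ∫⁻ z in {z | s < sliceMax f z}, ∑' j : ℕ,
            {z | 2 ^ j * s < sliceMax f z}.indicator (fun _ => 2 ^ (j + 1) * s) z := by
          refine setLIntegral_mono' (hm s) fun z hz => ?_
          simpa only [indicator_apply, mem_ofPred_eq] using le_tsum_dyadic hs hst hz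
      _ ≤ ∫⁻ z, ∑' j : ℕ,
            {z | 2 ^ j * s < sliceMax f z}.indicator (fun _ => 2 ^ (j + 1) * s) z :=
          setLIntegral_le_lintegral _ _
      _ = _ := by
          rw [lintegral_tsum fun j => (measurable_const.indicator (hm _)).aemeasurable]
          congr 1; ext j
          rw [lintegral_indicator (hm _), setLIntegral_const]
  calc s ^ k * ∫⁻ z in {z | s < sliceMax f z}, sliceMax f z
      ≤ s ^ k * ∑' j : ℕ, 2 ^ (j + 1) * s * volume {z | 2 ^ j * s < sliceMax f z} := by gcongr
    _ = ∑' j : ℕ, 2 * s * (2 ^ (1 - k)) ^ j *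
          ((2 ^ j * s) ^ k * volume {z | 2 ^ j * s < sliceMax f z}) := by
        rw [← ENNReal.tsum_mul_left]
        congr 1; ext j
        have h2 : ((2 : ℝ≥0∞) ^ (1 - k)) ^ j * (2 ^ j) ^ k = 2 ^ j := by
          rw [← ENNReal.rpow_natCast, ← ENNReal.rpow_mul, ← ENNReal.rpow_natCast 2 j,
            ← ENNReal.rpow_mul, ← ENNReal.rpow_add _ _ two_ne_zero (by finiteness)]
          congr 1; ring
        rw [ENNReal.mul_rpow_of_nonneg _ _ hk0.le, pow_succ]
        calc _ = 2 * s * (2 ^ j) * (s ^ k * volume {z | 2 ^ j * s < sliceMax f z}) := by ring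
          _ = 2 * s * (((2 : ℝ≥0∞) ^ (1 - k)) ^ j * (2 ^ j) ^ k) *
              (s ^ k * volume {z | 2 ^ j * s < sliceMax f z}) := by rw [h2]
          _ = _ := by ring
    _ ≤ ∑' j : ℕ, 2 * s * (2 ^ (1 - k)) ^ j * (5 ^ n * ∫⁻ z, f z ^ k) := by
        exact ENNReal.tsum_le_tsum fun j => mul_le_mul_right (rpow_mul_measure_sliceMax_le hf hk _) _
    _ = _ := by
        rw [ENNReal.tsum_mul_right, ENNReal.tsum_mul_left, ENNReal.tsum_geometric, tailConst]
        ring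

/-- The part of `f` below height `c` has averages at most `c`. Truncation thus lets the weak type
bound see only the large values of `f`. -/
theorem dyMax_le_add_dyMax {E : Type*} [NormedAddCommGroup E] [NormedSpace ℝ E]
    [FiniteDimensional ℝ E] [MeasurableSpace E] [BorelSpace E] (μ : Measure E)
    [μ.IsAddHaarMeasure] (f : E → ℝ≥0∞) (c : ℝ≥0∞) (x : E) :
    dyMax μ f x ≤ c + dyMax μ ({y | c < f y}.indicator f) x := by
  refine iSup_le fun i => ?_
  by_cases hx : x ∈ dyBall E i
  · rw [indicator_of_mem hx]
    have h1 : ∫⁻ y in dyBall E i, f y ∂μ ≤ μ (dyBall E i) * c +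
        ∫⁻ y in dyBall E i, {y | c < f y}.indicator f y ∂μ := by
      calc ∫⁻ y in dyBall E i, f y ∂μ
          ≤ ∫⁻ y in dyBall E i, (c + {y | c < f y}.indicator f y) ∂μ := by
            refine lintegral_mono fun y => ?_
            by_cases hy : c < f y
            · rw [indicator_of_mem (by exact hy)]; exact le_add_self
            · exact (not_lt.1 hy).trans le_self_add
        _ = _ := by
            rw [lintegral_add_left measurable_const, setLIntegral_const, mul_comm]
    calc (μ (dyBall E i))⁻¹ * ∫⁻ y in dyBall E i, f y ∂μ
        ≤ (μ (dyBall E i))⁻¹ * (μ (dyBall E i) * c + μ (dyBall E i) *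
            dyMax μ ({y | c < f y}.indicator f) x) := by
          refine mul_le_mul_right (h1.trans ?_) _
          exact add_le_add_right (setLIntegral_le_dyMax μ _ hx) _
      _ = _ := by
          rw [← mul_add, ← mul_assoc, ENNReal.inv_mul_cancel (measure_dyBall_ne_zero μ i)
            (measure_dyBall_ne_top μ i), one_mul]
  · rw [indicator_of_notMem hx]; exact zero_le

/-- Where the iterated function exceeds `2s`, the time maximal function of the slice maximal
function truncated at height `s` exceeds `s`. Weak type `(1,1)` in time leaves the integral of the
slice maximal function over its superlevel set, which is the tail estimate above. -/
theorem rpow_mul_measure_iterMax_le [NeZero n] {f : SpaceTime n → ℝ≥0∞} (hf : Measurable f)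
    {k : ℝ} (hk : 1 ≤ k) {s : ℝ≥0∞} (hs : s ≠ 0) (hst : s ≠ ⊤) :
    s ^ k * volume {z | 2 * s < iterMax f z} ≤ 5 * tailConst n k * ∫⁻ z, f z ^ k := by
  have hF := measurable_sliceMax hf
  have hmF : MeasurableSet {z | s < sliceMax f z} := measurableSet_lt measurable_const hF
  have hm : MeasurableSet {z | 2 * s < iterMax f z} :=
    measurableSet_lt measurable_const (measurable_iterMax hf)
  have h1 : s * volume {z | 2 * s < iterMax f z} ≤
      5 * ∫⁻ z in {z | s < sliceMax f z}, sliceMax f z := by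
    rw [← lintegral_indicator hmF, Measure.volume_eq_prod, Measure.prod_apply hm,
      lintegral_prod _ (hF.indicator hmF).aemeasurable,
      ← lintegral_const_mul _ (measurable_measure_prodMk_left hm),
      ← lintegral_const_mul _ ((hF.indicator hmF).lintegral_prod_right')]
    refine lintegral_mono fun x => ?_
    have h2 := mul_measure_dyMax_le (volume : Measure ℝ)
      (fun τ => {z | s < sliceMax f z}.indicator (sliceMax f) (x, τ)) s
    rw [Module.finrank_self, pow_one] at h2
    refine le_trans (mul_le_mul_right (measure_mono fun τ hτ => ?_) _) h2
    have h3 := (show 2 * s < iterMax f (x, τ) from hτ).trans_le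
      (dyMax_le_add_dyMax volume (fun τ => sliceMax f (x, τ)) s τ)
    rw [two_mul] at h3
    exact (ENNReal.add_lt_add_iff_left hst).1 h3
  have h4 : s * (s ^ k * volume {z | 2 * s < iterMax f z}) ≤
      s * (5 * tailConst n k * ∫⁻ z, f z ^ k) := by
    calc s * (s ^ k * volume {z | 2 * s < iterMax f z})
        = s ^ k * (s * volume {z | 2 * s < iterMax f z}) := by ring
      _ ≤ s ^ k * (5 * ∫⁻ z in {z | s < sliceMax f z}, sliceMax f z) := by gcongr
      _ = 5 * (s ^ k * ∫⁻ z in {z | s < sliceMax f z}, sliceMax f z) := by ring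
      _ ≤ 5 * (tailConst n k * s * ∫⁻ z, f z ^ k) :=
          mul_le_mul_right (setLIntegral_sliceMax_le hf hk hs hst) _
      _ = _ := by ring
  exact (ENNReal.mul_le_mul_iff_right hs hst).1 h4

theorem strongMaximal_congr_ae {f g : SpaceTime n → ℝ≥0∞} (h : f =ᵐ[volume] g) :
    strongMaximal f = strongMaximal g := by
  ext z
  have : ∀ a b c, ∫⁻ w in cyl a b c, f w = ∫⁻ w in cyl a b c, g w := fun a b c =>
    lintegral_congr_ae (ae_restrict_of_ae h)
  simp only [strongMaximal, this]

/-- Weak type `(k,k)` of the strong maximal function, `k > 1`. -/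
theorem exists_rpow_mul_measure_strongMaximal_le (n : ℕ) [NeZero n] {k : ℝ} (hk : 1 < k) :
    ∃ C : ℝ, 0 < C ∧ ∀ f : SpaceTime n → ℝ≥0∞, AEMeasurable f → ∀ s : ℝ≥0∞, s ≠ 0 → s ≠ ⊤ →
      s ^ k * volume {z | s < strongMaximal f z} ≤ ENNReal.ofReal C * ∫⁻ z, f z ^ k := by
  set A : ℝ≥0∞ := (2 * 4 ^ (n + 1)) ^ k * (5 * tailConst n k) with hA
  have hk0 : 0 < k := by linarith
  have hAt : A ≠ ⊤ := ENNReal.mul_ne_top (by finiteness)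
    (ENNReal.mul_ne_top (by finiteness) (tailConst_ne_top n hk))
  refine ⟨A.toReal + 1, by positivity, fun f hf s hs hst => ?_⟩
  have hAC : A ≤ ENNReal.ofReal (A.toReal + 1) := by
    rw [ENNReal.le_ofReal_iff_toReal_le hAt (by positivity)]; linarith
  obtain ⟨g, hg, hfg⟩ := hf
  rw [strongMaximal_congr_ae hfg,
    lintegral_congr_ae (hfg.mono fun z hz => congrArg (· ^ k) hz : (fun z => f z ^ k) =ᵐ[volume] fun z => g z ^ k)]
  refine le_trans ?_ (mul_le_mul_left hAC _)
  -- The factor `4 ^ (n + 1)` is the loss in passing to the iterated function, and the factor 2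
  -- comes from its truncation level.
  set b : ℝ≥0∞ := 2 * 4 ^ (n + 1) with hb
  have hb0 : b ≠ 0 := by positivity
  have hbt : b ≠ ⊤ := by finiteness
  have h1 := rpow_mul_measure_iterMax_le hg hk.le (s := s / b)
    (ENNReal.div_ne_zero.2 ⟨hs, hbt⟩) (ENNReal.div_ne_top hst hb0)
  have h2 : {z | s < strongMaximal g z} ⊆ {z | 2 * (s / b) < iterMax g z} := by
    intro z hz
    have h3 : s < 4 ^ (n + 1) * iterMax g z := lt_of_lt_of_le hz (strongMaximal_le_iterMax hg z)
    by_contra h4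
    have h5 : iterMax g z ≤ 2 * (s / b) := not_lt.1 h4
    have h6 : 4 ^ (n + 1) * iterMax g z ≤ s := by
      calc 4 ^ (n + 1) * iterMax g z ≤ 4 ^ (n + 1) * (2 * (s / b)) := by gcongr
        _ = b * (s / b) := by rw [hb]; ring
        _ = s := ENNReal.mul_div_cancel hb0 hbt
    exact absurd h3 h6.not_gt
  calc s ^ k * volume {z | s < strongMaximal g z}
      = b ^ k * ((s / b) ^ k * volume {z | s < strongMaximal g z}) := by
        rw [← mul_assoc, ← ENNReal.mul_rpow_of_nonneg _ _ hk0.le, ENNReal.mul_div_cancel hb0 hbt]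
    _ ≤ b ^ k * (5 * tailConst n k * ∫⁻ z, g z ^ k) := by
        refine mul_le_mul_right (le_trans (mul_le_mul_right (measure_mono h2) _) h1) _
    _ = _ := by rw [hA]; ring

end StrongMaximal

/-! ### A Poincaré inequality for functions vanishing on a part of a ball -/

section Poincare

theorem lintegral_lintegral_lintegral_rotate {α β γ : Type*} [MeasurableSpace α]
    [MeasurableSpace β] [MeasurableSpace γ] (μ : Measure α) (ν : Measure β) (σ : Measure γ)
    [SFinite μ] [SFinite ν] [SFinite σ] {H : (α × β) × γ → ℝ≥0∞} (hH : Measurable H) :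
    ∫⁻ y, ∫⁻ x, ∫⁻ τ, H ((y, x), τ) ∂σ ∂ν ∂μ = ∫⁻ τ, ∫⁻ y, ∫⁻ x, H ((y, x), τ) ∂ν ∂μ ∂σ := by
  have h1 : ∀ τ, ∫⁻ y, ∫⁻ x, H ((y, x), τ) ∂ν ∂μ = ∫⁻ w, H (w, τ) ∂(μ.prod ν) := fun τ =>
    (lintegral_prod _ (hH.comp measurable_prodMk_right).aemeasurable).symm
  simp_rw [h1]
  rw [← lintegral_prod_symm _ hH.aemeasurable, lintegral_prod _ hH.aemeasurable,
    lintegral_prod _ hH.lintegral_prod_right'.aemeasurable]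

variable {E : Type*} [NormedAddCommGroup E] [NormedSpace ℝ E]

/-- The fundamental theorem of calculus along the segment from `y` to `x`, followed by Jensen's
inequality on the unit interval. -/
theorem enorm_sub_rpow_le_lintegral {φ : E → ℝ} (hφ : ContDiff ℝ 1 φ) {s : ℝ} (hs : 1 ≤ s)
    (x y : E) : ‖φ x - φ y‖ₑ ^ s ≤
      ‖x - y‖ₑ ^ s * ∫⁻ τ in Ioc (0 : ℝ) 1, ‖fderiv ℝ φ (y + τ • (x - y))‖ₑ ^ s := by
  have hs0 : 0 < s := by linarith
  have hc : Continuous fun τ : ℝ => fderiv ℝ φ (y + τ • (x - y)) :=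
    (hφ.continuous_fderiv one_ne_zero).comp (by fun_prop)
  have hd : ∀ τ ∈ uIcc (0 : ℝ) 1, HasDerivAt (fun τ : ℝ => φ (y + τ • (x - y)))
      (fderiv ℝ φ (y + τ • (x - y)) (x - y)) τ := by
    intro τ _
    have h1 : HasDerivAt (fun τ : ℝ => y + τ • (x - y)) (x - y) τ := by
      simpa using ((hasDerivAt_id τ).smul_const (x - y)).const_add y
    exact ((hφ.differentiable one_ne_zero _).hasFDerivAt).comp_hasDerivAt τ h1
  have h := intervalIntegral.integral_eq_sub_of_hasDerivAt hd
    ((hc.clm_apply continuous_const).intervalIntegrable _ _)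
  simp only [one_smul, zero_smul, add_zero, add_sub_cancel] at h
  rw [← h, intervalIntegral.integral_of_le zero_le_one]
  have h2 : ‖∫ τ in Ioc (0 : ℝ) 1, fderiv ℝ φ (y + τ • (x - y)) (x - y)‖ₑ ≤
      ‖x - y‖ₑ * ∫⁻ τ in Ioc (0 : ℝ) 1, ‖fderiv ℝ φ (y + τ • (x - y))‖ₑ := by
    refine (enorm_integral_le_lintegral_enorm _).trans ?_
    rw [← lintegral_const_mul _ hc.enorm.measurable]
    refine lintegral_mono fun τ => ?_
    rw [mul_comm]; exact ContinuousLinearMap.le_opENorm _ _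
  refine (ENNReal.rpow_le_rpow h2 hs0.le).trans ?_
  rw [ENNReal.mul_rpow_of_nonneg _ _ hs0.le]
  refine mul_le_mul_right ?_ _
  have h3 := lintegral_rpow_le_measure_rpow_mul (volume.restrict (Ioc (0 : ℝ) 1))
    hc.enorm.measurable.aemeasurable hs
  simpa using h3

variable [FiniteDimensional ℝ E] [MeasurableSpace E] [BorelSpace E] (μ : Measure E)
  [μ.IsAddHaarMeasure]

theorem setLIntegral_comp_homothety_le {B : Set E} (hB : Convex ℝ B) (hBm : MeasurableSet B)
    {g : E → ℝ≥0∞} (hg : Measurable g) {y : E} (hy : y ∈ B) {c : ℝ} (hc : 1 / 2 ≤ c)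
    (hc1 : c ≤ 1) :
    ∫⁻ x in B, g (y + c • (x - y)) ∂μ ≤ 2 ^ Module.finrank ℝ E * ∫⁻ x in B, g x ∂μ := by
  have hc0 : 0 < c := by linarith
  set v : E := y - c • y
  have hgB : Measurable (B.indicator g) := hg.indicator hBm
  calc ∫⁻ x in B, g (y + c • (x - y)) ∂μ
      = ∫⁻ x in B, B.indicator g (c • x + v) ∂μ := by
        refine setLIntegral_congr_fun hBm fun x hx => ?_
        have h1 : c • x + v = y + c • (x - y) := by simp only [v, smul_sub]; abel
        have h2 : y + c • (x - y) ∈ B :=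
          hB.add_smul_sub_mem hy hx ⟨hc0.le, hc1⟩
        simp only [h1, indicator_of_mem h2]
    _ ≤ ∫⁻ x, B.indicator g (c • x + v) ∂μ := setLIntegral_le_lintegral _ _
    _ = ENNReal.ofReal |(c ^ Module.finrank ℝ E)⁻¹| * ∫⁻ x, B.indicator g (x + v) ∂μ := by
        have h3 := lintegral_map (μ := μ) (g := fun x : E => c • x)
          (hgB.comp (measurable_add_const v)) (measurable_const_smul c)
        rw [Measure.map_addHaar_smul μ hc0.ne', lintegral_smul_measure] at h3
        simpa using h3.symm
    _ = ENNReal.ofReal |(c ^ Module.finrank ℝ E)⁻¹| * ∫⁻ x in B, g x ∂μ := by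
        rw [lintegral_add_right_eq_self (fun x => B.indicator g x) v, lintegral_indicator hBm]
    _ ≤ _ := by
        refine mul_le_mul_left ?_ _
        rw [abs_of_pos (by positivity), ← inv_pow]
        calc ENNReal.ofReal (c⁻¹ ^ Module.finrank ℝ E)
            ≤ ENNReal.ofReal (2 ^ Module.finrank ℝ E) := by
              gcongr
              rw [inv_le_comm₀ hc0 two_pos]; linarith
          _ = _ := by rw [ENNReal.ofReal_pow (by norm_num)]; norm_num

/-- For `c ≥ 1/2` the homothety centred at `y` has Jacobian at least `2 ^ (-dim)`, so it can be
inverted in `x`. For `c ≤ 1/2` the roles of `x` and `y` are exchanged, which replaces `c` by `1 - c`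
and avoids the degeneration at `c = 0`. -/
theorem lintegral_segment_le {B : Set E} (hB : Convex ℝ B) (hBm : MeasurableSet B)
    {g : E → ℝ≥0∞} (hg : Measurable g) {c : ℝ} (hc : 0 ≤ c) (hc1 : c ≤ 1) :
    ∫⁻ y in B, ∫⁻ x in B, g (y + c • (x - y)) ∂μ ∂μ ≤
      2 ^ Module.finrank ℝ E * μ B * ∫⁻ x in B, g x ∂μ := by
  have key : ∀ a : ℝ, 1 / 2 ≤ a → a ≤ 1 →
      ∫⁻ y in B, ∫⁻ x in B, g (y + a • (x - y)) ∂μ ∂μ ≤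
        2 ^ Module.finrank ℝ E * μ B * ∫⁻ x in B, g x ∂μ := by
    intro a ha ha1
    calc ∫⁻ y in B, ∫⁻ x in B, g (y + a • (x - y)) ∂μ ∂μ
        ≤ ∫⁻ _ in B, 2 ^ Module.finrank ℝ E * ∫⁻ x in B, g x ∂μ ∂μ :=
          setLIntegral_mono' hBm fun y hy =>
            setLIntegral_comp_homothety_le μ hB hBm hg hy ha ha1
      _ = _ := by rw [setLIntegral_const]; ring
  rcases le_total (1 / 2) c with h | h
  · exact key c h hc1
  · have hm : Measurable fun w : E × E => g (w.1 + c • (w.2 - w.1)) := hg.comp (by fun_prop)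
    rw [lintegral_lintegral_swap hm.aemeasurable]
    have h2 := key (1 - c) (by linarith) (by linarith)
    refine le_trans (le_of_eq ?_) h2
    congr 1; ext x; congr 1; ext y; congr 1
    module

/-- Poincaré inequality on a ball for a `C¹` function that vanishes on a part of the ball. -/
theorem measure_mul_lintegral_rpow_le {φ : E → ℝ} (hφ : ContDiff ℝ 1 φ) {s : ℝ} (hs : 1 ≤ s)
    (x₀ : E) {R : ℝ} {Z : Set E} (hZm : MeasurableSet Z) (hZB : Z ⊆ Metric.ball x₀ R)
    (hZ : ∀ y ∈ Z, φ y = 0) :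
    μ Z * ∫⁻ x in Metric.ball x₀ R, ‖φ x‖ₑ ^ s ∂μ ≤
      ENNReal.ofReal (2 * R) ^ s * (2 ^ Module.finrank ℝ E * μ (Metric.ball x₀ R) *
        ∫⁻ x in Metric.ball x₀ R, ‖fderiv ℝ φ x‖ₑ ^ s ∂μ) := by
  set B := Metric.ball x₀ R
  have hBm : MeasurableSet B := Metric.isOpen_ball.measurableSet
  have hs0 : 0 < s := by linarith
  have hgc : Continuous (fderiv ℝ φ) := hφ.continuous_fderiv one_ne_zero
  set g : E → ℝ≥0∞ := fun x => ‖fderiv ℝ φ x‖ₑ ^ s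
  have hg : Measurable g := hgc.enorm.measurable.pow_const s
  have hG : Measurable fun w : (E × E) × ℝ => g (w.1.1 + w.2 • (w.1.2 - w.1.1)) :=
    hg.comp (by fun_prop)
  -- Since `φ` vanishes on `Z`, averaging `φ x - φ y` over `y ∈ Z` loses nothing; enlarging `Z` to
  -- the ball afterwards makes the double integral symmetric.
  calc μ Z * ∫⁻ x in B, ‖φ x‖ₑ ^ s ∂μ
      = ∫⁻ y in Z, ∫⁻ x in B, ‖φ x - φ y‖ₑ ^ s ∂μ ∂μ := by
        rw [mul_comm, ← setLIntegral_const]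
        refine setLIntegral_congr_fun hZm fun y hy => ?_
        simp only [hZ y hy, sub_zero]
    _ ≤ ∫⁻ y in Z, ∫⁻ x in B, ENNReal.ofReal (2 * R) ^ s *
          (∫⁻ τ in Ioc (0 : ℝ) 1, g (y + τ • (x - y))) ∂μ ∂μ := by
        refine setLIntegral_mono' hZm fun y hy => setLIntegral_mono' hBm fun x hx => ?_
        refine (enorm_sub_rpow_le_lintegral hφ hs x y).trans ?_
        refine mul_le_mul_left (ENNReal.rpow_le_rpow ?_ hs0.le) _
        rw [← ofReal_norm]
        refine ENNReal.ofReal_le_ofReal ?_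
        have h1 := Metric.mem_ball.1 hx
        have h2 := Metric.mem_ball.1 (hZB hy)
        have h3 := dist_triangle_right x y x₀
        rw [← dist_eq_norm]; linarith
    _ ≤ ∫⁻ y in B, ∫⁻ x in B, ENNReal.ofReal (2 * R) ^ s *
          (∫⁻ τ in Ioc (0 : ℝ) 1, g (y + τ • (x - y))) ∂μ ∂μ := lintegral_mono_set hZB
    _ = ENNReal.ofReal (2 * R) ^ s * ∫⁻ y in B, ∫⁻ x in B,
          (∫⁻ τ in Ioc (0 : ℝ) 1, g (y + τ • (x - y))) ∂μ ∂μ := by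
        have hne : ENNReal.ofReal (2 * R) ^ s ≠ ⊤ :=
          ENNReal.rpow_ne_top_of_nonneg hs0.le ENNReal.ofReal_ne_top
        rw [← lintegral_const_mul' _ _ hne]
        exact lintegral_congr fun y => lintegral_const_mul' _ _ hne
    _ = ENNReal.ofReal (2 * R) ^ s * ∫⁻ τ in Ioc (0 : ℝ) 1, (∫⁻ y in B, ∫⁻ x in B,
          g (y + τ • (x - y)) ∂μ ∂μ) := by
        rw [lintegral_lintegral_lintegral_rotate (μ.restrict B) (μ.restrict B) _ hG]
    _ ≤ ENNReal.ofReal (2 * R) ^ s * ∫⁻ τ in Ioc (0 : ℝ) 1,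
          (2 ^ Module.finrank ℝ E * μ B * ∫⁻ x in B, g x ∂μ) := by
        refine mul_le_mul_right (setLIntegral_mono' measurableSet_Ioc fun τ hτ => ?_) _
        exact lintegral_segment_le μ (convex_ball x₀ R) hBm hg hτ.1.le hτ.2
    _ = _ := by simp

end Poincare

/-! ### The Poincaré inequality on slices and cylinders -/

section SlicePoincare

theorem add_rpow_le_two_rpow_mul {a b s S : ℝ} (ha : 0 ≤ a) (hb : 0 ≤ b) (hs : 0 ≤ s)
    (hsS : s ≤ S) : (a + b) ^ s ≤ 2 ^ S * (a ^ s + b ^ s) := by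
  have h2 : (2 : ℝ) ^ s ≤ 2 ^ S := Real.rpow_le_rpow_of_exponent_le one_le_two hsS
  have hab := Real.rpow_nonneg ha s
  have hbb := Real.rpow_nonneg hb s
  rcases le_total a b with h | h
  · calc (a + b) ^ s ≤ (2 * b) ^ s := Real.rpow_le_rpow (by positivity) (by linarith) hs
      _ = 2 ^ s * b ^ s := Real.mul_rpow two_pos.le hb
      _ ≤ 2 ^ S * (a ^ s + b ^ s) := by gcongr; linarith
  · calc (a + b) ^ s ≤ (2 * a) ^ s := Real.rpow_le_rpow (by positivity) (by linarith) hs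
      _ = 2 ^ s * a ^ s := Real.mul_rpow two_pos.le ha
      _ ≤ 2 ^ S * (a ^ s + b ^ s) := by gcongr; linarith

theorem rpow_le_one_add_rpow {a s t : ℝ} (ha : 0 ≤ a) (hs : 0 ≤ s) (hst : s ≤ t) :
    a ^ s ≤ 1 + a ^ t := by
  rcases le_total a 1 with h | h
  · have := Real.rpow_le_one ha h hs
    have := Real.rpow_nonneg ha t
    linarith
  · have := Real.rpow_le_rpow_of_exponent_le h hst
    linarith

variable {n : ℕ}

theorem enorm_rpow_eq_ofReal {F : Type*} [NormedAddCommGroup F] (x : F) {s : ℝ} (hs : 0 ≤ s) :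
    ‖x‖ₑ ^ s = ENNReal.ofReal (‖x‖ ^ s) := by
  rw [← ofReal_norm, ENNReal.ofReal_rpow_of_nonneg (norm_nonneg _) hs]

theorem norm_gradient_eq (φ : EuclideanSpace ℝ (Fin n) → ℝ) (x : EuclideanSpace ℝ (Fin n)) :
    ‖gradient φ x‖ = ‖fderiv ℝ φ x‖ := by
  rw [gradient, LinearIsometryEquiv.norm_map]

/-- The constant in `IsMeasureDensityDomain.poincare_smooth`. -/
def smoothPoincareConst (n : ℕ) (m S : ℝ) : ℝ := 2 ^ S * 2 ^ n / m

/-- A test function supported in Ω vanishes on the complement, which fills at least the fraction `m`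
of a ball centred on the boundary. The volume of the ball cancels, and so does `R`, so that the
constant is scale invariant. -/
theorem IsMeasureDensityDomain.poincare_smooth {m : ℝ} (hm : 0 < m)
    {Ω : Set (EuclideanSpace ℝ (Fin n))}
    (hΩ : IsMeasureDensityDomain m Ω) {x₀ : EuclideanSpace ℝ (Fin n)} (hx₀ : x₀ ∈ frontier Ω)
    {R s S : ℝ} (hR : 0 < R) (hs : 1 ≤ s) (hsS : s ≤ S) {φ : EuclideanSpace ℝ (Fin n) → ℝ}
    (hφ : ContDiff ℝ 1 φ) (hφΩ : tsupport φ ⊆ Ω) :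
    ∫⁻ x in Metric.ball x₀ R, ENNReal.ofReal ((|φ x| / R) ^ s) ≤
      ENNReal.ofReal (smoothPoincareConst n m S) *
        ∫⁻ x in Metric.ball x₀ R, ENNReal.ofReal (‖gradient φ x‖ ^ s) := by
  have hs0 : 0 ≤ s := by linarith
  set B := Metric.ball x₀ R
  have hB0 : volume B ≠ 0 := (Metric.measure_ball_pos _ _ hR).ne'
  have hBt : volume B ≠ ⊤ := measure_ball_lt_top.ne
  have h1 := measure_mul_lintegral_rpow_le volume hφ hs x₀ (R := R) (Z := Ωᶜ ∩ B)
    (hΩ.isOpen.measurableSet.compl.inter Metric.isOpen_ball.measurableSet) inter_subset_right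
    (fun y hy => image_eq_zero_of_notMem_tsupport fun h => hy.1 (hφΩ h))
  rw [finrank_euclideanSpace_fin] at h1
  set J := ∫⁻ x in B, ‖fderiv ℝ φ x‖ₑ ^ s with hJ
  set I := ∫⁻ x in B, ‖φ x‖ₑ ^ s with hI
  have h2 : volume B * (ENNReal.ofReal m * I) ≤
      volume B * (ENNReal.ofReal (2 * R) ^ s * 2 ^ n * J) := by
    calc volume B * (ENNReal.ofReal m * I) = ENNReal.ofReal m * volume B * I := by ring
      _ ≤ volume (Ωᶜ ∩ B) * I := by gcongr; exact hΩ.density x₀ hx₀ R hR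
      _ ≤ _ := h1
      _ = _ := by ring
  have h3 := (ENNReal.mul_le_mul_iff_right hB0 hBt).1 h2
  have hJ' : J = ∫⁻ x in B, ENNReal.ofReal (‖gradient φ x‖ ^ s) :=
    lintegral_congr fun x => by rw [enorm_rpow_eq_ofReal _ hs0, norm_gradient_eq]
  have hI' : ∫⁻ x in B, ENNReal.ofReal ((|φ x| / R) ^ s) =
      ENNReal.ofReal ((R⁻¹) ^ s) * I := by
    rw [← lintegral_const_mul' _ _ ENNReal.ofReal_ne_top]
    refine lintegral_congr fun x => ?_
    rw [enorm_rpow_eq_ofReal _ hs0, ← ENNReal.ofReal_mul (by positivity), Real.norm_eq_abs,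
      ← Real.mul_rpow (by positivity) (by positivity), div_eq_inv_mul]
  rw [hI', ← hJ']
  have hmm : ENNReal.ofReal m⁻¹ * ENNReal.ofReal m = 1 := by
    rw [← ENNReal.ofReal_mul (by positivity), inv_mul_cancel₀ hm.ne', ENNReal.ofReal_one]
  calc ENNReal.ofReal (R⁻¹ ^ s) * I
      = ENNReal.ofReal (R⁻¹ ^ s) * (ENNReal.ofReal m⁻¹ * (ENNReal.ofReal m * I)) := by
        rw [← mul_assoc (ENNReal.ofReal m⁻¹), hmm, one_mul]
    _ ≤ ENNReal.ofReal (R⁻¹ ^ s) *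
          (ENNReal.ofReal m⁻¹ * (ENNReal.ofReal (2 * R) ^ s * 2 ^ n * J)) := by gcongr
    _ = ENNReal.ofReal (R⁻¹ ^ s * m⁻¹ * (2 * R) ^ s * 2 ^ n) * J := by
        rw [ENNReal.ofReal_rpow_of_nonneg (by positivity) hs0,
          ENNReal.ofReal_mul (by positivity), ENNReal.ofReal_mul (by positivity),
          ENNReal.ofReal_mul (by positivity), ENNReal.ofReal_pow (by norm_num), show ENNReal.ofReal 2 = 2 by norm_num]
        ring
    _ ≤ _ := by
        gcongr
        rw [smoothPoincareConst]
        have h5 : R⁻¹ ^ s * (2 * R) ^ s = 2 ^ s := by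
          rw [← Real.mul_rpow (by positivity) (by positivity)]; congr 1; field_simp
        calc R⁻¹ ^ s * m⁻¹ * (2 * R) ^ s * 2 ^ n = (R⁻¹ ^ s * (2 * R) ^ s) * 2 ^ n / m := by
              field_simp
          _ = 2 ^ s * 2 ^ n / m := by rw [h5]
          _ ≤ _ := by
              gcongr
              exact one_le_two

/-- The constant in `IsMeasureDensityDomain.poincare_slice`. -/
def poincareConst (n : ℕ) (m S : ℝ) : ℝ := 2 ^ S * (smoothPoincareConst n m S * 2 ^ S + 1)

theorem poincareConst_pos (n : ℕ) {m : ℝ} (hm : 0 < m) (S : ℝ) : 0 < poincareConst n m S := by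
  unfold poincareConst smoothPoincareConst; positivity

/-- The exponent on the left is a constant below `s(x)`, so the constant-exponent inequality applies
to the approximating test functions. The `+ 1` next to `‖Dv‖` absorbs the passage between exponents.
-/
theorem IsMeasureDensityDomain.poincare_slice {m : ℝ} (hm : 0 < m)
    {Ω : Set (EuclideanSpace ℝ (Fin n))}
    (hΩ : IsMeasureDensityDomain m Ω) {x₀ : EuclideanSpace ℝ (Fin n)} (hx₀ : x₀ ∈ frontier Ω)
    {R s₀ S : ℝ} (hR : 0 < R) (hR1 : R ≤ 1) (hs₀ : 1 ≤ s₀)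
    {s : EuclideanSpace ℝ (Fin n) → ℝ} (hs : Measurable s)
    (hs₀s : ∀ x ∈ Metric.ball x₀ R, s₀ ≤ s x) (hsS : ∀ x ∈ Metric.ball x₀ R, s x ≤ S)
    {v : EuclideanSpace ℝ (Fin n) → ℝ}
    {Dv : EuclideanSpace ℝ (Fin n) → EuclideanSpace ℝ (Fin n)} (hDv : AEMeasurable Dv)
    (hout : ∀ x ∉ Ω, v x = 0 ∧ Dv x = 0) (hv : MemSobolevZero Ω s v Dv) :
    ∫⁻ x in Metric.ball x₀ R, ENNReal.ofReal ((|v x| / R) ^ s₀) ≤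
      ENNReal.ofReal (poincareConst n m S) *
        ∫⁻ x in Metric.ball x₀ R, ENNReal.ofReal ((‖Dv x‖ + 1) ^ s x) := by
  obtain ⟨φ, hφ, hlim⟩ := hv
  set B := Metric.ball x₀ R with hBdef
  have hBm : MeasurableSet B := Metric.isOpen_ball.measurableSet
  have hs₀0 : 0 ≤ s₀ := by linarith
  have hx₀B : x₀ ∈ B := Metric.mem_ball_self hR
  have hs₀S : s₀ ≤ S := (hs₀s x₀ hx₀B).trans (hsS x₀ hx₀B)
  have hA0 : 0 ≤ smoothPoincareConst n m S := by unfold smoothPoincareConst; positivity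
  set K := ∫⁻ x in B, ENNReal.ofReal ((‖Dv x‖ + 1) ^ s x) with hK
  have hKm : AEMeasurable (fun x => ENNReal.ofReal ((‖Dv x‖ + 1) ^ s x)) (volume.restrict B) :=
    ((hDv.norm.add_const 1).pow hs.aemeasurable).ennreal_ofReal.restrict
  set δ : ℕ → ℝ≥0∞ := fun k => ∫⁻ x in Ω, (ENNReal.ofReal (|v x - φ k x| ^ s x) +
    ENNReal.ofReal (‖Dv x - gradient (φ k) x‖ ^ s x)) with hδ
  have hgrad0 : ∀ k, ∀ x ∉ Ω, gradient (φ k) x = 0 := by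
    intro k x hx
    have h1 : x ∉ tsupport (φ k) := fun h => hx ((hφ k).2.2 h)
    have h2 : fderiv ℝ (φ k) x = 0 := by
      by_contra h3
      exact h1 (support_fderiv_subset ℝ (Function.mem_support.2 h3))
    rw [gradient, h2, map_zero]
  have hφ0 : ∀ k, ∀ x ∉ Ω, φ k x = 0 := fun k x hx =>
    image_eq_zero_of_notMem_tsupport fun h => hx ((hφ k).2.2 h)
  have hle : ∀ k, ∀ f : EuclideanSpace ℝ (Fin n) → ℝ, (∀ x ∉ Ω, f x = 0) →
      (∀ x, ENNReal.ofReal (|f x| ^ s x) ≤ ENNReal.ofReal (|v x - φ k x| ^ s x) +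
        ENNReal.ofReal (‖Dv x - gradient (φ k) x‖ ^ s x)) →
      ∫⁻ x in B, ENNReal.ofReal (|f x| ^ s x) ≤ δ k := by
    intro k f hf hfle
    calc ∫⁻ x in B, ENNReal.ofReal (|f x| ^ s x)
        ≤ ∫⁻ x in B, Ω.indicator (fun x => ENNReal.ofReal (|f x| ^ s x)) x := by
          refine setLIntegral_mono' hBm fun x hx => ?_
          by_cases hxΩ : x ∈ Ω
          · rw [indicator_of_mem hxΩ]
          · have : s x ≠ 0 := by linarith [hs₀s x hx]
            rw [hf x hxΩ, abs_zero, Real.zero_rpow this, ENNReal.ofReal_zero]; exact zero_le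
      _ ≤ ∫⁻ x, Ω.indicator (fun x => ENNReal.ofReal (|f x| ^ s x)) x :=
          setLIntegral_le_lintegral _ _
      _ = ∫⁻ x in Ω, ENNReal.ofReal (|f x| ^ s x) := lintegral_indicator hΩ.isOpen.measurableSet _
      _ ≤ δ k := lintegral_mono hfle
  have hδ1 : ∀ k, ∫⁻ x in B, ENNReal.ofReal (|v x - φ k x| ^ s x) ≤ δ k := fun k =>
    hle k _ (fun x hx => by rw [(hout x hx).1, hφ0 k x hx, sub_zero]) fun x => le_self_add
  have hδ2 : ∀ k, ∫⁻ x in B, ENNReal.ofReal (‖Dv x - gradient (φ k) x‖ ^ s x) ≤ δ k := fun k => by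
    have := hle k (fun x => ‖Dv x - gradient (φ k) x‖)
      (fun x hx => by rw [(hout x hx).2, hgrad0 k x hx, sub_zero, norm_zero])
      (fun x => by rw [abs_norm]; exact le_add_self)
    simpa only [abs_norm] using this
  have hgradle : ∀ k, ∫⁻ x in B, ENNReal.ofReal (‖gradient (φ k) x‖ ^ s₀) ≤
      ENNReal.ofReal (2 ^ S) * (δ k + K) := by
    intro k
    calc ∫⁻ x in B, ENNReal.ofReal (‖gradient (φ k) x‖ ^ s₀)
        ≤ ∫⁻ x in B, ENNReal.ofReal (2 ^ S) * (ENNReal.ofReal (‖Dv x - gradient (φ k) x‖ ^ s x) +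
            ENNReal.ofReal ((‖Dv x‖ + 1) ^ s x)) := by
          refine setLIntegral_mono' hBm fun x hx => ?_
          rw [← ENNReal.ofReal_add (by positivity) (by positivity),
            ← ENNReal.ofReal_mul (by positivity)]
          refine ENNReal.ofReal_le_ofReal ?_
          have hsx : 0 ≤ s x := hs₀0.trans (hs₀s x hx)
          have h0 : ‖gradient (φ k) x‖ ≤ ‖Dv x - gradient (φ k) x‖ + ‖Dv x‖ := by
            have := norm_sub_norm_le (gradient (φ k) x) (Dv x)
            rw [norm_sub_rev] at this; linarith
          calc ‖gradient (φ k) x‖ ^ s₀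
              ≤ (‖Dv x - gradient (φ k) x‖ + (‖Dv x‖ + 1)) ^ s₀ :=
                Real.rpow_le_rpow (norm_nonneg _) (by linarith) hs₀0
            _ ≤ (‖Dv x - gradient (φ k) x‖ + (‖Dv x‖ + 1)) ^ s x := by
                refine Real.rpow_le_rpow_of_exponent_le ?_ (hs₀s x hx)
                linarith [norm_nonneg (Dv x - gradient (φ k) x), norm_nonneg (Dv x)]
            _ ≤ _ := add_rpow_le_two_rpow_mul (norm_nonneg _) (by positivity) hsx (hsS x hx)
      _ = ENNReal.ofReal (2 ^ S) * ((∫⁻ x in B, ENNReal.ofReal (‖Dv x - gradient (φ k) x‖ ^ s x))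
            + K) := by
          rw [lintegral_const_mul' _ _ ENNReal.ofReal_ne_top, lintegral_add_right' _ hKm]
      _ ≤ _ := by gcongr; exact hδ2 k
  -- The approximation error carries the factor `R⁻¹ ^ S`, which is not scale invariant, but it
  -- multiplies `δ k → 0` and disappears in the limit.
  have hmain : ∀ k, ∫⁻ x in B, ENNReal.ofReal ((|v x| / R) ^ s₀) ≤
      ENNReal.ofReal (2 ^ S) * (ENNReal.ofReal (smoothPoincareConst n m S) *
        (ENNReal.ofReal (2 ^ S) * (δ k + K)) + (K + ENNReal.ofReal (R⁻¹ ^ S) * δ k)) := by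
    intro k
    have hφm : Measurable fun x => ENNReal.ofReal ((|φ k x| / R) ^ s₀) :=
      ((((hφ k).1.continuous.abs.div_const R).measurable).pow_const s₀).ennreal_ofReal
    calc ∫⁻ x in B, ENNReal.ofReal ((|v x| / R) ^ s₀)
        ≤ ∫⁻ x in B, ENNReal.ofReal (2 ^ S) * (ENNReal.ofReal ((|φ k x| / R) ^ s₀) +
            (ENNReal.ofReal ((‖Dv x‖ + 1) ^ s x) +
              ENNReal.ofReal (R⁻¹ ^ S) * ENNReal.ofReal (|v x - φ k x| ^ s x))) := by
          refine setLIntegral_mono' hBm fun x hx => ?_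
          rw [← ENNReal.ofReal_mul (by positivity),
            ← ENNReal.ofReal_add (by positivity) (by positivity),
            ← ENNReal.ofReal_add (by positivity) (by positivity),
            ← ENNReal.ofReal_mul (by positivity)]
          refine ENNReal.ofReal_le_ofReal ?_
          have hsx : 0 ≤ s x := hs₀0.trans (hs₀s x hx)
          have h0 : |v x| / R ≤ |φ k x| / R + |v x - φ k x| / R := by
            rw [← add_div]; gcongr
            have := abs_sub_abs_le_abs_sub (v x) (φ k x); linarith
          have h1 : 1 ≤ (‖Dv x‖ + 1) ^ s x :=
            Real.one_le_rpow (by linarith [norm_nonneg (Dv x)]) hsx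
          calc (|v x| / R) ^ s₀ ≤ (|φ k x| / R + |v x - φ k x| / R) ^ s₀ :=
                Real.rpow_le_rpow (by positivity) h0 hs₀0
            _ ≤ 2 ^ S * ((|φ k x| / R) ^ s₀ + (|v x - φ k x| / R) ^ s₀) :=
                add_rpow_le_two_rpow_mul (by positivity) (by positivity) hs₀0 hs₀S
            _ ≤ 2 ^ S * ((|φ k x| / R) ^ s₀ + ((‖Dv x‖ + 1) ^ s x +
                  R⁻¹ ^ S * |v x - φ k x| ^ s x)) := by
                gcongr
                refine (rpow_le_one_add_rpow (by positivity) hs₀0 (hs₀s x hx)).trans ?_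
                refine add_le_add h1 ?_
                rw [div_eq_inv_mul, Real.mul_rpow (by positivity) (by positivity)]
                gcongr
                · exact (one_le_inv₀ hR).2 hR1
                · exact hsS x hx
      _ = ENNReal.ofReal (2 ^ S) * ((∫⁻ x in B, ENNReal.ofReal ((|φ k x| / R) ^ s₀)) +
            (K + ENNReal.ofReal (R⁻¹ ^ S) *
              ∫⁻ x in B, ENNReal.ofReal (|v x - φ k x| ^ s x))) := by
          rw [lintegral_const_mul' _ _ ENNReal.ofReal_ne_top, lintegral_add_left hφm,
            lintegral_add_left' hKm, lintegral_const_mul' _ _ ENNReal.ofReal_ne_top]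
      _ ≤ _ := by
          have h2 := hΩ.poincare_smooth hm hx₀ hR hs₀ hs₀S
            ((hφ k).1.of_le (by exact_mod_cast le_top)) (hφ k).2.2
          have h3 := hgradle k
          have h4 := hδ1 k
          gcongr
          exact h2.trans (by gcongr)
  have hlim' : Tendsto (fun k => ENNReal.ofReal (2 ^ S) *
      (ENNReal.ofReal (smoothPoincareConst n m S) * (ENNReal.ofReal (2 ^ S) * (δ k + K)) +
        (K + ENNReal.ofReal (R⁻¹ ^ S) * δ k))) atTop (𝓝 (ENNReal.ofReal (2 ^ S) *
      (ENNReal.ofReal (smoothPoincareConst n m S) * (ENNReal.ofReal (2 ^ S) * (0 + K)) +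
        (K + ENNReal.ofReal (R⁻¹ ^ S) * 0)))) := by
    have c1 : ∀ a : ℝ, ENNReal.ofReal a ≠ ⊤ := fun a => ENNReal.ofReal_ne_top
    refine ENNReal.Tendsto.const_mul (Tendsto.add (ENNReal.Tendsto.const_mul
      (ENNReal.Tendsto.const_mul (Tendsto.add hlim tendsto_const_nhds) (Or.inr (c1 _)))
      (Or.inr (c1 _))) (Tendsto.add tendsto_const_nhds
      (ENNReal.Tendsto.const_mul hlim (Or.inr (c1 _))))) (Or.inr (c1 _))
  refine (ge_of_tendsto' hlim' hmain).trans_eq ?_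
  rw [poincareConst, ENNReal.ofReal_mul (by positivity), ENNReal.ofReal_add (by positivity)
    zero_le_one, ENNReal.ofReal_mul hA0, ENNReal.ofReal_one]
  ring

theorem IsMeasureDensityDomain.poincare_cylinder {m : ℝ} (hm : 0 < m)
    {Ω : Set (EuclideanSpace ℝ (Fin n))}
    (hΩ : IsMeasureDensityDomain m Ω) {z₀ : SpaceTime n} (hz₀ : z₀.1 ∈ frontier Ω)
    {R b s₀ S T : ℝ} (hR : 0 < R) (hR1 : R ≤ 1) (hs₀ : 1 ≤ s₀)
    {s : SpaceTime n → ℝ} (hs : Measurable s)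
    (hs₀s : ∀ z ∈ cyl R b z₀, s₀ ≤ s z) (hsS : ∀ z ∈ cyl R b z₀, s z ≤ S)
    {u : SpaceTime n → ℝ} {Du : SpaceTime n → EuclideanSpace ℝ (Fin n)}
    (hu : MemParabolicSpace Ω T s u Du) :
    ∫⁻ z in cyl R b z₀, ENNReal.ofReal ((|u z| / R) ^ s₀) ≤
      ENNReal.ofReal (poincareConst n m S) *
        ∫⁻ z in cyl R b z₀, ENNReal.ofReal ((‖Du z‖ + 1) ^ s z) := by
  have hum : AEMeasurable (fun z => ENNReal.ofReal ((|u z| / R) ^ s₀)) :=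
    ((hu.aemeasurable.norm.div_const R).pow_const s₀).ennreal_ofReal
  have hDum : AEMeasurable (fun z => ENNReal.ofReal ((‖Du z‖ + 1) ^ s z)) :=
    ((hu.aemeasurable_grad.norm.add_const 1).pow hs.aemeasurable).ennreal_ofReal
  have hslice : ∀ᵐ t : ℝ, AEMeasurable (fun x => Du (x, t)) := by
    obtain ⟨g, hg, hgD⟩ := hu.aemeasurable_grad
    have h1 : ∀ᵐ w : ℝ × EuclideanSpace ℝ (Fin n), Du w.swap = g w.swap :=
      (Measure.measurePreserving_swap (μ := (volume : Measure ℝ))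
        (ν := (volume : Measure (EuclideanSpace ℝ (Fin n))))).quasiMeasurePreserving.ae hgD
    filter_upwards [Measure.ae_ae_of_ae_prod h1] with t ht
    exact ⟨fun x => g (x, t), hg.comp measurable_prodMk_right, ht⟩
  have hsl := (ae_restrict_iff' measurableSet_Ioo).1 hu.slice
  have hr : (volume : Measure (SpaceTime n)).restrict (cyl R b z₀) =
      (volume.restrict (Metric.ball z₀.1 R)).prod
        (volume.restrict (Ioo (z₀.2 - b) (z₀.2 + b))) := by
    rw [cyl, Measure.volume_eq_prod, Measure.prod_restrict]
  have hum' := hum.restrict (s := cyl R b z₀)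
  have hDum' := hDum.restrict (s := cyl R b z₀)
  rw [hr] at hum' hDum' ⊢
  rw [lintegral_prod_symm _ hum', lintegral_prod_symm _ hDum',
    ← lintegral_const_mul' _ _ ENNReal.ofReal_ne_top]
  refine lintegral_mono_ae ?_
  refine (ae_restrict_iff' measurableSet_Ioo).2 ?_
  filter_upwards [hslice, hsl] with t ht1 ht2 htI
  by_cases htT : t ∈ Ioo (-T) T
  · exact hΩ.poincare_slice hm hz₀ hR hR1 hs₀ (s := fun x => s (x, t))
      (hs.comp measurable_prodMk_right) (fun x hx => hs₀s _ ⟨hx, htI⟩)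
      (fun x hx => hsS _ ⟨hx, htI⟩) ht1 (fun x hx => hu.zero_outside _ fun h => hx h.1) (ht2 htT)
  · have h0 : ∀ x, u (x, t) = 0 := fun x => (hu.zero_outside _ fun h => htT h.2).1
    have hs₀' : s₀ ≠ 0 := by linarith
    simp only [h0, abs_zero, zero_div, Real.zero_rpow hs₀', ENNReal.ofReal_zero, lintegral_zero]
    exact zero_le

end SlicePoincare

/-! ### The common setting of the estimates -/

/-- Restrictions on the fixed constants. -/
structure FixedConstants (n : ℕ) (pm pp L m q β₀ : ℝ) : Prop where
  one_le_n : 1 ≤ n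
  one_lt_pm : 1 < pm
  pm_le_pp : pm ≤ pp
  L_pos : 0 < L
  m_pos : 0 < m
  one_lt_q : 1 < q
  β₀_pos : 0 < β₀
  β₀_lt : β₀ < 1 - 1 / q
  β₀_le : β₀ ≤ 1 / 2

/-- The objects entering the construction of the bad set, with their standing hypotheses. -/
structure CoverSetting (n : ℕ) (pm pp L m q β₀ : ℝ) where
  const : FixedConstants n pm pp L m q β₀
  p : SpaceTime n → ℝ
  om : ℝ → ℝ
  Ω : Set (EuclideanSpace ℝ (Fin n))
  T : ℝ
  β : ℝ
  u : SpaceTime n → ℝ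
  Du : SpaceTime n → EuclideanSpace ℝ (Fin n)
  z₀ : SpaceTime n
  ρ₀ : ℝ
  d : ℝ
  α₀ : ℝ
  ρ : ℝ
  ρb : ℝ
  lam : ℝ
  logHolder : IsLogHolderExponent pm pp L p
  logModulus : IsLogModulus L p om
  domain : IsMeasureDensityDomain m Ω
  β_pos : 0 < β
  β_lt : β < β₀
  exponent : ∀ z, 1 < p z * (1 - β)
  mem : MemParabolicSpace Ω T (fun z => p z * (1 - β)) u Du
  boundary : z₀.1 ∈ frontier Ω
  radius : RadiusRestrictions p om L (energy Ω T β p u Du) ρ₀ z₀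
  exps : ExponentRestrictions p q β₀ d ρ₀ z₀
  one_le_α₀ : 1 ≤ α₀
  ρ_pos : 0 < ρ
  ρ_le : 128 * ρ ≤ ρ₀
  stopping : StoppingCondition p d β α₀ ρ z₀ Du
  ρ_lt_ρb : ρ < ρb
  ρb_le : ρb ≤ 16 * ρ
  α₀_le_lam : α₀ ≤ lam

theorem measurableSet_cyl {n : ℕ} (a b : ℝ) (z : SpaceTime n) : MeasurableSet (cyl a b z) :=
  Metric.isOpen_ball.measurableSet.prod measurableSet_Ioo

theorem measurableSet_intrinsicCyl {n : ℕ} (p : SpaceTime n → ℝ) (d μ r : ℝ) (z : SpaceTime n) :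
    MeasurableSet (intrinsicCyl p d μ r z) :=
  measurableSet_cyl _ _ _

/-- Twice the volume of the unit ball. -/
def volConst (n : ℕ) : ℝ := 2 * (volume (Metric.ball (0 : EuclideanSpace ℝ (Fin n)) 1)).toReal

theorem volConst_pos (n : ℕ) : 0 < volConst n :=
  mul_pos two_pos (ENNReal.toReal_pos (Metric.measure_ball_pos _ _ one_pos).ne'
    measure_ball_lt_top.ne)

/-- The exponent of `μ` in the volume of an intrinsic cylinder. -/
def volExp {n : ℕ} (p : SpaceTime n → ℝ) (d : ℝ) (z : SpaceTime n) : ℝ :=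
  n * (-(1 / p z) + d / 2) + (-1 + d)

theorem volume_intrinsicCyl {n : ℕ} (p : SpaceTime n → ℝ) (d : ℝ) {μ r : ℝ} (hμ : 0 < μ)
    (hr : 0 < r) (z : SpaceTime n) :
    volume (intrinsicCyl p d μ r z) =
      ENNReal.ofReal (volConst n * μ ^ volExp p d z * r ^ (n + 2)) := by
  have h1 : 0 < scaleX p d μ z := Real.rpow_pos_of_pos hμ _
  have h2 : 0 < scaleT d μ := Real.rpow_pos_of_pos hμ _
  have hb : volume (Metric.ball (0 : EuclideanSpace ℝ (Fin n)) 1) =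
      ENNReal.ofReal (volConst n / 2) := by
    rw [volConst, mul_div_cancel_left₀ _ two_ne_zero, ENNReal.ofReal_toReal
      measure_ball_lt_top.ne]
  rw [intrinsicCyl, cyl, Measure.volume_eq_prod, Measure.prod_prod,
    Measure.addHaar_ball_of_pos _ _ (by positivity), hb, Real.volume_Ioo,
    finrank_euclideanSpace_fin,
    ← ENNReal.ofReal_mul (by positivity),
    ← ENNReal.ofReal_mul (by have := volConst_pos n; positivity)]
  congr 1
  have h3 : μ ^ volExp p d z = scaleX p d μ z ^ n * scaleT d μ := by
    rw [volExp, Real.rpow_add hμ, scaleX, scaleT, ← Real.rpow_natCast, ← Real.rpow_mul hμ.le]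
    congr 2; ring
  rw [h3]; ring

theorem mem_intrinsicCyl_iff {n : ℕ} {p : SpaceTime n → ℝ} {d μ r : ℝ} (hμ : 0 < μ) (hr : 0 < r)
    {z w : SpaceTime n} : w ∈ intrinsicCyl p d μ r z ↔ locDist p d μ z z w < r := by
  have h1 : 0 < scaleX p d μ z := Real.rpow_pos_of_pos hμ _
  have h2 : 0 < scaleT d μ := Real.rpow_pos_of_pos hμ _
  have e1 : μ ^ (1 / p z - d / 2) = (scaleX p d μ z)⁻¹ := by
    rw [scaleX, ← Real.rpow_neg hμ.le]; congr 1; ring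
  have e2 : μ ^ (1 - d) = (scaleT d μ)⁻¹ := by
    rw [scaleT, ← Real.rpow_neg hμ.le]; congr 1; ring
  rw [locDist, max_lt_iff, Real.sqrt_lt' hr, e1, e2, inv_mul_lt_iff₀ h1, inv_mul_lt_iff₀ h2,
    abs_lt, intrinsicCyl, cyl, mem_prod, Metric.mem_ball, mem_Ioo, dist_comm, dist_eq_norm]
  refine and_congr Iff.rfl ⟨fun h => ⟨by linarith [h.2], by linarith [h.1]⟩,
    fun h => ⟨by linarith [h.2], by linarith [h.1]⟩⟩

/-! ### Scalings, volumes and energies in the common setting. -/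

namespace CoverSetting

variable {n : ℕ} {pm pp L m q β₀ : ℝ} (D : CoverSetting n pm pp L m q β₀)

theorem one_lt_p (z : SpaceTime n) : 1 < D.p z := D.const.one_lt_pm.trans_le (D.logHolder.lower z)

theorem p_pos (z : SpaceTime n) : 0 < D.p z := one_pos.trans (D.one_lt_p z)

theorem one_le_lam : 1 ≤ D.lam := D.one_le_α₀.trans D.α₀_le_lam

theorem ρb_pos : 0 < D.ρb := D.ρ_pos.trans D.ρ_lt_ρb

theorem ρ_lt : D.ρ < 1 / 128 := by linarith [D.ρ_le, D.radius.lt_one]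

theorem one_sub_β_pos : 0 < 1 - D.β := by linarith [D.β_lt, D.const.β₀_le]

theorem pInf_le {z : SpaceTime n} (hz : z ∈ largeCyl D.ρ₀ D.z₀) : pInf D.p D.ρ₀ D.z₀ ≤ D.p z :=
  csInf_le ⟨pm, forall_mem_image.2 fun w _ => D.logHolder.lower w⟩ (mem_image_of_mem _ hz)

theorem le_pSup {z : SpaceTime n} (hz : z ∈ largeCyl D.ρ₀ D.z₀) : D.p z ≤ pSup D.p D.ρ₀ D.z₀ :=
  le_csSup ⟨pp, forall_mem_image.2 fun w _ => D.logHolder.upper w⟩ (mem_image_of_mem _ hz)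

theorem center_mem_largeCyl : D.z₀ ∈ largeCyl D.ρ₀ D.z₀ := by
  have := D.radius.pos
  refine ⟨Metric.mem_ball_self (by positivity), ?_, ?_⟩ <;> nlinarith [sq_nonneg (128 * D.ρ₀)]

theorem pm_le_pInf : pm ≤ pInf D.p D.ρ₀ D.z₀ :=
  le_csInf ⟨_, mem_image_of_mem _ D.center_mem_largeCyl⟩
    (forall_mem_image.2 fun w _ => D.logHolder.lower w)

theorem expX_nonpos {z : SpaceTime n} (hz : z ∈ largeCyl D.ρ₀ D.z₀) :
    -(1 / D.p z) + D.d / 2 ≤ 0 := by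
  have h1 := D.p_pos z
  have h2 := D.le_pSup hz
  have h3 : D.d < 2 / pSup D.p D.ρ₀ D.z₀ := D.exps.d_upper.trans_le (min_le_left _ _)
  have h4 : 2 / pSup D.p D.ρ₀ D.z₀ ≤ 2 / D.p z := by gcongr
  have h5 : 2 / D.p z = 2 * (1 / D.p z) := by ring
  linarith

theorem d_pos : 0 < D.d := by
  refine lt_of_le_of_lt ?_ D.exps.d_lower
  have := D.pm_le_pInf
  have := D.const.one_lt_pm
  have : 0 < pInf D.p D.ρ₀ D.z₀ := by linarith
  positivity

theorem d_lt_one : D.d < 1 := D.exps.d_upper.trans_le (min_le_right _ _)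

theorem scaleX_le_one {z : SpaceTime n} (hz : z ∈ largeCyl D.ρ₀ D.z₀) {μ : ℝ} (hμ : 1 ≤ μ) :
    scaleX D.p D.d μ z ≤ 1 :=
  Real.rpow_le_one_of_one_le_of_nonpos hμ (D.expX_nonpos hz)

theorem scaleT_le_one {μ : ℝ} (hμ : 1 ≤ μ) : scaleT D.d μ ≤ 1 :=
  Real.rpow_le_one_of_one_le_of_nonpos hμ (by linarith [D.d_lt_one])

theorem volExp_nonpos {z : SpaceTime n} (hz : z ∈ largeCyl D.ρ₀ D.z₀) :
    volExp D.p D.d z ≤ 0 := by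
  have h1 := D.expX_nonpos hz
  have h2 := D.d_lt_one
  have h3 : (n : ℝ) * (-(1 / D.p z) + D.d / 2) ≤ 0 :=
    mul_nonpos_of_nonneg_of_nonpos (Nat.cast_nonneg n) h1
  unfold volExp; linarith

/-- This is where the restriction linking `d` and `β₀` enters: a cylinder shrinks in μ no faster
than `μ ^ (2 * β₀ - 1)`, so multiplying its volume by `μ ^ η` with `η > 1 - 2β₀` leaves a positive
power of μ. -/
theorem le_volExp {z : SpaceTime n} (hz : z ∈ largeCyl D.ρ₀ D.z₀) :
    2 * β₀ - 1 ≤ volExp D.p D.d z := by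
  have h1 := D.exps.beta_d
  have h2 := D.pInf_le hz
  have h3 : 0 < pInf D.p D.ρ₀ D.z₀ := by linarith [D.pm_le_pInf, D.const.one_lt_pm]
  have h4 : (n : ℝ) / D.p z ≤ n / pInf D.p D.ρ₀ D.z₀ := by gcongr
  have h5 : volExp D.p D.d z = D.d * (n + 2) / 2 - n / D.p z - 1 := by unfold volExp; ring
  linarith

/-- Both scaling factors are at most 1 when `μ ≥ 1`, because `d < 2/p⁺` and `d < 1`. Hence intrinsic
radii control parabolic distances, and thereby the oscillation of `p`. -/
theorem parDist_le_of_mem {μ r : ℝ} (hμ : 1 ≤ μ) (hr : 0 < r) {z w : SpaceTime n}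
    (hz : z ∈ largeCyl D.ρ₀ D.z₀) (hw : w ∈ intrinsicCyl D.p D.d μ r z) : parDist w z ≤ r := by
  have hX := D.scaleX_le_one hz hμ
  have hT := D.scaleT_le_one (μ := μ) hμ
  have h1 := Metric.mem_ball.1 hw.1
  have h2 := hw.2
  rw [dist_eq_norm] at h1
  refine max_le (h1.le.trans (mul_le_of_le_one_left hr.le hX)) ?_
  refine Real.sqrt_le_iff.2 ⟨hr.le, ?_⟩
  have h3 : scaleT D.d μ * r ^ 2 ≤ r ^ 2 := mul_le_of_le_one_left (sq_nonneg r) hT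
  exact abs_le.2 ⟨by linarith [h2.1], by linarith [h2.2]⟩

theorem intrinsicCyl_subset_largeCyl {r : ℝ} (hr : 0 < r) (hrρ : r ≤ 16 * D.ρ) :
    intrinsicCyl D.p D.d D.α₀ r D.z₀ ⊆ largeCyl D.ρ₀ D.z₀ := by
  have hX := D.scaleX_le_one D.center_mem_largeCyl D.one_le_α₀
  have hT := D.scaleT_le_one D.one_le_α₀
  have hρ := D.ρ_le
  have hr0 : r ≤ 128 * D.ρ₀ := by linarith [D.ρ_pos, D.radius.pos]
  refine prod_mono (Metric.ball_subset_ball ((mul_le_of_le_one_left hr.le hX).trans hr0)) ?_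
  have h3 : scaleT D.d D.α₀ * r ^ 2 ≤ (128 * D.ρ₀) ^ 2 :=
    (mul_le_of_le_one_left (sq_nonneg r) hT).trans (by gcongr)
  exact Ioo_subset_Ioo (by linarith) (by linarith)

theorem intrinsicCyl_mono {r r' : ℝ} (hr : 0 < r) (hrr : r ≤ r') (p : SpaceTime n → ℝ) (d : ℝ)
    {μ : ℝ} (hμ : 0 < μ) (z : SpaceTime n) :
    intrinsicCyl p d μ r z ⊆ intrinsicCyl p d μ r' z := fun _ hw =>
  (mem_intrinsicCyl_iff hμ (hr.trans_le hrr)).2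
    (((mem_intrinsicCyl_iff hμ hr).1 hw).trans_le hrr)

theorem abs_p_sub_le {z : SpaceTime n} {r : ℝ} (hr : 0 < r) (hrρ : r ≤ 16 * D.ρ)
    (hz : z ∈ intrinsicCyl D.p D.d D.α₀ r D.z₀) : |D.p z - D.p D.z₀| ≤ D.om (16 * D.ρ) := by
  have h1 := D.parDist_le_of_mem D.one_le_α₀ hr D.center_mem_largeCyl hz
  have h2 : 0 ≤ parDist z D.z₀ := le_max_of_le_left (norm_nonneg _)
  exact (D.logModulus.bound _ _).trans
    (D.logModulus.mono (mem_Ici.2 h2) (mem_Ici.2 (h2.trans (h1.trans hrρ))) (h1.trans hrρ))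

/-- `(|∇u| + 1)^{p(1-β)}` -/
def gradEnergy (z : SpaceTime n) : ℝ := (‖D.Du z‖ + 1) ^ (D.p z * (1 - D.β))

theorem energy_pos : 0 < energy D.Ω D.T D.β D.p D.u D.Du := by
  have h1 := D.radius.energy_bound.trans_lt' D.radius.pos
  have := one_div_pos.1 h1
  linarith

theorem energy_le : energy D.Ω D.T D.β D.p D.u D.Du ≤ 1 / D.ρ := by
  have h1 := D.radius.energy_bound
  have h2 := D.energy_pos
  have h3 := D.ρ_le
  have h4 := D.ρ_pos
  rw [le_div_iff₀ (by positivity)] at h1 ⊢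
  nlinarith

theorem s_le (z : SpaceTime n) : D.p z * (1 - D.β) ≤ pp := by
  have h1 := D.logHolder.upper z
  have h2 := D.p_pos z
  nlinarith [D.β_pos]

theorem integrableOn_energy :
    IntegrableOn (fun z => (|D.u z| + ‖D.Du z‖ + 1) ^ (D.p z * (1 - D.β)))
      (parDomain D.Ω D.T) := by
  have hvol : volume (parDomain D.Ω D.T) ≠ ⊤ := by
    rw [parDomain, Measure.volume_eq_prod, Measure.prod_prod]
    exact ENNReal.mul_ne_top D.domain.isBounded.measure_lt_top.ne measure_Ioo_lt_top.ne
  have hm : AEMeasurable (fun z => (|D.u z| + ‖D.Du z‖ + 1) ^ (D.p z * (1 - D.β))) :=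
    ((D.mem.aemeasurable.norm.add D.mem.aemeasurable_grad.norm).add_const 1).pow
      (D.logHolder.measurable.mul_const _).aemeasurable
  have hi : IntegrableOn (fun z => 2 ^ pp * (2 ^ pp * (|D.u z| ^ (D.p z * (1 - D.β)) +
      ‖D.Du z‖ ^ (D.p z * (1 - D.β))) + 1)) (parDomain D.Ω D.T) :=
    (((D.mem.integrable.add D.mem.integrable_grad).const_mul _).add
      (integrableOn_const hvol)).const_mul _
  refine hi.mono' hm.restrict.aestronglyMeasurable (ae_of_all _ fun z => ?_)
  rw [Real.norm_of_nonneg (by positivity)]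
  have hs : 0 ≤ D.p z * (1 - D.β) := by linarith [D.exponent z]
  refine (add_rpow_le_two_rpow_mul (by positivity) zero_le_one hs (D.s_le z)).trans ?_
  rw [Real.one_rpow]
  gcongr
  exact add_rpow_le_two_rpow_mul (by positivity) (by positivity) hs (D.s_le z)

theorem lintegral_energy :
    ∫⁻ z in parDomain D.Ω D.T,
      ENNReal.ofReal ((|D.u z| + ‖D.Du z‖ + 1) ^ (D.p z * (1 - D.β))) =
      ENNReal.ofReal (energy D.Ω D.T D.β D.p D.u D.Du) := by
  rw [energy, ofReal_integral_eq_lintegral_ofReal D.integrableOn_energy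
    (ae_of_all _ fun z => by positivity)]

/-- `|∇u| + 1 + |u| / k` -/
def hFun (k : ℝ) (z : SpaceTime n) : ℝ := ‖D.Du z‖ + 1 + |D.u z| / k

theorem one_le_hFun {k : ℝ} (hk : 0 < k) (z : SpaceTime n) : 1 ≤ D.hFun k z := by
  have : 0 ≤ |D.u z| / k := by positivity
  unfold hFun; linarith [norm_nonneg (D.Du z)]

theorem aemeasurable_hFun (k : ℝ) : AEMeasurable (D.hFun k) :=
  (D.mem.aemeasurable_grad.norm.add_const 1).add (D.mem.aemeasurable.norm.div_const k)

/-- Inside the domain `k ≤ 1` gives `h ≤ k⁻¹ (|u| + |∇u| + 1)`. Outside, `u` and `∇u` vanish and `h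
= 1`, which accounts for the volume term. -/
theorem lintegral_hFun_le {k : ℝ} (hk : 0 < k) (hk1 : k ≤ 1) (Q : Set (SpaceTime n)) :
    ∫⁻ z in Q, ENNReal.ofReal (D.hFun k z ^ (D.p z * (1 - D.β))) ≤
      ENNReal.ofReal ((k⁻¹) ^ pp) *
        (ENNReal.ofReal (energy D.Ω D.T D.β D.p D.u D.Du) + volume Q) := by
  have hPm : MeasurableSet (parDomain D.Ω D.T) :=
    D.domain.isOpen.measurableSet.prod measurableSet_Ioo
  have hki : 1 ≤ k⁻¹ := (one_le_inv₀ hk).2 hk1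
  have hpp : 0 ≤ pp := by linarith [D.const.one_lt_pm, D.const.pm_le_pp]
  calc ∫⁻ z in Q, ENNReal.ofReal (D.hFun k z ^ (D.p z * (1 - D.β)))
      ≤ ∫⁻ z in Q, ENNReal.ofReal ((k⁻¹) ^ pp) * ((parDomain D.Ω D.T).indicator (fun z =>
          ENNReal.ofReal ((|D.u z| + ‖D.Du z‖ + 1) ^ (D.p z * (1 - D.β)))) z + 1) := by
        refine lintegral_mono fun z => ?_
        have hs : 0 ≤ D.p z * (1 - D.β) := by linarith [D.exponent z]
        by_cases hz : z ∈ parDomain D.Ω D.T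
        · rw [indicator_of_mem hz]
          refine le_trans ?_ (mul_le_mul_right le_self_add _)
          rw [← ENNReal.ofReal_mul (by positivity)]
          refine ENNReal.ofReal_le_ofReal ?_
          have h1 : D.hFun k z ≤ k⁻¹ * (|D.u z| + ‖D.Du z‖ + 1) := by
            have : ‖D.Du z‖ + 1 ≤ k⁻¹ * (‖D.Du z‖ + 1) :=
              le_mul_of_one_le_left (by positivity) hki
            rw [hFun, div_eq_inv_mul]; linarith
          have h0 := D.one_le_hFun hk z
          calc D.hFun k z ^ (D.p z * (1 - D.β))
              ≤ (k⁻¹ * (|D.u z| + ‖D.Du z‖ + 1)) ^ (D.p z * (1 - D.β)) :=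
                Real.rpow_le_rpow (by linarith) h1 hs
            _ = (k⁻¹) ^ (D.p z * (1 - D.β)) *
                (|D.u z| + ‖D.Du z‖ + 1) ^ (D.p z * (1 - D.β)) :=
                Real.mul_rpow (by positivity) (by positivity)
            _ ≤ _ := by
                gcongr
                exact D.s_le z
        · rw [indicator_of_notMem hz, zero_add, mul_one]
          obtain ⟨h1, h2⟩ := D.mem.zero_outside z hz
          refine ENNReal.ofReal_le_ofReal ?_
          rw [hFun, h1, h2, norm_zero, abs_zero, zero_div, zero_add, add_zero, Real.one_rpow]
          exact Real.one_le_rpow hki hpp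
    _ = ENNReal.ofReal ((k⁻¹) ^ pp) * ((∫⁻ z in Q, (parDomain D.Ω D.T).indicator (fun z =>
          ENNReal.ofReal ((|D.u z| + ‖D.Du z‖ + 1) ^ (D.p z * (1 - D.β)))) z) + volume Q) := by
        rw [lintegral_const_mul' _ _ ENNReal.ofReal_ne_top,
          lintegral_add_right _ measurable_const, setLIntegral_one]
    _ ≤ _ := by
        gcongr
        refine (setLIntegral_le_lintegral _ _).trans ?_
        rw [lintegral_indicator hPm, D.lintegral_energy]

theorem lintegral_gradEnergy_le (Q : Set (SpaceTime n)) :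
    ∫⁻ z in Q, ENNReal.ofReal (D.gradEnergy z) ≤
      ENNReal.ofReal (energy D.Ω D.T D.β D.p D.u D.Du) + volume Q := by
  have h := D.lintegral_hFun_le one_pos le_rfl Q
  rw [inv_one, Real.one_rpow, ENNReal.ofReal_one, one_mul] at h
  refine le_trans (lintegral_mono fun z => ENNReal.ofReal_le_ofReal ?_) h
  have hs : 0 ≤ D.p z * (1 - D.β) := by linarith [D.exponent z]
  refine Real.rpow_le_rpow (by positivity) ?_ hs
  rw [hFun, div_one]; linarith [abs_nonneg (D.u z)]

theorem integrableOn_gradEnergy {Q : Set (SpaceTime n)}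
    (hQt : volume Q ≠ ⊤) : IntegrableOn D.gradEnergy Q := by
  have hm : AEMeasurable D.gradEnergy :=
    (D.mem.aemeasurable_grad.norm.add_const 1).pow
      (D.logHolder.measurable.mul_const _).aemeasurable
  refine ⟨hm.restrict.aestronglyMeasurable, ?_⟩
  rw [hasFiniteIntegral_iff_ofReal (ae_of_all _ fun z => by unfold gradEnergy; positivity)]
  exact (D.lintegral_gradEnergy_le Q).trans_lt
    (ENNReal.add_lt_top.2 ⟨ENNReal.ofReal_lt_top, hQt.lt_top⟩)

theorem ofReal_setAverage_mul {Q : Set (SpaceTime n)}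
    (hQ0 : volume Q ≠ 0) (hQt : volume Q ≠ ⊤) :
    ENNReal.ofReal (⨍ z in Q, D.gradEnergy z) * volume Q =
      ∫⁻ z in Q, ENNReal.ofReal (D.gradEnergy z) := by
  rw [setAverage_eq, smul_eq_mul, ENNReal.ofReal_mul (by positivity),
    ofReal_integral_eq_lintegral_ofReal (D.integrableOn_gradEnergy hQt)
      (ae_of_all _ fun z => by unfold gradEnergy; positivity), Measure.real,
    ENNReal.ofReal_inv_of_pos (ENNReal.toReal_pos hQ0 hQt), ENNReal.ofReal_toReal hQt,
    mul_comm, ← mul_assoc, ENNReal.mul_inv_cancel hQ0 hQt, one_mul]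

theorem volume_intrinsicCyl_ne_zero {μ r : ℝ} (hμ : 0 < μ) (hr : 0 < r) (z : SpaceTime n) :
    volume (intrinsicCyl D.p D.d μ r z) ≠ 0 := by
  rw [volume_intrinsicCyl _ _ hμ hr, Ne, ENNReal.ofReal_eq_zero, not_le]
  have := volConst_pos n
  positivity

theorem volume_intrinsicCyl_ne_top {μ r : ℝ} (hμ : 0 < μ) (hr : 0 < r) (z : SpaceTime n) :
    volume (intrinsicCyl D.p D.d μ r z) ≠ ⊤ := by
  rw [volume_intrinsicCyl _ _ hμ hr]; exact ENNReal.ofReal_ne_top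

theorem α₀_pos : 0 < D.α₀ := one_pos.trans_le D.one_le_α₀

theorem lam_pos : 0 < D.lam := one_pos.trans_le D.one_le_lam

theorem stopping_lower :
    ENNReal.ofReal (D.α₀ ^ (1 - D.β)) * volume (intrinsicCyl D.p D.d D.α₀ D.ρ D.z₀) ≤
      ∫⁻ z in intrinsicCyl D.p D.d D.α₀ D.ρ D.z₀, ENNReal.ofReal (D.gradEnergy z) := by
  rw [← D.ofReal_setAverage_mul
    (D.volume_intrinsicCyl_ne_zero D.α₀_pos D.ρ_pos _)
    (D.volume_intrinsicCyl_ne_top D.α₀_pos D.ρ_pos _)]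
  gcongr
  exact D.stopping.lower

theorem stopping_upper :
    ∫⁻ z in intrinsicCyl D.p D.d D.α₀ (16 * D.ρ) D.z₀, ENNReal.ofReal (D.gradEnergy z) ≤
      ENNReal.ofReal (D.α₀ ^ (1 - D.β)) *
        volume (intrinsicCyl D.p D.d D.α₀ (16 * D.ρ) D.z₀) := by
  have h16 : 0 < 16 * D.ρ := by linarith [D.ρ_pos]
  rw [← D.ofReal_setAverage_mul
    (D.volume_intrinsicCyl_ne_zero D.α₀_pos h16 _)
    (D.volume_intrinsicCyl_ne_top D.α₀_pos h16 _)]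
  gcongr
  exact D.stopping.upper

end CoverSetting

/-! ### Energy estimates -/

theorem IsLogModulus.le_half {n : ℕ} {L : ℝ} {p : SpaceTime n → ℝ} {om : ℝ → ℝ}
    (h : IsLogModulus L p om) {r : ℝ} (hr : 0 ≤ r) (hr2 : r ≤ 1 / 2) :
    om r ≤ L / Real.log 2 := by
  have h1 := h.logBound (1 / 2) (by norm_num) le_rfl
  rw [one_div_one_div] at h1
  have h2 : 0 < Real.log 2 := Real.log_pos one_lt_two
  have h3 : om r ≤ om (1 / 2) := h.mono (mem_Ici.2 hr) (mem_Ici.2 (by norm_num)) hr2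
  rw [le_div_iff₀ h2]
  nlinarith

/-- Powers `x ^ e` with `e` controlled by the modulus at scale `r` are bounded if `x` is at most
polynomially large in `1 / r`. -/
theorem IsLogModulus.rpow_le {n : ℕ} {L : ℝ} {p : SpaceTime n → ℝ} {om : ℝ → ℝ}
    (h : IsLogModulus L p om) {r x A K e N : ℝ} (hr : 0 < r) (hr2 : r ≤ 1 / 2) (hx : 1 ≤ x)
    (hA : 1 ≤ A) (hK : 0 ≤ K) (hxA : x ≤ A * r ^ (-K)) (hN : 0 ≤ N) (he : e ≤ N * om r) :
    x ^ e ≤ Real.exp (N * (L / Real.log 2 * Real.log A + K * L)) := by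
  have hx0 : 0 < x := by linarith
  have hlog : Real.log x ≤ Real.log A + K * Real.log (1 / r) := by
    have h1 := Real.log_le_log hx0 hxA
    rw [Real.log_mul (by positivity) (by positivity), Real.log_rpow hr] at h1
    rw [one_div, Real.log_inv]; linarith
  have h0 : 0 ≤ om r := h.nonneg r hr.le
  have hlx : 0 ≤ Real.log x := Real.log_nonneg hx
  have hlA : 0 ≤ Real.log A := Real.log_nonneg hA
  rw [Real.rpow_def_of_pos hx0]
  refine Real.exp_le_exp.2 ?_
  -- The two terms use different facts: `ω(r) log (1/r) ≤ L` for the power of `r`, and `ω(r) ≤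
  -- ω(1/2) ≤ L / log 2` for the constant `A`.
  calc Real.log x * e ≤ Real.log x * (N * om r) := by gcongr
    _ ≤ (Real.log A + K * Real.log (1 / r)) * (N * om r) := by gcongr
    _ = N * (om r * Real.log A + K * (om r * Real.log (1 / r))) := by ring
    _ ≤ _ := by
        have := h.le_half hr.le hr2
        have := h.logBound r hr hr2
        gcongr

theorem IsLogModulus.le_of_le_exp {n : ℕ} {L : ℝ} {p : SpaceTime n → ℝ} {om : ℝ → ℝ}
    (h : IsLogModulus L p om) (hL : 0 < L) {r ε : ℝ} (hr : 0 < r) (hr2 : r ≤ 1 / 2) (hε : 0 < ε)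
    (hre : r ≤ Real.exp (-(L / ε))) : om r ≤ ε := by
  have h1 : L / ε ≤ Real.log (1 / r) := by
    have := Real.log_le_log hr hre
    rw [Real.log_exp] at this
    rw [one_div, Real.log_inv]; linarith
  have h2 := h.logBound r hr hr2
  have h3 : om r * (L / ε) ≤ L :=
    (mul_le_mul_of_nonneg_left h1 (h.nonneg r hr.le)).trans h2
  rw [mul_div_assoc', div_le_iff₀ hε] at h3
  nlinarith

/-- The good set of a `CoverSetting`. -/
abbrev CoverSetting.good {n : ℕ} {pm pp L m q β₀ : ℝ} (D : CoverSetting n pm pp L m q β₀) :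
    Set (SpaceTime n) :=
  goodSet D.p D.d q D.β D.α₀ D.ρ D.ρb D.z₀ D.u D.Du D.lam

/-- The length by which `u` is divided. -/
abbrev CoverSetting.len {n : ℕ} {pm pp L m q β₀ : ℝ} (D : CoverSetting n pm pp L m q β₀) : ℝ :=
  scaleX D.p D.d D.α₀ D.z₀ * D.ρ

/-! ### Polynomial bounds in `1/ρ` and the weak type estimate on bad cylinders. -/

namespace FixedConstants

variable {n : ℕ} {pm pp L m q β₀ : ℝ} (hc : FixedConstants n pm pp L m q β₀)
include hc

/-- The lower stopping condition bounds `α₀^(1-β) |Q_ρ|` by the energy plus the volume. The volume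
term is absorbed unless `α₀` is bounded, and the energy is at most `1/ρ`. By `le_volExp` the left
side contains at least `α₀^β₀ ρ^(n+2)`, whence the exponent `(n+3)/β₀`. -/
theorem exists_α₀_le : ∃ C K : ℝ, 1 ≤ C ∧ 0 ≤ K ∧
    ∀ D : CoverSetting n pm pp L m q β₀, D.α₀ ≤ C * D.ρ ^ (-K) := by
  have hv := volConst_pos n
  have hβ₀ := hc.β₀_pos
  refine ⟨max 4 ((2 / volConst n) ^ (1 / β₀)), (n + 3) / β₀,
    le_max_of_le_left (by norm_num), by positivity, fun D => ?_⟩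
  have hρ := D.ρ_pos
  have hα := D.α₀_pos
  have hα1 := D.one_le_α₀
  have hρ1 : D.ρ ≤ 1 := by linarith [D.ρ_lt]
  have hρK : 1 ≤ D.ρ ^ (-((n + 3) / β₀)) :=
    Real.one_le_rpow_of_pos_of_le_one_of_nonpos hρ hρ1 (neg_nonpos.2 (by positivity))
  -- In this case `1 - β ≥ 1/2` gives `α₀ ≤ 4`. Otherwise the volume is at most half of the left
  -- side and can be absorbed.
  by_cases h2 : D.α₀ ^ (1 - D.β) ≤ 2
  · have h3 : D.α₀ ^ (1 / 2 : ℝ) ≤ 2 := by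
      refine le_trans (Real.rpow_le_rpow_of_exponent_le hα1 ?_) h2
      linarith [D.β_lt, hc.β₀_le]
    have h4 : D.α₀ ≤ 4 := by
      rw [← Real.sqrt_eq_rpow, Real.sqrt_le_left (by norm_num)] at h3
      linarith
    calc D.α₀ ≤ max 4 ((2 / volConst n) ^ (1 / β₀)) * 1 := by
          rw [mul_one]; exact h4.trans (le_max_left _ _)
      _ ≤ _ := by gcongr
  · push Not at h2
    set V : ℝ := volConst n * D.α₀ ^ volExp D.p D.d D.z₀ * D.ρ ^ (n + 2) with hV
    have hV0 : 0 < V := by positivity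
    have hE := D.energy_pos
    have h3 : D.α₀ ^ (1 - D.β) * V ≤ energy D.Ω D.T D.β D.p D.u D.Du + V := by
      have h4 := D.stopping_lower.trans
        (D.lintegral_gradEnergy_le _)
      rw [volume_intrinsicCyl _ _ hα hρ, ← ENNReal.ofReal_mul (by positivity),
        ← ENNReal.ofReal_add hE.le hV0.le,
        ENNReal.ofReal_le_ofReal_iff (by positivity)] at h4
      exact h4
    have h5 : D.α₀ ^ (1 - D.β) * V ≤ 2 / D.ρ := by
      have h6 : 2 * V ≤ D.α₀ ^ (1 - D.β) * V := by gcongr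
      have h7 := D.energy_le
      have h8 : 2 / D.ρ = 2 * (1 / D.ρ) := by ring
      rw [h8]; linarith
    have h6 : D.α₀ ^ β₀ ≤ D.α₀ ^ (1 - D.β) * D.α₀ ^ volExp D.p D.d D.z₀ := by
      rw [← Real.rpow_add hα]
      refine Real.rpow_le_rpow_of_exponent_le hα1 ?_
      linarith [D.le_volExp D.center_mem_largeCyl, D.β_lt]
    have h7 : D.α₀ ^ β₀ ≤ 2 / volConst n * D.ρ ^ (-((n : ℝ) + 3)) := by
      have h8 : D.α₀ ^ β₀ * (volConst n * D.ρ ^ (n + 3)) ≤ 2 := by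
        calc D.α₀ ^ β₀ * (volConst n * D.ρ ^ (n + 3))
            ≤ (D.α₀ ^ (1 - D.β) * D.α₀ ^ volExp D.p D.d D.z₀) *
                (volConst n * D.ρ ^ (n + 3)) := by gcongr
          _ = (D.α₀ ^ (1 - D.β) * V) * D.ρ := by rw [hV]; ring
          _ ≤ 2 / D.ρ * D.ρ := by gcongr
          _ = 2 := by field_simp
      rw [Real.rpow_neg hρ.le, show (n : ℝ) + 3 = ((n + 3 : ℕ) : ℝ) by push_cast; ring,
        Real.rpow_natCast]
      rw [← le_div_iff₀ (by positivity)] at h8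
      refine h8.trans_eq ?_
      field_simp
    calc D.α₀ = (D.α₀ ^ β₀) ^ (1 / β₀) := by
          rw [← Real.rpow_mul hα.le, mul_one_div_cancel hβ₀.ne', Real.rpow_one]
      _ ≤ (2 / volConst n * D.ρ ^ (-((n : ℝ) + 3))) ^ (1 / β₀) := by gcongr
      _ = (2 / volConst n) ^ (1 / β₀) * D.ρ ^ (-(((n : ℝ) + 3) / β₀)) := by
          rw [Real.mul_rpow (by positivity) (by positivity), ← Real.rpow_mul hρ.le]
          congr 2; ring
      _ ≤ _ := by gcongr; exact le_max_right _ _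

/-- The crude bound: `1/len ≤ α₀/ρ` is polynomial in `1/ρ`, and so is the energy. No oscillation
control of `p` is needed. -/
theorem exists_lintegral_hFun_le : ∃ C K : ℝ, 1 ≤ C ∧ 0 ≤ K ∧
    ∀ D : CoverSetting n pm pp L m q β₀, ∀ η ≤ 1 - β₀,
      ∫⁻ z in intrinsicCyl D.p D.d D.α₀ D.ρb D.z₀,
        ENNReal.ofReal (D.hFun D.len z ^ (D.p z * η)) ≤ ENNReal.ofReal (C * D.ρ ^ (-K)) := by
  obtain ⟨C₁, K₁, hC₁, hK₁, hα⟩ := hc.exists_α₀_le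
  have hv := volConst_pos n
  have hpp : 1 ≤ pp := by linarith [hc.one_lt_pm, hc.pm_le_pp]
  have hC₁pp : 1 ≤ C₁ ^ pp := Real.one_le_rpow hC₁ (by linarith)
  refine ⟨C₁ ^ pp * (1 + volConst n), (K₁ + 1) * pp + 1, by nlinarith, by positivity,
    fun D η hη => ?_⟩
  have hρ := D.ρ_pos
  have hα0 := D.α₀_pos
  have hα1 := D.one_le_α₀
  have hρ1 : D.ρ ≤ 1 := by linarith [D.ρ_lt]
  have hσ0 : 0 < scaleX D.p D.d D.α₀ D.z₀ := Real.rpow_pos_of_pos hα0 _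
  have hσ1 := D.scaleX_le_one D.center_mem_largeCyl hα1
  have hk0 : 0 < D.len := mul_pos hσ0 hρ
  have hk1 : D.len ≤ 1 := mul_le_one₀ hσ1 hρ.le hρ1
  have hinv : (D.len)⁻¹ ≤ C₁ * D.ρ ^ (-(K₁ + 1)) := by
    have h1 : (scaleX D.p D.d D.α₀ D.z₀)⁻¹ ≤ D.α₀ := by
      rw [scaleX, ← Real.rpow_neg hα0.le]
      conv_rhs => rw [← Real.rpow_one D.α₀]
      refine Real.rpow_le_rpow_of_exponent_le hα1 ?_
      have h2 : 1 / D.p D.z₀ ≤ 1 := by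
        rw [div_le_one (D.p_pos _)]; exact (D.one_lt_p _).le
      linarith [D.d_pos]
    calc (D.len)⁻¹ = (scaleX D.p D.d D.α₀ D.z₀)⁻¹ * D.ρ⁻¹ := mul_inv _ _
      _ ≤ (C₁ * D.ρ ^ (-K₁)) * D.ρ⁻¹ := by gcongr; exact h1.trans (hα D)
      _ = _ := by
          rw [neg_add, Real.rpow_add hρ, Real.rpow_neg_one]; ring
  have hVol : volume (intrinsicCyl D.p D.d D.α₀ D.ρb D.z₀) ≤ ENNReal.ofReal (volConst n) := by
    rw [volume_intrinsicCyl _ _ hα0 D.ρb_pos]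
    refine ENNReal.ofReal_le_ofReal ?_
    have h1 : D.α₀ ^ volExp D.p D.d D.z₀ ≤ 1 :=
      Real.rpow_le_one_of_one_le_of_nonpos hα1 (D.volExp_nonpos D.center_mem_largeCyl)
    have h2 : D.ρb ^ (n + 2) ≤ 1 :=
      pow_le_one₀ D.ρb_pos.le (by linarith [D.ρb_le, D.ρ_lt])
    have h3 := D.ρb_pos
    calc volConst n * D.α₀ ^ volExp D.p D.d D.z₀ * D.ρb ^ (n + 2)
        ≤ volConst n * 1 * 1 := by gcongr
      _ = _ := by ring
  calc ∫⁻ z in intrinsicCyl D.p D.d D.α₀ D.ρb D.z₀,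
        ENNReal.ofReal (D.hFun D.len z ^ (D.p z * η))
      ≤ ∫⁻ z in intrinsicCyl D.p D.d D.α₀ D.ρb D.z₀,
        ENNReal.ofReal (D.hFun D.len z ^ (D.p z * (1 - D.β))) := by
        refine lintegral_mono fun z => ENNReal.ofReal_le_ofReal ?_
        refine Real.rpow_le_rpow_of_exponent_le (D.one_le_hFun hk0 z) ?_
        have := D.p_pos z
        gcongr
        linarith [D.β_lt]
    _ ≤ _ := D.lintegral_hFun_le hk0 hk1 _
    _ ≤ ENNReal.ofReal ((C₁ * D.ρ ^ (-(K₁ + 1))) ^ pp) *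
          (ENNReal.ofReal (1 / D.ρ) + ENNReal.ofReal (volConst n / D.ρ)) := by
        gcongr
        · exact D.energy_le
        · refine hVol.trans (ENNReal.ofReal_le_ofReal ?_)
          rw [le_div_iff₀ hρ]; nlinarith
    _ = _ := by
        rw [← ENNReal.ofReal_add (by positivity) (by positivity),
          ← ENNReal.ofReal_mul (by positivity), Real.mul_rpow (by positivity) (by positivity),
          ← Real.rpow_mul hρ.le, neg_add ((K₁ + 1) * pp), Real.rpow_add hρ, Real.rpow_neg_one,
          neg_mul]
        congr 1
        field_simp

/-- Off the good set the strong maximal function exceeds `λ^(1/q)`, so the cylinder lies in a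
superlevel set. Weak type `k = ηq` turns `h^(p/q)` into `h^(pη)`; the freedom to take η below `1 -
β` later absorbs the oscillation of `p`. -/
theorem exists_measure_intrinsicCyl_le {η : ℝ} (hη : 1 < η * q) :
    ∃ C : ℝ, 0 < C ∧ ∀ D : CoverSetting n pm pp L m q β₀, ∀ z : SpaceTime n, ∀ r : ℝ,
      Disjoint (intrinsicCyl D.p D.d D.lam r z) D.good →
      ENNReal.ofReal (D.lam ^ η) * volume (intrinsicCyl D.p D.d D.lam r z) ≤
        ENNReal.ofReal C * ∫⁻ z in intrinsicCyl D.p D.d D.α₀ D.ρb D.z₀,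
          ENNReal.ofReal (D.hFun D.len z ^ (D.p z * η)) := by
  have : NeZero n := ⟨by have := hc.one_le_n; omega⟩
  have hq : 0 < q := by linarith [hc.one_lt_q]
  obtain ⟨C, hC, hw⟩ := exists_rpow_mul_measure_strongMaximal_le n hη
  refine ⟨C, hC, fun D z r hdisj => ?_⟩
  have hk0 : 0 < D.len := mul_pos (Real.rpow_pos_of_pos D.α₀_pos _) D.ρ_pos
  have hlam := D.lam_pos
  set Q := intrinsicCyl D.p D.d D.α₀ D.ρb D.z₀ with hQ
  have hQm : MeasurableSet Q := measurableSet_intrinsicCyl _ _ _ _ _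
  set f : SpaceTime n → ℝ≥0∞ := Q.indicator fun w =>
    ENNReal.ofReal (D.hFun D.len w ^ (D.p w / q)) with hf
  have hfm : AEMeasurable f :=
    (((D.aemeasurable_hFun _).pow
      (D.logHolder.measurable.div_const q).aemeasurable).ennreal_ofReal).indicator hQm
  have h1 := hw f hfm (ENNReal.ofReal (D.lam ^ (1 / q)))
    (by rw [Ne, ENNReal.ofReal_eq_zero, not_le]; positivity) ENNReal.ofReal_ne_top
  have hpow : (ENNReal.ofReal (D.lam ^ (1 / q))) ^ (η * q) = ENNReal.ofReal (D.lam ^ η) := by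
    rw [ENNReal.ofReal_rpow_of_nonneg (by positivity) (by linarith), ← Real.rpow_mul hlam.le]
    congr 2; field_simp
  have hfpow : ∫⁻ w, f w ^ (η * q) = ∫⁻ z in Q,
      ENNReal.ofReal (D.hFun D.len z ^ (D.p z * η)) := by
    rw [← lintegral_indicator hQm]
    refine lintegral_congr fun w => ?_
    by_cases hwQ : w ∈ Q
    · have h0 : 0 ≤ D.hFun D.len w := zero_le_one.trans (D.one_le_hFun hk0 w)
      rw [hf, indicator_of_mem hwQ, indicator_of_mem hwQ,
        ENNReal.ofReal_rpow_of_nonneg (by positivity) (by linarith), ← Real.rpow_mul h0]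
      congr 2; field_simp
    · rw [hf, indicator_of_notMem hwQ, indicator_of_notMem hwQ,
        ENNReal.zero_rpow_of_pos (by linarith)]
  rw [hpow, hfpow] at h1
  refine le_trans (mul_le_mul_right (measure_mono fun w hw => ?_) _) h1
  have h2 : w ∉ D.good := disjoint_left.1 hdisj hw
  have h3 : ENNReal.ofReal (D.lam ^ (1 - D.β)) < strongMaximal f w ^ (q * (1 - D.β)) :=
    not_le.1 h2
  have hqβ : 0 < q * (1 - D.β) := mul_pos hq D.one_sub_β_pos
  have h4 : ENNReal.ofReal (D.lam ^ (1 - D.β)) =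
      (ENNReal.ofReal (D.lam ^ (1 / q))) ^ (q * (1 - D.β)) := by
    rw [ENNReal.ofReal_rpow_of_nonneg (by positivity) hqβ.le, ← Real.rpow_mul hlam.le]
    congr 2; field_simp
  rw [h4] at h3
  exact (ENNReal.rpow_lt_rpow_iff hqβ).1 h3

end FixedConstants
-- The fine energy bound from Poincaré and the upper stopping condition.
namespace FixedConstants

variable {n : ℕ} {pm pp L m q β₀ : ℝ} (hc : FixedConstants n pm pp L m q β₀)
include hc

/-- The term with `u` is estimated by the boundary Poincaré inequality on the cylinder of radius
`ρb`, whose spatial radius is at most `16 * len`. What remains is the gradient energy on the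
cylinder of radius `16ρ`, where the upper stopping condition holds. -/
theorem exists_lintegral_hFun_rpow_le : ∃ C : ℝ, 1 ≤ C ∧
    ∀ D : CoverSetting n pm pp L m q β₀, ∀ s₀ : ℝ, 1 ≤ s₀ →
      (∀ z ∈ intrinsicCyl D.p D.d D.α₀ (16 * D.ρ) D.z₀, s₀ ≤ D.p z * (1 - D.β)) →
      ∫⁻ z in intrinsicCyl D.p D.d D.α₀ D.ρb D.z₀, ENNReal.ofReal (D.hFun D.len z ^ s₀) ≤
        ENNReal.ofReal (C * D.α₀ ^ (1 - D.β)) *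
          volume (intrinsicCyl D.p D.d D.α₀ (16 * D.ρ) D.z₀) := by
  have hP := poincareConst_pos n hc.m_pos pp
  have hpp : 1 ≤ pp := by linarith [hc.one_lt_pm, hc.pm_le_pp]
  have h2 : (1 : ℝ) ≤ 2 ^ pp := Real.one_le_rpow one_le_two (by linarith)
  have h16 : (0 : ℝ) < 16 ^ pp := by positivity
  refine ⟨2 ^ pp * (1 + 16 ^ pp * poincareConst n m pp),
    one_le_mul_of_one_le_of_one_le h2 (by nlinarith), fun D s₀ hs₀ hs₀s => ?_⟩
  have hα0 := D.α₀_pos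
  have hρ := D.ρ_pos
  have hρb := D.ρb_pos
  have hσ0 : 0 < scaleX D.p D.d D.α₀ D.z₀ := Real.rpow_pos_of_pos hα0 _
  have hσ1 := D.scaleX_le_one D.center_mem_largeCyl D.one_le_α₀
  have hk0 : 0 < D.len := mul_pos hσ0 hρ
  set R := scaleX D.p D.d D.α₀ D.z₀ * D.ρb with hR
  have hR0 : 0 < R := mul_pos hσ0 hρb
  have hR1 : R ≤ 1 := mul_le_one₀ hσ1 hρb.le (by linarith [D.ρb_le, D.ρ_lt])
  have hRlen : R ≤ 16 * D.len := by
    have := mul_le_mul_of_nonneg_left D.ρb_le hσ0.le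
    rw [CoverSetting.len, hR]; linarith
  set Q := intrinsicCyl D.p D.d D.α₀ D.ρb D.z₀ with hQ
  set Q' := intrinsicCyl D.p D.d D.α₀ (16 * D.ρ) D.z₀ with hQ'
  have hQQ' : Q ⊆ Q' := CoverSetting.intrinsicCyl_mono hρb D.ρb_le _ _ hα0 _
  have hQm : MeasurableSet Q := measurableSet_intrinsicCyl _ _ _ _ _
  have hs₀pp : s₀ ≤ pp := by
    refine (hs₀s D.z₀ ((mem_intrinsicCyl_iff hα0 (by positivity)).2 ?_)).trans (D.s_le _)
    simp [locDist, hρ]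
  have hpoin := D.domain.poincare_cylinder hc.m_pos D.boundary hR0 hR1 hs₀
    (b := scaleT D.d D.α₀ * D.ρb ^ 2) (S := pp)
    (D.logHolder.measurable.mul_const _) (fun z hz => hs₀s z (hQQ' hz)) (fun z _ => D.s_le z)
    D.mem
  have hGm : AEMeasurable (fun z => ENNReal.ofReal (D.gradEnergy z)) (volume.restrict Q) :=
    ((D.mem.aemeasurable_grad.norm.add_const 1).pow
      (D.logHolder.measurable.mul_const _).aemeasurable).ennreal_ofReal.restrict
  calc ∫⁻ z in Q, ENNReal.ofReal (D.hFun D.len z ^ s₀)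
      ≤ ∫⁻ z in Q, ENNReal.ofReal (2 ^ pp) * (ENNReal.ofReal (D.gradEnergy z) +
          ENNReal.ofReal (16 ^ pp) * ENNReal.ofReal ((|D.u z| / R) ^ s₀)) := by
        refine setLIntegral_mono' hQm fun z hz => ?_
        have hg0 : 0 ≤ D.gradEnergy z := by unfold CoverSetting.gradEnergy; positivity
        rw [← ENNReal.ofReal_mul (by positivity), ← ENNReal.ofReal_add hg0 (by positivity),
          ← ENNReal.ofReal_mul (by positivity)]
        refine ENNReal.ofReal_le_ofReal ?_
        refine (add_rpow_le_two_rpow_mul (by positivity) (by positivity) (by linarith)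
          hs₀pp).trans ?_
        gcongr
        · exact Real.rpow_le_rpow_of_exponent_le (by linarith [norm_nonneg (D.Du z)])
            (hs₀s z (hQQ' hz))
        · calc (|D.u z| / D.len) ^ s₀ ≤ (16 * (|D.u z| / R)) ^ s₀ := by
                refine Real.rpow_le_rpow (by positivity) ?_ (by linarith)
                rw [mul_div_assoc', div_le_div_iff₀ hk0 hR0]
                nlinarith [abs_nonneg (D.u z)]
            _ = 16 ^ s₀ * (|D.u z| / R) ^ s₀ := Real.mul_rpow (by norm_num) (by positivity)
            _ ≤ _ := by
                gcongr
                norm_num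
    _ = ENNReal.ofReal (2 ^ pp) * ((∫⁻ z in Q, ENNReal.ofReal (D.gradEnergy z)) +
          ENNReal.ofReal (16 ^ pp) * ∫⁻ z in Q, ENNReal.ofReal ((|D.u z| / R) ^ s₀)) := by
        rw [lintegral_const_mul' _ _ ENNReal.ofReal_ne_top, lintegral_add_left' hGm,
          lintegral_const_mul' _ _ ENNReal.ofReal_ne_top]
    _ ≤ ENNReal.ofReal (2 ^ pp) * ((∫⁻ z in Q, ENNReal.ofReal (D.gradEnergy z)) +
          ENNReal.ofReal (16 ^ pp) * (ENNReal.ofReal (poincareConst n m pp) *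
            ∫⁻ z in Q, ENNReal.ofReal (D.gradEnergy z))) := by
        gcongr
        exact hpoin
    _ = ENNReal.ofReal (2 ^ pp * (1 + 16 ^ pp * poincareConst n m pp)) *
          ∫⁻ z in Q, ENNReal.ofReal (D.gradEnergy z) := by
        rw [ENNReal.ofReal_mul (by positivity), ENNReal.ofReal_add zero_le_one (by positivity),
          ENNReal.ofReal_mul (by positivity), ENNReal.ofReal_one]
        ring
    _ ≤ ENNReal.ofReal (2 ^ pp * (1 + 16 ^ pp * poincareConst n m pp)) *
          (ENNReal.ofReal (D.α₀ ^ (1 - D.β)) * volume Q') := by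
        gcongr
        exact (lintegral_mono_set hQQ').trans D.stopping_upper
    _ = _ := by rw [← mul_assoc, ← ENNReal.ofReal_mul (by positivity)]

/-- The variable exponent `pη` is frozen: it is at most `(p(z₀) + o)η`, which by the smallness
hypothesis lies below the admissible constant exponent `s₀`. Jensen's inequality then interpolates,
at the price of an extra `4o` in the exponent of `α₀`. -/
theorem exists_lintegral_hFun_le_of_small {η : ℝ} (hη : 0 < η) (hη1 : η ≤ 1) : ∃ C : ℝ, 1 ≤ C ∧
    ∀ D : CoverSetting n pm pp L m q β₀, D.om (16 * D.ρ) ≤ 1 / 2 →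
      (D.p D.z₀ + D.om (16 * D.ρ)) * η ≤ (D.p D.z₀ - D.om (16 * D.ρ)) * (1 - D.β) →
      ∫⁻ z in intrinsicCyl D.p D.d D.α₀ D.ρb D.z₀,
        ENNReal.ofReal (D.hFun D.len z ^ (D.p z * η)) ≤
      ENNReal.ofReal (C * D.α₀ ^ (η + 4 * D.om (16 * D.ρ))) *
        volume (intrinsicCyl D.p D.d D.α₀ (16 * D.ρ) D.z₀) := by
  obtain ⟨C, hC, h⟩ := hc.exists_lintegral_hFun_rpow_le
  refine ⟨C, hC, fun D ho hsmall => ?_⟩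
  have hα0 := D.α₀_pos
  have hα1 := D.one_le_α₀
  have hρ := D.ρ_pos
  have hβ := D.one_sub_β_pos
  set o := D.om (16 * D.ρ) with hodef
  have ho0 : 0 ≤ o := D.logModulus.nonneg _ (by positivity)
  have hp0 := D.one_lt_p D.z₀
  -- The maximum with 1 keeps `s₀` admissible in the Poincaré inequality; it stays below `p(z)(1-β)`
  -- because that exponent exceeds 1 everywhere.
  set s₀ := max 1 ((D.p D.z₀ - o) * (1 - D.β)) with hs₀
  have hs₀1 : 1 ≤ s₀ := le_max_left _ _
  have hs₀0 : 0 < s₀ := by linarith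
  set γ := (D.p D.z₀ + o) * η / s₀ with hγ
  have hγ0 : 0 < γ := by positivity
  have hγ1 : γ ≤ 1 := (div_le_one hs₀0).2 (hsmall.trans (le_max_right _ _))
  have hk0 : 0 < D.len := mul_pos (Real.rpow_pos_of_pos hα0 _) hρ
  set Q := intrinsicCyl D.p D.d D.α₀ D.ρb D.z₀ with hQ
  set Q' := intrinsicCyl D.p D.d D.α₀ (16 * D.ρ) D.z₀ with hQ'
  have hQQ' : Q ⊆ Q' := CoverSetting.intrinsicCyl_mono D.ρb_pos D.ρb_le _ _ hα0 _
  have hQm : MeasurableSet Q := measurableSet_intrinsicCyl _ _ _ _ _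
  have hV0 : volume Q' ≠ 0 := D.volume_intrinsicCyl_ne_zero hα0 (by positivity) _
  have hVt : volume Q' ≠ ⊤ := D.volume_intrinsicCyl_ne_top hα0 (by positivity) _
  have hosc : ∀ z ∈ Q', |D.p z - D.p D.z₀| ≤ o := fun z hz =>
    D.abs_p_sub_le (by positivity) le_rfl hz
  have hmain := h D s₀ hs₀1 (fun z hz => max_le (D.exponent z).le (by
    have := (abs_le.1 (hosc z hz)).1
    gcongr; linarith))
  have hFm : AEMeasurable (fun z => ENNReal.ofReal (D.hFun D.len z ^ s₀) ^ γ)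
      (volume.restrict Q) :=
    ((((D.aemeasurable_hFun D.len).pow_const s₀).ennreal_ofReal).pow_const γ).restrict
  have hJ := lintegral_rpow_le_measure_rpow_mul (volume.restrict Q) hFm
    ((one_le_div hγ0).2 hγ1)
  simp_rw [← ENNReal.rpow_mul, mul_one_div_cancel hγ0.ne', ENNReal.rpow_one] at hJ
  rw [Measure.restrict_apply_univ] at hJ
  have hexp : (1 - D.β) * γ ≤ η + 4 * o := by
    have h1 : (1 - D.β) * γ * s₀ = (1 - D.β) * ((D.p D.z₀ + o) * η) := by
      rw [hγ]; field_simp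
    have h2 : (D.p D.z₀ - o) * (1 - D.β) ≤ s₀ := le_max_right _ _
    have h3 : (D.p D.z₀ + o) * η ≤ (η + 4 * o) * (D.p D.z₀ - o) := by nlinarith
    have h4 : (1 - D.β) * γ * s₀ ≤ (η + 4 * o) * s₀ := by
      rw [h1]
      calc (1 - D.β) * ((D.p D.z₀ + o) * η)
          ≤ (1 - D.β) * ((η + 4 * o) * (D.p D.z₀ - o)) := by gcongr
        _ = (η + 4 * o) * ((D.p D.z₀ - o) * (1 - D.β)) := by ring
        _ ≤ _ := by gcongr
    exact le_of_mul_le_mul_right h4 hs₀0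
  calc ∫⁻ z in Q, ENNReal.ofReal (D.hFun D.len z ^ (D.p z * η))
      ≤ ∫⁻ z in Q, ENNReal.ofReal (D.hFun D.len z ^ s₀) ^ γ := by
        refine setLIntegral_mono' hQm fun z hz => ?_
        have h0 := D.one_le_hFun hk0 z
        rw [ENNReal.ofReal_rpow_of_nonneg (by positivity) hγ0.le, ← Real.rpow_mul (by linarith)]
        refine ENNReal.ofReal_le_ofReal (Real.rpow_le_rpow_of_exponent_le h0 ?_)
        rw [hγ, mul_div_cancel₀ _ hs₀0.ne']
        have := (abs_le.1 (hosc z (hQQ' hz))).2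
        gcongr; linarith
    _ = ((∫⁻ z in Q, ENNReal.ofReal (D.hFun D.len z ^ s₀) ^ γ) ^ (1 / γ)) ^ γ := by
        rw [← ENNReal.rpow_mul, one_div_mul_cancel hγ0.ne', ENNReal.rpow_one]
    _ ≤ (volume Q' ^ (1 / γ - 1) * (ENNReal.ofReal (C * D.α₀ ^ (1 - D.β)) * volume Q')) ^ γ := by
        have h5 : 0 ≤ 1 / γ - 1 := sub_nonneg.2 ((one_le_div hγ0).2 hγ1)
        refine ENNReal.rpow_le_rpow (hJ.trans ?_) hγ0.le
        exact mul_le_mul' (ENNReal.rpow_le_rpow (measure_mono hQQ') h5) hmain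
    _ = ENNReal.ofReal ((C * D.α₀ ^ (1 - D.β)) ^ γ) * volume Q' := by
        have h6 : volume Q' ^ (1 / γ - 1) * (ENNReal.ofReal (C * D.α₀ ^ (1 - D.β)) * volume Q') =
            ENNReal.ofReal (C * D.α₀ ^ (1 - D.β)) * volume Q' ^ (1 / γ) := by
          rw [show 1 / γ = (1 / γ - 1) + 1 by ring, ENNReal.rpow_add _ _ hV0 hVt,
            ENNReal.rpow_one, add_sub_cancel_right]
          ring
        rw [h6, ENNReal.mul_rpow_of_nonneg _ _ hγ0.le, ← ENNReal.rpow_mul,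
          one_div_mul_cancel hγ0.ne', ENNReal.rpow_one,
          ENNReal.ofReal_rpow_of_nonneg (by positivity) hγ0.le]
    _ ≤ _ := by
        gcongr
        rw [Real.mul_rpow (by positivity) (by positivity), ← Real.rpow_mul hα0.le]
        gcongr
        · conv_rhs => rw [← Real.rpow_one C]
          exact Real.rpow_le_rpow_of_exponent_le hC hγ1

end FixedConstants

theorem le_max_one_of_pow_le {x c : ℝ} {k : ℕ} (hk : k ≠ 0) (h : x ^ k ≤ c) : x ≤ max 1 c := by
  by_cases hx : x ≤ 1
  · exact hx.trans (le_max_left _ _)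
  · push Not at hx
    exact le_max_of_le_right ((le_self_pow₀ hx.le hk).trans h)

/-! ### Polynomial control of λ by the radius of a bad cylinder. -/

namespace FixedConstants

variable {n : ℕ} {pm pp L m q β₀ : ℝ} (hc : FixedConstants n pm pp L m q β₀)
include hc

/-- If a cylinder `Q_r^λ(z)` centred in `Q_{ρ_b}^{α₀}(z₀)` misses the good set, then `λ` is at most
polynomially large in `1 / r`. -/
theorem exists_lam_rpow_mul_le : ∃ C N : ℝ, 1 ≤ C ∧ 0 < N ∧
    ∀ D : CoverSetting n pm pp L m q β₀, ∀ z ∈ intrinsicCyl D.p D.d D.α₀ D.ρb D.z₀,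
      ∀ r : ℝ, 0 < r → Disjoint (intrinsicCyl D.p D.d D.lam r z) D.good →
      D.lam ^ (β₀ / 2) * r ^ N ≤ C := by
  have hβ₀ := hc.β₀_pos
  have hq : 0 < q := by linarith [hc.one_lt_q]
  have hL := hc.L_pos
  have hv := volConst_pos n
  -- The first entry keeps `η + 2β₀ - 1 = β₀ - ε ≥ β₀/2`, the power of λ that survives; the second
  -- keeps `ηq > 1`, as required by the weak type bound.
  set ε := min (β₀ / 2) ((1 - β₀ - 1 / q) / 2) with hε
  have hε0 : 0 < ε := lt_min (by linarith) (by linarith [hc.β₀_lt])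
  have hε1 : ε ≤ β₀ / 2 := min_le_left _ _
  have hε2 : ε ≤ (1 - β₀ - 1 / q) / 2 := min_le_right _ _
  set η := 1 - β₀ - ε with hη
  have hηq : 1 < η * q := by
    have : 1 / q < η := by linarith [hc.β₀_lt]
    rwa [div_lt_iff₀ hq] at this
  have hη0 : 0 < η := by linarith [hc.β₀_le]
  have hη1 : η ≤ 1 := by linarith
  obtain ⟨C₁, K₁, hC₁, hK₁, h₁⟩ := hc.exists_α₀_le
  obtain ⟨C₂, K₂, hC₂, hK₂, h₂⟩ := hc.exists_lintegral_hFun_le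
  obtain ⟨C₃, hC₃, h₃⟩ := hc.exists_lintegral_hFun_le_of_small hη0 hη1
  obtain ⟨C₄, hC₄, h₄⟩ := hc.exists_measure_intrinsicCyl_le hηq
  have hlarge : ∀ D : CoverSetting n pm pp L m q β₀,
      ∀ z ∈ intrinsicCyl D.p D.d D.α₀ D.ρb D.z₀, z ∈ largeCyl D.ρ₀ D.z₀ := fun D z hz =>
    D.intrinsicCyl_subset_largeCyl D.ρb_pos D.ρb_le hz
  set C₅ := C₄ * C₂ / volConst n with hC₅
  have hC₅0 : 0 < C₅ := by positivity
  have crude : ∀ D : CoverSetting n pm pp L m q β₀,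
      ∀ z ∈ intrinsicCyl D.p D.d D.α₀ D.ρb D.z₀, ∀ r : ℝ, 0 < r →
      Disjoint (intrinsicCyl D.p D.d D.lam r z) D.good →
      D.lam ^ (β₀ / 2) * r ^ (n + 2) ≤ C₅ * D.ρ ^ (-K₂) := by
    intro D z hz r hr hd
    have hρ := D.ρ_pos
    have hlam := D.lam_pos
    have h5 := (h₄ D z r hd).trans (mul_le_mul_right (h₂ D η (by linarith)) _)
    rw [volume_intrinsicCyl _ _ hlam hr, ← ENNReal.ofReal_mul (by positivity),
      ← ENNReal.ofReal_mul (by positivity), ENNReal.ofReal_le_ofReal_iff (by positivity)] at h5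
    have h6 : D.lam ^ (β₀ / 2) ≤ D.lam ^ η * D.lam ^ volExp D.p D.d z := by
      rw [← Real.rpow_add hlam]
      refine Real.rpow_le_rpow_of_exponent_le D.one_le_lam ?_
      linarith [D.le_volExp (hlarge D z hz)]
    rw [hC₅, div_mul_eq_mul_div, le_div_iff₀ hv]
    calc D.lam ^ (β₀ / 2) * r ^ (n + 2) * volConst n
        ≤ (D.lam ^ η * D.lam ^ volExp D.p D.d z) * r ^ (n + 2) * volConst n := by gcongr
      _ = D.lam ^ η * (volConst n * D.lam ^ volExp D.p D.d z * r ^ (n + 2)) := by ring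
      _ ≤ _ := h5
      _ = _ := by ring
  set A := Real.exp (((n : ℝ) + 4) * (L / Real.log 2 * Real.log (C₁ * 16 ^ K₁) + K₁ * L)) with hA
  set C₈ := max 1 (C₄ * C₃ * A * 16 ^ (n + 2)) with hC₈
  have hC₈1 : 1 ≤ C₈ := le_max_left _ _
  -- Comparing both sides of the weak type bound, λ is lowered to `α₀` since its exponent is
  -- positive. The powers of `α₀` then cancel up to an exponent at most `(n + 4) ω(16ρ)`, which is
  -- bounded by log-Hölder continuity, and only `r^(n+2) ≤ C ρ^(n+2)` remains.
  have fine : ∀ D : CoverSetting n pm pp L m q β₀, D.om (16 * D.ρ) ≤ ε / 2 →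
      ∀ z ∈ intrinsicCyl D.p D.d D.α₀ D.ρb D.z₀, ∀ r : ℝ, 0 < r →
      Disjoint (intrinsicCyl D.p D.d D.lam r z) D.good → r ≤ C₈ * D.ρ := by
    intro D ho z hz r hr hd
    have hρ := D.ρ_pos
    have hlam := D.lam_pos
    have hα0 := D.α₀_pos
    have ho0 : 0 ≤ D.om (16 * D.ρ) := D.logModulus.nonneg _ (by positivity)
    have hp0 := D.one_lt_p D.z₀
    have hpz := D.one_lt_p z
    -- The gap `1 - β ≥ η + ε` pays for the oscillation, which is at most `ε/2`.
    have hsm : (D.p D.z₀ + D.om (16 * D.ρ)) * η ≤ (D.p D.z₀ - D.om (16 * D.ρ)) * (1 - D.β) := by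
      have h5 : η + ε ≤ 1 - D.β := by linarith [D.β_lt]
      have h6 : (D.p D.z₀ - D.om (16 * D.ρ)) * (η + ε) ≤
          (D.p D.z₀ - D.om (16 * D.ρ)) * (1 - D.β) :=
        mul_le_mul_of_nonneg_left h5 (by linarith [hc.β₀_le])
      nlinarith [hc.β₀_le]
    have h5 := (h₄ D z r hd).trans (mul_le_mul_right
      (h₃ D (by linarith [hc.β₀_le]) hsm) _)
    rw [volume_intrinsicCyl _ _ hlam hr, volume_intrinsicCyl _ _ hα0 (by positivity),
      ← ENNReal.ofReal_mul (by positivity), ← ENNReal.ofReal_mul (by positivity),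
      ← ENNReal.ofReal_mul (by positivity), ENNReal.ofReal_le_ofReal_iff (by positivity)] at h5
    set o := D.om (16 * D.ρ) with hodef
    have h6 : D.α₀ ^ (η + volExp D.p D.d z) ≤ D.lam ^ η * D.lam ^ volExp D.p D.d z := by
      rw [← Real.rpow_add hlam]
      exact Real.rpow_le_rpow hα0.le D.α₀_le_lam
        (by linarith [D.le_volExp (hlarge D z hz)])
    have hosc := D.abs_p_sub_le D.ρb_pos D.ρb_le hz
    have hdiff : 4 * o + volExp D.p D.d D.z₀ - volExp D.p D.d z ≤ ((n : ℝ) + 4) * o := by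
      have h7 : 1 / D.p z - 1 / D.p D.z₀ ≤ o := by
        rw [div_sub_div _ _ (by linarith) (by linarith), div_le_iff₀ (by positivity)]
        have h8 := (abs_le.1 hosc).1
        have h9 : 1 ≤ D.p z * D.p D.z₀ := one_le_mul_of_one_le_of_one_le hpz.le hp0.le
        nlinarith
      have h8 : volExp D.p D.d D.z₀ - volExp D.p D.d z = n * (1 / D.p z - 1 / D.p D.z₀) := by
        unfold volExp; ring
      have h9 : (n : ℝ) * (1 / D.p z - 1 / D.p D.z₀) ≤ n * o := by gcongr
      linarith
    have hαA : D.α₀ ^ (4 * o + volExp D.p D.d D.z₀ - volExp D.p D.d z) ≤ A := by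
      refine D.logModulus.rpow_le (r := 16 * D.ρ) (by positivity) (by linarith [D.ρ_lt])
        D.one_le_α₀ ?_ hK₁ ?_ (by positivity) hdiff
      · exact one_le_mul_of_one_le_of_one_le hC₁ (Real.one_le_rpow (by norm_num) hK₁)
      · refine (h₁ D).trans_eq ?_
        rw [Real.mul_rpow (by norm_num) hρ.le, mul_assoc, ← mul_assoc (16 ^ K₁ : ℝ),
          ← Real.rpow_add (by norm_num), add_neg_cancel, Real.rpow_zero, one_mul]
    have h10 : r ^ (n + 2) ≤ C₄ * C₃ * A * 16 ^ (n + 2) * D.ρ ^ (n + 2) := by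
      have hpos : 0 < volConst n * D.α₀ ^ (η + volExp D.p D.d z) := by positivity
      refine le_of_mul_le_mul_left ?_ hpos
      calc volConst n * D.α₀ ^ (η + volExp D.p D.d z) * r ^ (n + 2)
          ≤ volConst n * (D.lam ^ η * D.lam ^ volExp D.p D.d z) * r ^ (n + 2) := by gcongr
        _ = D.lam ^ η * (volConst n * D.lam ^ volExp D.p D.d z * r ^ (n + 2)) := by ring
        _ ≤ _ := h5
        _ = volConst n * C₄ * C₃ * (D.α₀ ^ (η + 4 * o) * D.α₀ ^ volExp D.p D.d D.z₀) *
              (16 * D.ρ) ^ (n + 2) := by ring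
        _ = volConst n * C₄ * C₃ * (D.α₀ ^ (η + volExp D.p D.d z) *
              D.α₀ ^ (4 * o + volExp D.p D.d D.z₀ - volExp D.p D.d z)) *
              (16 * D.ρ) ^ (n + 2) := by
            rw [← Real.rpow_add hα0, ← Real.rpow_add hα0]; congr 3; ring
        _ ≤ volConst n * C₄ * C₃ * (D.α₀ ^ (η + volExp D.p D.d z) * A) *
              (16 * D.ρ) ^ (n + 2) := by gcongr
        _ = _ := by rw [mul_pow]; ring
    have h11 : (r / D.ρ) ^ (n + 2) ≤ C₄ * C₃ * A * 16 ^ (n + 2) := by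
      rw [div_pow, div_le_iff₀ (by positivity)]; exact h10
    have h12 := le_max_one_of_pow_le (by omega) h11
    rwa [div_le_iff₀ hρ] at h12
  set c := Real.exp (-(L / (ε / 2))) / 16 with hcdef
  have hc0 : 0 < c := by positivity
  set C₉ := C₅ * c ^ (-K₂) with hC₉
  have hC₉0 : 0 < C₉ := by positivity
  set C₁₀ := max 1 C₉ with hC₁₀
  have hC₁₀1 : 1 ≤ C₁₀ := le_max_left _ _
  refine ⟨max 1 (max (C₅ * C₈ ^ K₂) (C₉ * C₁₀ ^ K₂)), ((n + 2 : ℕ) : ℝ) + K₂, le_max_left _ _,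
    by positivity, fun D z hz r hr hd => ?_⟩
  have hρ := D.ρ_pos
  have hcr := crude D z hz r hr hd
  rw [Real.rpow_add hr, Real.rpow_natCast, ← mul_assoc]
  refine le_max_of_le_right ?_
  -- Below this threshold the oscillation is at most `ε/2`, so `r ≤ C₈ρ` converts the factor
  -- `ρ^(-K₂)` of the crude bound into `r^(-K₂)`. Above it ρ is bounded below; the crude bound then
  -- also bounds `r`, since `λ ≥ 1`.
  by_cases hsmall : 16 * D.ρ ≤ Real.exp (-(L / (ε / 2)))
  · refine le_max_of_le_left ?_
    have ho := D.logModulus.le_of_le_exp hL (by positivity) (by linarith [D.ρ_lt])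
      (half_pos hε0) hsmall
    have hrρ := fine D ho z hz r hr hd
    calc D.lam ^ (β₀ / 2) * r ^ (n + 2) * r ^ K₂
        ≤ C₅ * D.ρ ^ (-K₂) * (C₈ * D.ρ) ^ K₂ := by gcongr
      _ = C₅ * C₈ ^ K₂ * (D.ρ ^ (-K₂) * D.ρ ^ K₂) := by
          rw [Real.mul_rpow (by positivity) hρ.le]; ring
      _ = _ := by rw [← Real.rpow_add hρ, neg_add_cancel, Real.rpow_zero, mul_one]
  · refine le_max_of_le_right ?_
    push Not at hsmall
    have hcρ : c ≤ D.ρ := by rw [hcdef]; linarith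
    have h5 : D.lam ^ (β₀ / 2) * r ^ (n + 2) ≤ C₉ := by
      refine hcr.trans ?_
      rw [hC₉]
      refine mul_le_mul_of_nonneg_left ?_ hC₅0.le
      exact Real.rpow_le_rpow_of_nonpos hc0 hcρ (by linarith)
    have h6 : r ≤ C₁₀ := by
      refine le_max_one_of_pow_le (k := n + 2) (by omega) (le_trans ?_ h5)
      exact le_mul_of_one_le_left (by positivity) (Real.one_le_rpow D.one_le_lam (by linarith))
    gcongr

end FixedConstants

/-! ### The covering -/

theorem isOpen_lt_strongMaximal {n : ℕ} (f : SpaceTime n → ℝ≥0∞) (s : ℝ≥0∞) :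
    IsOpen {z | s < strongMaximal f z} := by
  refine isOpen_iff_mem_nhds.2 fun z hz => ?_
  simp only [strongMaximal, mem_ofPred_eq, lt_iSup_iff] at hz
  obtain ⟨c, a, b, ha, hb, hzc, hlt⟩ := hz
  refine mem_of_superset ((Metric.isOpen_ball.prod isOpen_Ioo).mem_nhds hzc) fun w hw => ?_
  simp only [strongMaximal, mem_ofPred_eq, lt_iSup_iff]
  exact ⟨c, a, b, ha, hb, hw, hlt⟩

/-- The strong maximal function is lower semicontinuous because the averaging cylinders are open and
need only contain the point. Closedness is what makes the distance to the good set positive. -/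
theorem isClosed_goodSet {n : ℕ} (p : SpaceTime n → ℝ) (d q β α₀ ρ ρb : ℝ) (z₀ : SpaceTime n)
    (u : SpaceTime n → ℝ) (Du : SpaceTime n → EuclideanSpace ℝ (Fin n)) (lam : ℝ)
    (hqβ : 0 < q * (1 - β)) : IsClosed (goodSet p d q β α₀ ρ ρb z₀ u Du lam) := by
  rw [← isOpen_compl_iff]
  convert isOpen_lt_strongMaximal ((intrinsicCyl p d α₀ ρb z₀).indicator fun w =>
    ENNReal.ofReal ((‖Du w‖ + 1 + |u w| / (scaleX p d α₀ z₀ * ρ)) ^ (p w / q)))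
    (ENNReal.ofReal (lam ^ (1 - β)) ^ (q * (1 - β))⁻¹) using 1
  ext z
  rw [mem_compl_iff, goodSet, mem_ofPred_eq, mem_ofPred_eq, not_le, gFun,
    ENNReal.rpow_inv_lt_iff hqβ]

/-- Passing through a common point costs two radii of the first cylinder and one of the second: `2 ·
2C + 1` in space. In time the sum is `2 · 4 + 1 = 9` times `rb ^ 2`, well below `(9 * rb) ^ 2`. -/
theorem intrinsicCyl_subset_of_inter_nonempty {n : ℕ} {p : SpaceTime n → ℝ} {d μ ra rb C X : ℝ}
    {a b : SpaceTime n} (hμ : 0 < μ) (hra : 0 < ra) (hrab : ra ≤ 2 * rb)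
    (hC : scaleX p d μ a ≤ C * scaleX p d μ b) (hX : 9 ≤ X) (hXC : 4 * C + 1 ≤ X)
    (hne : (intrinsicCyl p d μ ra a ∩ intrinsicCyl p d μ rb b).Nonempty) :
    intrinsicCyl p d μ ra a ⊆ intrinsicCyl p d μ (X * rb) b := by
  obtain ⟨w, ⟨hwa1, hwa2⟩, hwb1, hwb2⟩ := hne
  have hrb : 0 < rb := by linarith
  have hσb : 0 < scaleX p d μ b := Real.rpow_pos_of_pos hμ _
  have hσa : 0 < scaleX p d μ a := Real.rpow_pos_of_pos hμ _
  have hT : 0 < scaleT d μ := Real.rpow_pos_of_pos hμ _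
  rintro y ⟨hy1, hy2⟩
  rw [Metric.mem_ball] at hwa1 hwb1 hy1
  have h1 : scaleX p d μ a * ra ≤ (C * scaleX p d μ b) * (2 * rb) :=
    mul_le_mul hC hrab hra.le (hσa.le.trans hC)
  have h2 : scaleT d μ * ra ^ 2 ≤ scaleT d μ * (2 * rb) ^ 2 := by gcongr
  have h3 : scaleT d μ * (9 * rb) ^ 2 ≤ scaleT d μ * (X * rb) ^ 2 := by gcongr
  have h4 : (4 * C + 1) * (scaleX p d μ b * rb) ≤ X * (scaleX p d μ b * rb) := by gcongr
  have h5 : 0 < scaleT d μ * rb ^ 2 := by positivity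
  refine ⟨Metric.mem_ball.2 ?_, ?_, ?_⟩
  · have := dist_triangle y.1 a.1 b.1
    have := dist_triangle_left a.1 b.1 w.1
    linarith
  · linarith [hy2.1, hwa2.2, hwb2.1]
  · linarith [hy2.2, hwa2.1, hwb2.2]

/-! ### Nonemptiness of the good set and bounds on the radii. -/

namespace CoverSetting

variable {n : ℕ} {pm pp L m q β₀ : ℝ} (D : CoverSetting n pm pp L m q β₀)

/-- The bad set of a `CoverSetting`. -/
abbrev bad : Set (SpaceTime n) :=
  badSet D.p D.d q D.β D.α₀ D.ρ D.ρb D.z₀ D.u D.Du D.lam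

/-- The radius `ρ_z`. -/
abbrev rad (z : SpaceTime n) : ℝ :=
  coverRadius D.p D.d q D.β D.α₀ D.ρ D.ρb D.z₀ D.u D.Du D.lam z

theorem bad_subset_largeCyl : D.bad ⊆ largeCyl D.ρ₀ D.z₀ := fun _ hz =>
  D.intrinsicCyl_subset_largeCyl D.ρb_pos D.ρb_le hz.1

theorem locDist_nonneg {p : SpaceTime n → ℝ} {d μ : ℝ} (z z₁ z₂ : SpaceTime n) :
    0 ≤ locDist p d μ z z₁ z₂ :=
  le_max_of_le_right (Real.sqrt_nonneg _)

theorem rad_le_locDist {w : SpaceTime n} (hw : w ∈ D.good) (z : SpaceTime n) :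
    D.rad z ≤ locDist D.p D.d D.lam z z w :=
  csInf_le ⟨0, forall_mem_image.2 fun _ _ => locDist_nonneg _ _ _⟩ (mem_image_of_mem _ hw)

theorem disjoint_intrinsicCyl_good {z : SpaceTime n} (hz : 0 < D.rad z) :
    Disjoint (intrinsicCyl D.p D.d D.lam (D.rad z) z) D.good :=
  disjoint_left.2 fun _ hw hwg =>
    ((mem_intrinsicCyl_iff D.lam_pos hz).1 hw).not_ge (D.rad_le_locDist hwg z)

/-- If the good set were empty, cylinders of every radius would miss it, contradicting the bound on
`λ^(β₀/2) r^N` for large `r`. -/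
theorem good_nonempty : D.good.Nonempty := by
  obtain ⟨C, N, hC, hN, h⟩ := D.const.exists_lam_rpow_mul_le
  by_contra hne
  rw [not_nonempty_iff_eq_empty] at hne
  have hz : D.z₀ ∈ intrinsicCyl D.p D.d D.α₀ D.ρb D.z₀ :=
    (mem_intrinsicCyl_iff D.α₀_pos D.ρb_pos).2 (by simp [locDist, D.ρb_pos])
  have h1 := h D D.z₀ hz ((C + 1) ^ (1 / N)) (by positivity) (by rw [hne]; exact disjoint_empty _)
  rw [← Real.rpow_mul (by positivity), one_div_mul_cancel hN.ne', Real.rpow_one] at h1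
  have h2 : 1 ≤ D.lam ^ (β₀ / 2) :=
    Real.one_le_rpow D.one_le_lam (by linarith [D.const.β₀_pos])
  nlinarith

theorem rad_pos {z : SpaceTime n} (hz : z ∈ D.bad) : 0 < D.rad z := by
  have hqβ : 0 < q * (1 - D.β) :=
    mul_pos (by linarith [D.const.one_lt_q]) D.one_sub_β_pos
  have hopen : D.goodᶜ ∈ 𝓝 z :=
    (isClosed_goodSet _ _ _ _ _ _ _ _ _ _ _ hqβ).isOpen_compl.mem_nhds hz.2
  obtain ⟨δ, hδ, hsub⟩ := Metric.mem_nhds_iff.1 hopen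
  have hzL := D.bad_subset_largeCyl hz
  have hX := D.scaleX_le_one hzL D.one_le_lam
  have hT := D.scaleT_le_one D.one_le_lam
  set r := min δ 1 with hr
  have hr0 : 0 < r := lt_min hδ one_pos
  have hr1 : r ≤ 1 := min_le_right _ _
  have hrδ : r ≤ δ := min_le_left _ _
  -- Nonemptiness of the good set matters here: the infimum over an empty set would be the default
  -- value 0.
  refine hr0.trans_le (le_csInf (D.good_nonempty.image _) (forall_mem_image.2 fun w hw => ?_))
  by_contra hlt
  have hwQ := (mem_intrinsicCyl_iff D.lam_pos hr0).2 (not_le.1 hlt)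
  refine hsub (Metric.mem_ball.2 ?_) hw
  rw [Prod.dist_eq]
  refine max_lt ((Metric.mem_ball.1 hwQ.1).trans_le
    ((mul_le_of_le_one_left hr0.le hX).trans hrδ)) ?_
  have h1 : scaleT D.d D.lam * r ^ 2 ≤ δ := by
    calc scaleT D.d D.lam * r ^ 2 ≤ r ^ 2 := mul_le_of_le_one_left (sq_nonneg r) hT
      _ ≤ r := pow_le_of_le_one hr0.le hr1 two_ne_zero
      _ ≤ δ := hrδ
  rw [Real.dist_eq, abs_lt]
  exact ⟨by linarith [hwQ.2.1], by linarith [hwQ.2.2]⟩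

theorem exists_rad_le : ∃ R : ℝ, ∀ z ∈ D.bad, D.rad z ≤ R := by
  obtain ⟨C, N, hC, hN, h⟩ := D.const.exists_lam_rpow_mul_le
  refine ⟨C ^ (1 / N), fun z hz => ?_⟩
  have hr := D.rad_pos hz
  have h1 := h D z hz.1 _ hr (D.disjoint_intrinsicCyl_good hr)
  have h2 : 1 ≤ D.lam ^ (β₀ / 2) :=
    Real.one_le_rpow D.one_le_lam (by linarith [D.const.β₀_pos])
  have h3 : D.rad z ^ N ≤ C := (le_mul_of_one_le_left (by positivity) h2).trans h1
  calc D.rad z = (D.rad z ^ N) ^ (1 / N) := by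
        rw [← Real.rpow_mul hr.le, mul_one_div_cancel hN.ne', Real.rpow_one]
    _ ≤ _ := by gcongr

theorem parDist_le_of_inter_nonempty {a b : SpaceTime n} (ha : a ∈ D.bad) (hb : b ∈ D.bad)
    (hne : (intrinsicCyl D.p D.d D.lam (D.rad a) a ∩
      intrinsicCyl D.p D.d D.lam (D.rad b) b).Nonempty) :
    parDist a b ≤ D.rad a + D.rad b := by
  obtain ⟨w, hwa, hwb⟩ := hne
  have hra := D.rad_pos ha
  have hrb := D.rad_pos hb
  have h1 := D.parDist_le_of_mem D.one_le_lam hra (D.bad_subset_largeCyl ha) hwa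
  have h2 := D.parDist_le_of_mem D.one_le_lam hrb (D.bad_subset_largeCyl hb) hwb
  simp only [parDist, max_le_iff] at h1 h2 ⊢
  rw [Real.sqrt_le_left hra.le] at h1
  rw [Real.sqrt_le_left hrb.le] at h2
  refine ⟨?_, ?_⟩
  · have := norm_sub_le_norm_sub_add_norm_sub a.1 w.1 b.1
    rw [norm_sub_rev a.1 w.1] at this
    linarith [h1.1, h2.1]
  · rw [Real.sqrt_le_left (by positivity)]
    have := abs_sub_le a.2 w.2 b.2
    rw [abs_sub_comm a.2 w.2] at this
    nlinarith [h1.2, h2.2, mul_pos hra hrb]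

end CoverSetting

/-- The ratio of the scalings is `λ^(1/p(b) - 1/p(a))`, whose exponent is at most `ω(3 ρ_b)` since
the centres are within parabolic distance `ρ_a + ρ_b ≤ 3 ρ_b`. As λ is polynomial in `1/ρ_b`, the
log-Hölder bound applies for `3 ρ_b ≤ 1/2`. For larger radii λ itself is bounded by `A * 6 ^ K` and
the exponent by 1. -/
theorem FixedConstants.exists_scaleX_le {n : ℕ} {pm pp L m q β₀ : ℝ}
    (hc : FixedConstants n pm pp L m q β₀) : ∃ C : ℝ,
    ∀ D : CoverSetting n pm pp L m q β₀, ∀ a ∈ D.bad, ∀ b ∈ D.bad,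
      (intrinsicCyl D.p D.d D.lam (D.rad a) a ∩
        intrinsicCyl D.p D.d D.lam (D.rad b) b).Nonempty → D.rad a ≤ 2 * D.rad b →
      scaleX D.p D.d D.lam a ≤ C * scaleX D.p D.d D.lam b := by
  obtain ⟨C, N, hC, hN, h⟩ := hc.exists_lam_rpow_mul_le
  have hβ₀ := hc.β₀_pos
  set K := 2 * N / β₀ with hK
  have hK0 : 0 < K := by positivity
  set A := C ^ (2 / β₀) with hA
  have hA1 : 1 ≤ A := Real.one_le_rpow hC (by positivity)
  refine ⟨max (Real.exp (1 * (L / Real.log 2 * Real.log (A * 3 ^ K) + K * L))) (A * 6 ^ K),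
    fun D a ha b hb hne hab => ?_⟩
  have hlam := D.lam_pos
  have hlam1 := D.one_le_lam
  have hr := D.rad_pos hb
  have hle : D.lam ≤ A * D.rad b ^ (-K) := by
    have h1 := h D b hb.1 _ hr (D.disjoint_intrinsicCyl_good hr)
    rw [← le_div_iff₀ (by positivity)] at h1
    calc D.lam = (D.lam ^ (β₀ / 2)) ^ (2 / β₀) := by
          rw [← Real.rpow_mul hlam.le, div_mul_div_cancel₀ two_ne_zero, div_self hβ₀.ne',
            Real.rpow_one]
      _ ≤ (C / D.rad b ^ N) ^ (2 / β₀) := by gcongr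
      _ = A * D.rad b ^ (-K) := by
          rw [div_eq_mul_inv, ← Real.rpow_neg hr.le, Real.mul_rpow (by positivity) (by positivity),
            ← Real.rpow_mul hr.le, hA, hK]
          congr 2; ring
  have hpa := D.one_lt_p a
  have hpb := D.one_lt_p b
  have hpar : parDist a b ≤ 3 * D.rad b := by
    linarith [D.parDist_le_of_inter_nonempty ha hb hne]
  have hpar0 : 0 ≤ parDist a b := le_max_of_le_left (norm_nonneg _)
  have he : 1 / D.p b - 1 / D.p a ≤ D.om (3 * D.rad b) := by
    have h1 := (D.logModulus.bound a b).trans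
      (D.logModulus.mono (mem_Ici.2 hpar0) (mem_Ici.2 (hpar0.trans hpar)) hpar)
    rw [div_sub_div _ _ (by linarith) (by linarith), div_le_iff₀ (by nlinarith)]
    have h2 := (abs_le.1 h1).2
    have h3 : 1 ≤ D.p b * D.p a := one_le_mul_of_one_le_of_one_le hpb.le hpa.le
    nlinarith [D.logModulus.nonneg _ (hpar0.trans hpar)]
  have hbound : D.lam ^ (1 / D.p b - 1 / D.p a) ≤
      max (Real.exp (1 * (L / Real.log 2 * Real.log (A * 3 ^ K) + K * L))) (A * 6 ^ K) := by
    by_cases h3 : 3 * D.rad b ≤ 1 / 2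
    · refine le_max_of_le_left (D.logModulus.rpow_le (r := 3 * D.rad b) (by positivity) h3 hlam1
        (one_le_mul_of_one_le_of_one_le hA1 (Real.one_le_rpow (by norm_num) hK0.le)) hK0.le
        (hle.trans_eq ?_) zero_le_one (by rwa [one_mul]))
      rw [Real.mul_rpow (by norm_num) hr.le, mul_assoc, ← mul_assoc (3 ^ K : ℝ),
        ← Real.rpow_add (by norm_num), add_neg_cancel, Real.rpow_zero, one_mul]
    · refine le_max_of_le_right ?_
      have h4 : 1 / D.p b - 1 / D.p a ≤ 1 := by
        have : 1 / D.p b ≤ 1 := (div_le_one (by linarith)).2 hpb.le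
        have : 0 < 1 / D.p a := by positivity
        linarith
      calc D.lam ^ (1 / D.p b - 1 / D.p a) ≤ D.lam ^ (1 : ℝ) :=
            Real.rpow_le_rpow_of_exponent_le hlam1 h4
        _ ≤ A * D.rad b ^ (-K) := by rwa [Real.rpow_one]
        _ ≤ A * (1 / 6) ^ (-K) := by
            refine mul_le_mul_of_nonneg_left ?_ (by linarith)
            exact Real.rpow_le_rpow_of_nonpos (by norm_num) (by linarith) (by linarith)
        _ = _ := by rw [one_div, Real.inv_rpow (by norm_num), Real.rpow_neg (by norm_num), inv_inv]
  have hsplit : scaleX D.p D.d D.lam a =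
      D.lam ^ (1 / D.p b - 1 / D.p a) * scaleX D.p D.d D.lam b := by
    rw [scaleX, scaleX, ← Real.rpow_add hlam]; congr 1; ring
  rw [hsplit]
  exact mul_le_mul_of_nonneg_right hbound (Real.rpow_pos_of_pos hlam _).le

/-- The Vitali covering of the bad set by intrinsic cylinders. -/
theorem CoverSetting.exists_covering {n : ℕ} {pm pp L m q β₀ : ℝ}
    (D : CoverSetting n pm pp L m q β₀) {C X : ℝ} (hX : 9 ≤ X) (hXC : 4 * C + 1 ≤ X)
    (hscale : ∀ a ∈ D.bad, ∀ b ∈ D.bad,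
      (intrinsicCyl D.p D.d D.lam (D.rad a) a ∩
        intrinsicCyl D.p D.d D.lam (D.rad b) b).Nonempty → D.rad a ≤ 2 * D.rad b →
      scaleX D.p D.d D.lam a ≤ C * scaleX D.p D.d D.lam b) {t : ℝ} (ht : t ∈ Ioo (0 : ℝ) 1) :
    ∃ S : Set (SpaceTime n), S ⊆ D.bad ∧ S.Countable ∧
      S.PairwiseDisjoint (fun z => intrinsicCyl D.p D.d D.lam (t * D.rad z) z) ∧
      (⋃ z ∈ D.bad, intrinsicCyl D.p D.d D.lam (t * D.rad z) z) ⊆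
        (⋃ z ∈ S, intrinsicCyl D.p D.d D.lam (X * (t * D.rad z)) z) ∧
      (⋃ z ∈ D.bad, intrinsicCyl D.p D.d D.lam (D.rad z) z) ⊆
        (⋃ z ∈ S, intrinsicCyl D.p D.d D.lam (X * D.rad z) z) := by
  obtain ⟨R, hR⟩ := D.exists_rad_le
  have hlam := D.lam_pos
  have hpos : ∀ z ∈ D.bad, 0 < t * D.rad z := fun z hz => mul_pos ht.1 (D.rad_pos hz)
  have hne : ∀ z ∈ D.bad, (intrinsicCyl D.p D.d D.lam (t * D.rad z) z).Nonempty := fun z hz =>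
    ⟨z, (mem_intrinsicCyl_iff hlam (hpos z hz)).2 (by simpa [locDist] using hpos z hz)⟩
  -- Vitali's lemma is run on the shrunken cylinders but with the unshrunken radii as size function.
  -- Shrunken cylinders that meet have unshrunken ones that meet, so one family serves both
  -- inclusions.
  obtain ⟨S, hSb, hdisj, hcov⟩ := Vitali.exists_disjoint_subfamily_covering_enlargement
    (fun z => intrinsicCyl D.p D.d D.lam (t * D.rad z) z) D.bad D.rad 2 one_lt_two
    (fun z hz => (D.rad_pos hz).le) R hR hne
  have hsub : ∀ z ∈ D.bad, intrinsicCyl D.p D.d D.lam (t * D.rad z) z ⊆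
      intrinsicCyl D.p D.d D.lam (D.rad z) z := fun z hz =>
    CoverSetting.intrinsicCyl_mono (hpos z hz)
      (mul_le_of_le_one_left (D.rad_pos hz).le ht.2.le) _ _ hlam _
  refine ⟨S, hSb, hdisj.countable_of_isOpen (fun z _ => Metric.isOpen_ball.prod isOpen_Ioo)
    (fun z hz => hne z (hSb hz)), hdisj, ?_, ?_⟩
  · refine iUnion₂_subset fun a ha => ?_
    obtain ⟨b, hb, hint, hab⟩ := hcov a ha
    have hint' := hint.mono (inter_subset_inter (hsub a ha) (hsub b (hSb hb)))
    refine subset_iUnion₂_of_subset b hb ?_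
    refine intrinsicCyl_subset_of_inter_nonempty hlam (hpos a ha) ?_
      (hscale a ha b (hSb hb) hint' hab) hX hXC hint
    have := mul_le_mul_of_nonneg_left hab ht.1.le
    linarith
  · refine iUnion₂_subset fun a ha => ?_
    obtain ⟨b, hb, hint, hab⟩ := hcov a ha
    have hint' := hint.mono (inter_subset_inter (hsub a ha) (hsub b (hSb hb)))
    refine subset_iUnion₂_of_subset b hb ?_
    exact intrinsicCyl_subset_of_inter_nonempty hlam (D.rad_pos ha) hab
      (hscale a ha b (hSb hb) hint' hab) hX hXC hint'

end VarExpParabolic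

end

theorem mainTheorem4 (n : ℕ) (hn : 1 ≤ n) (pm pp L m q β₀ : ℝ)
    (hpm_one : 1 < pm) (hpm : 2 * (n : ℝ) / ((n : ℝ) + 2) < pm) (hL : 0 < L) (hm : 0 < m)
    (hq : 1 < q) (hβ₀ : 0 < β₀) (hβ₀q : β₀ < 1 - 1 / q) (hβ₀half : β₀ ≤ 1 / 2)
    (hβ₀pm : 2 * (n : ℝ) / ((n : ℝ) + 2) < pm - β₀) :
    ∃ X : ℝ, 9 ≤ X ∧
      ∀ (p : VarExpParabolic.SpaceTime n → ℝ) (om : ℝ → ℝ),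
        VarExpParabolic.IsLogHolderExponent pm pp L p →
        VarExpParabolic.IsLogModulus L p om →
      ∀ (Ω : Set (EuclideanSpace ℝ (Fin n))) (T : ℝ),
        VarExpParabolic.IsMeasureDensityDomain m Ω → 0 < T →
      ∀ (Λ₀ Λ₁ h₁ : ℝ)
        (𝒜 : VarExpParabolic.SpaceTime n → EuclideanSpace ℝ (Fin n) → EuclideanSpace ℝ (Fin n)),
        0 < Λ₀ → 0 < Λ₁ →
        VarExpParabolic.IsAdmissibleOperator Ω T p Λ₀ Λ₁ h₁ 𝒜 →
      ∀ (β : ℝ) (u : VarExpParabolic.SpaceTime n → ℝ)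
        (Du : VarExpParabolic.SpaceTime n → EuclideanSpace ℝ (Fin n)),
        0 < β → β < β₀ →
        VarExpParabolic.IsVeryWeakSolution Ω T β p 𝒜 u Du →
      ∀ (z₀ : VarExpParabolic.SpaceTime n) (ρ₀ d : ℝ),
        z₀.1 ∈ frontier Ω → z₀.2 ∈ Set.Ioo (-T) T →
        VarExpParabolic.RadiusRestrictions p om L (VarExpParabolic.energy Ω T β p u Du) ρ₀ z₀ →
        VarExpParabolic.ExponentRestrictions p q β₀ d ρ₀ z₀ →
      ∀ (α₀ ρ ρa ρb lam : ℝ),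
        1 ≤ α₀ → 0 < ρ → 128 * ρ ≤ ρ₀ →
        VarExpParabolic.StoppingCondition p d β α₀ ρ z₀ Du →
        ρ ≤ ρa → ρa < ρb → ρb ≤ 16 * ρ →
        α₀ ≤ lam →
        (VarExpParabolic.goodSet p d q β α₀ ρ ρb z₀ u Du lam).Nonempty ∧
        (∀ z ∈ VarExpParabolic.badSet p d q β α₀ ρ ρb z₀ u Du lam,
          0 < VarExpParabolic.coverRadius p d q β α₀ ρ ρb z₀ u Du lam z) ∧
        ∀ t ∈ Set.Ioo (0 : ℝ) 1,
          ∃ S : Set (VarExpParabolic.SpaceTime n),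
            S ⊆ VarExpParabolic.badSet p d q β α₀ ρ ρb z₀ u Du lam ∧ S.Countable ∧
            S.PairwiseDisjoint (fun z => VarExpParabolic.intrinsicCyl p d lam
              (t * VarExpParabolic.coverRadius p d q β α₀ ρ ρb z₀ u Du lam z) z) ∧
            (⋃ z ∈ VarExpParabolic.badSet p d q β α₀ ρ ρb z₀ u Du lam,
              VarExpParabolic.intrinsicCyl p d lam
                (t * VarExpParabolic.coverRadius p d q β α₀ ρ ρb z₀ u Du lam z) z) ⊆
            (⋃ z ∈ S, VarExpParabolic.intrinsicCyl p d lam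
                (X * (t * VarExpParabolic.coverRadius p d q β α₀ ρ ρb z₀ u Du lam z)) z) ∧
            (⋃ z ∈ VarExpParabolic.badSet p d q β α₀ ρ ρb z₀ u Du lam,
              VarExpParabolic.intrinsicCyl p d lam
                (VarExpParabolic.coverRadius p d q β α₀ ρ ρb z₀ u Du lam z) z) ⊆
            (⋃ z ∈ S, VarExpParabolic.intrinsicCyl p d lam
                (X * VarExpParabolic.coverRadius p d q β α₀ ρ ρb z₀ u Du lam z) z) := by
  -- If the bounds are in the wrong order no admissible exponent exists, as seen at the origin, and
  -- any constant works.
  by_cases hpp : pm ≤ pp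
  swap
  · refine ⟨9, le_rfl, fun p om hp => absurd ((hp.lower 0).trans (hp.upper 0)) hpp⟩
  have hc : VarExpParabolic.FixedConstants n pm pp L m q β₀ :=
    ⟨hn, hpm_one, hpp, hL, hm, hq, hβ₀, hβ₀q, hβ₀half⟩
  obtain ⟨C, hC⟩ := hc.exists_scaleX_le
  refine ⟨max 9 (4 * C + 1), le_max_left _ _, ?_⟩
  intro p om hp hom Ω T hΩ _ _ _ _ _ _ _ _ β u Du hβ hββ₀ hu z₀ ρ₀ d hz₀ _ hrad hexp
    α₀ ρ ρa ρb lam hα₀ hρ hρρ₀ hav hρa hρab hρb hlam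
  let D : VarExpParabolic.CoverSetting n pm pp L m q β₀ :=
    { const := hc, p := p, om := om, Ω := Ω, T := T, β := β, u := u, Du := Du, z₀ := z₀,
      ρ₀ := ρ₀, d := d, α₀ := α₀, ρ := ρ, ρb := ρb, lam := lam, logHolder := hp,
      logModulus := hom, domain := hΩ, β_pos := hβ, β_lt := hββ₀, exponent := hu.exponent,
      mem := hu.mem, boundary := hz₀, radius := hrad, exps := hexp, one_le_α₀ := hα₀,
      ρ_pos := hρ, ρ_le := hρρ₀, stopping := hav, ρ_lt_ρb := hρa.trans_lt hρab,
      ρb_le := hρb, α₀_le_lam := hlam }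
  exact ⟨D.good_nonempty, fun z hz => D.rad_pos hz, fun t ht =>
    D.exists_covering (le_max_left _ _) (le_max_right _ _) (hC D) ht⟩
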